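/- **Setting.** On $L^2(\mathbb R^3)$ (complex-valued functions) and for $\beta\ge 0$ let $H_\beta=(-i\nabla+\beta\,\mathbf a)^2$ with $\mathbf a(\mathbf x)=\tfrac12\,\mathbf e\times\mathbf x$, $\mathbf e=(0,0,1)$, understood as the self-adjoint operator of the closed quadratic form $\psi\mapsto\|(-i\nabla+\beta\mathbf a)\psi\|^2$, whose form domain is the set of $\psi\in L^2$ with $(-i\nabla+\beta\mathbf a)\psi\in L^2$ in the weak sense. A density matrix is a non-negative trace class operator $\Gamma$ on $L^2(\mathbb R^3)$. If $\Gamma=\sum_k w_k|\psi_k\rangle\langle\psi_k|$ is a diagonalization of $\Gamma$ with orthonormal $\psi_k$, then $\rho_\Gamma=\sum_k w_k|\psi_k|^2$ is its density, and $\mathrm{Tr}[H_\beta\Gamma]=\sum_k w_k\|(-i\nabla+\beta\mathbf a)\psi_k\|^2\in[0,\infty]$ (a summand with $w_k>0$ and $\psi_k$ outside of the form domain is $\infty$, and a summand with $w_k=0$ is $0$). On the domain of all density matrices with $\mathrm{Tr}[H_\beta\Gamma]<\infty$ the magnetic Hartree functional is $$\mathcal E^{\rm MH}_\beta[\Gamma]=\mathrm{Tr}[(H_\beta-\beta)\Gamma]-\int\frac{\rho_\Gamma(\mathbf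 x)}{|\mathbf x|}\,d^3\mathbf x+D[\rho_\Gamma,\rho_\Gamma],\qquad D[\rho,\rho]=\frac12\iint\frac{\rho(\mathbf x)\rho(\mathbf y)}{|\mathbf x-\mathbf y|}\,d^3\mathbf x\,d^3\mathbf y,$$ where $\mathrm{Tr}[(H_\beta-\beta)\Gamma]=\mathrm{Tr}[H_\beta\Gamma]-\beta\,\mathrm{Tr}[\Gamma]$, and the Hartree energy is $$E^{\rm MH}(\lambda,\beta)=\inf\{\mathcal E^{\rm MH}_\beta[\Gamma]:\ \mathrm{Tr}[H_\beta\Gamma]<\infty,\ \mathrm{Tr}[\Gamma]=\lambda\}.$$ **Theorem (Existence of a minimizer).** Let $\beta\ge 0$ and $\lambda>0$. 1. The functional is well defined: $\int\rho_\Gamma/|\mathbf x|<\infty$ and $D[\rho_\Gamma,\rho_\Gamma]<\infty$ whenever $\mathrm{Tr}[H_\beta\Gamma]<\infty$. The infimum defining $E^{\rm MH}(\lambda,\beta)$ is over a non-empty set of real numbers which is bounded below. 2. There is a density matrix $\Gamma^{\rm H}$ with $\mathrm{Tr}[H_\beta\Gamma^{\rm H}]<\infty$ and $\mathrm{Tr}[\Gamma^{\rm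 H}]\le\lambda$ which minimizes $\mathcal E^{\rm MH}_\beta$ among all density matrices $\Gamma$ with $\mathrm{Tr}[H_\beta\Gamma]<\infty$ and $\mathrm{Tr}[\Gamma]\le\lambda$, and it satisfies $E^{\rm MH}(\lambda,\beta)=\mathcal E^{\rm MH}_\beta[\Gamma^{\rm H}]$. 3. The density of the minimizer is unique: any two minimizers of $\mathcal E^{\rm MH}_\beta$ under the condition $\mathrm{Tr}[\Gamma]\le\lambda$ have densities that agree almost everywhere. -/

import Mathlib

open MeasureTheory Filter Topology
open scoped ENNReal NNReal ContDiff InnerProductSpace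

noncomputable section

namespace MagneticHartree

/-! ### Diagonalization of positive trace class operators -/

section Diagonalization

universe u

variable {H : Type u} [NormedAddCommGroup H] [InnerProductSpace ℂ H]

theorem norm_sub_sum_sq_le {κ : Type*} (b : HilbertBasis κ ℂ H) (F : Finset κ) (y : H) (c : κ → ℝ)
    (hc : Summable c) (hy : ∀ i, ‖⟪b i, y⟫_ℂ‖ ^ 2 ≤ c i) :
    ‖y - ∑ i ∈ F, ⟪b i, y⟫_ℂ • b i‖ ^ 2 ≤ ∑' i : { i // i ∉ F }, c i := by
  classical
  set z := y - ∑ i ∈ F, ⟪b i, y⟫_ℂ • b i with hz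
  have hcoef : ∀ i, ⟪b i, z⟫_ℂ = if i ∈ F then 0 else ⟪b i, y⟫_ℂ := by
    intro i
    rw [hz, inner_sub_right, inner_sum]
    simp only [inner_smul_right, orthonormal_iff_ite.mp b.orthonormal]
    split_ifs with h <;> simp [h]
  have h1 := b.hasSum_inner_mul_inner z z
  have h2 : HasSum (fun i => ‖⟪b i, z⟫_ℂ‖ ^ 2) (‖z‖ ^ 2) := by
    have := Complex.hasSum_re h1
    rw [show (⟪z, z⟫_ℂ).re = ‖z‖ ^ 2 from inner_self_eq_norm_sq (𝕜 := ℂ) z] at this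
    refine this.congr_fun ?_ |> fun h => h
    intro i
    rw [← inner_conj_symm z (b i), ← Complex.normSq_eq_conj_mul_self, Complex.ofReal_re,
      Complex.normSq_eq_norm_sq]
  have h3 : HasSum (fun i : {i // i ∉ F} => ‖⟪b i, z⟫_ℂ‖ ^ 2) (‖z‖ ^ 2) := by
    refine (hasSum_subtype_iff_of_support_subset (s := {i | i ∉ F}) ?_).2 h2
    intro i hi hF
    exact hi (by simp [hcoef, hF])
  rw [← h3.tsum_eq]
  refine h3.summable.tsum_le_tsum (fun i => ?_) (hc.subtype _)
  rw [hcoef, if_neg i.2]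
  exact hy i

theorem isCompactOperator_of_summable [CompleteSpace H] {T : H →L[ℂ] H} (hT : T.IsPositive)
    {κ : Type*} (b : HilbertBasis κ ℂ H) (hs : Summable fun i => (⟪b i, T (b i)⟫_ℂ).re) :
    IsCompactOperator T := by
  classical
  set S : H →L[ℂ] H := CFC.sqrt T with hS
  have hSpos : S.IsPositive := (ContinuousLinearMap.nonneg_iff_isPositive _).1 (CFC.sqrt_nonneg T)
  have hSS : S * S = T :=
    CFC.sqrt_mul_sqrt_self T ((ContinuousLinearMap.nonneg_iff_isPositive _).2 hT)
  have hsym : ∀ x y, ⟪S x, y⟫_ℂ = ⟪x, S y⟫_ℂ := fun x y => hSpos.isSymmetric x y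
  have hnorm : ∀ i, ‖S (b i)‖ ^ 2 = (⟪b i, T (b i)⟫_ℂ).re := by
    intro i
    rw [← hSS, show (S * S) (b i) = S (S (b i)) from rfl, ← hsym]
    exact (inner_self_eq_norm_sq (𝕜 := ℂ) _).symm
  let SF : Finset κ → (H →L[ℂ] H) := fun F =>
    ∑ i ∈ F, ((innerSL ℂ (b i)) ∘L S).smulRight (b i)
  have hSF : ∀ F, IsCompactOperator (SF F) := by
    intro F
    have : SF F ∈ compactOperator (RingHom.id ℂ) H H :=
      Submodule.sum_mem _ fun i _ => by
        have h := (isCompactOperator_of_locallyCompactSpace_dom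
          ((innerSL ℂ (b i)) ∘L S)).clm_comp (ContinuousLinearMap.toSpanSingleton ℂ (b i))
        exact h
    exact this
  have hlim : Tendsto SF atTop (𝓝 S) := by
    rw [tendsto_iff_norm_sub_tendsto_zero]
    have ht := tendsto_tsum_compl_atTop_zero (fun i => (⟪b i, T (b i)⟫_ℂ).re)
    have ht' := (Real.continuous_sqrt.tendsto 0).comp ht
    rw [Real.sqrt_zero] at ht'
    refine squeeze_zero (fun _ => norm_nonneg _) (fun F => ?_) ht'
    refine ContinuousLinearMap.opNorm_le_bound _ (Real.sqrt_nonneg _) fun x => ?_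
    show ‖(SF F - S) x‖ ≤ √(∑' a : { i // i ∉ F }, (⟪b a, T (b a)⟫_ℂ).re) * ‖x‖
    refine (sq_le_sq₀ (norm_nonneg _) (by positivity)).1 ?_
    have hSFx : (SF F - S) x = -(S x - ∑ i ∈ F, ⟪b i, S x⟫_ℂ • b i) := by
      simp [SF]
    rw [hSFx, norm_neg, mul_pow, Real.sq_sqrt (tsum_nonneg fun i => hnorm i ▸ sq_nonneg _)]
    refine (norm_sub_sum_sq_le b F (S x) (fun i => (⟪b i, T (b i)⟫_ℂ).re * ‖x‖ ^ 2)
      (hs.mul_right _) fun i => ?_).trans_eq tsum_mul_right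
    rw [← hsym, ← hnorm, ← mul_pow]
    gcongr
    exact norm_inner_le_norm _ _
  have hSc : IsCompactOperator S := isCompactOperator_of_tendsto hlim (Eventually.of_forall hSF)
  have := hSc.comp_clm S
  rw [← hSS]
  exact this


theorem countable_of_hilbertBasis [SecondCountableTopology H] {κ : Type*} (b : HilbertBasis κ ℂ H) :
    Countable κ := by
  refine Pairwise.countable_of_isOpen_disjoint (s := fun i => Metric.ball (b i) (1 / 2)) ?_
    (fun _ => Metric.isOpen_ball) (fun i => ⟨b i, by simp⟩)
  intro i j hij
  refine Metric.ball_disjoint_ball ?_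
  have h : ‖b i - b j‖ ^ 2 = 2 := by
    rw [@norm_sub_sq ℂ, b.orthonormal.1, b.orthonormal.1, b.orthonormal.2 hij]
    norm_num
  rw [dist_eq_norm]
  nlinarith [norm_nonneg (b i - b j)]

open scoped ComplexOrder in
theorem exists_eigenbasis [CompleteSpace H] {T : H →L[ℂ] H} (hT : T.IsPositive) (hc : IsCompactOperator T) :
    ∃ (ι : Type u) (b : HilbertBasis ι ℂ H) (w : ι → ℝ≥0), ∀ i, T (b i) = ((w i : ℝ) : ℂ) • b i := by
  have hsym := hT.isSymmetric
  have hbot := T.orthogonalComplement_iSup_eigenspaces_eq_bot hc hsym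
  have hcomp : ∀ μ, CompleteSpace (Module.End.eigenspace (T : Module.End ℂ H) μ) := fun μ => by
    have : IsClosed (Module.End.eigenspace (T : Module.End ℂ H) μ : Set H) := by
      have h : (Module.End.eigenspace (T : Module.End ℂ H) μ : Set H) = {x | T x = μ • x} := by
        ext x; simp
      rw [h]
      exact isClosed_eq T.continuous (continuous_const_smul μ)
    exact this.completeSpace_coe
  have hex := fun μ => exists_hilbertBasis ℂ (Module.End.eigenspace (T : Module.End ℂ H) μ)
  let s : ℂ → Type u := fun μ => (hex μ).choose
  let e : ∀ μ, HilbertBasis (s μ) ℂ (Module.End.eigenspace (T : Module.End ℂ H) μ) :=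
    fun μ => (hex μ).choose_spec.choose
  have hon : Orthonormal ℂ (fun a : Σ μ, s μ => (e a.1 a.2 : H)) :=
    hsym.orthogonalFamily_eigenspaces.orthonormal_sigma_orthonormal (fun μ => (e μ).orthonormal)
  have hmem : ∀ a : Σ μ, s μ, T (e a.1 a.2 : H) = a.1 • (e a.1 a.2 : H) := fun a =>
    Module.End.mem_eigenspace_iff.1 (e a.1 a.2).2
  clear_value e s
  have hsp : (Submodule.span ℂ (Set.range fun a : Σ μ, s μ => (e a.1 a.2 : H)))ᗮ = ⊥ := by
    rw [eq_bot_iff, ← hbot]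
    refine fun x hx => ?_
    rw [← Submodule.iInf_orthogonal, Submodule.mem_iInf]
    intro μ y hy
    have h1 := ((e μ).hasSum_repr ⟨y, hy⟩).mapL
      (Module.End.eigenspace (T : Module.End ℂ H) μ).subtypeL
    have h2 := h1.mapL (innerSL ℂ x)
    have h3 : ⟪x, y⟫_ℂ = 0 := by
      refine h2.unique ?_
      convert hasSum_zero using 1
      funext i
      have h4 := Submodule.inner_left_of_mem_orthogonal
        (Submodule.subset_span (Set.mem_range_self (⟨μ, i⟩ : Σ μ, s μ))) hx
      simp only [map_smul, Submodule.subtypeL_apply, innerSL_apply_apply, smul_eq_mul]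
      rw [h4, mul_zero]
    rw [← inner_conj_symm, h3, map_zero]
  refine ⟨Σ μ, s μ, HilbertBasis.mkOfOrthogonalEqBot hon hsp, fun a => a.1.re.toNNReal, fun a => ?_⟩
  rw [HilbertBasis.coe_mkOfOrthogonalEqBot]
  have hn : ‖(e a.1 a.2 : H)‖ = 1 := (e a.1).orthonormal.1 a.2
  have h1 : ⟪(e a.1 a.2 : H), T (e a.1 a.2 : H)⟫_ℂ = a.1 := by
    rw [hmem, inner_smul_right, inner_self_eq_norm_sq_to_K, hn]; simp
  have h2 : 0 ≤ a.1 := h1 ▸ hT.inner_nonneg_right _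
  have h3 := Complex.nonneg_iff.1 h2
  have h4 : (((a.1.re.toNNReal : ℝ≥0) : ℝ) : ℂ) = a.1 := by
    rw [Real.coe_toNNReal _ h3.1]
    exact Complex.ext (by simp) (by simp [← h3.2])
  rw [h4]
  exact hmem a

end Diagonalization

/-! ### The one-particle space and the magnetic kinetic energy -/

/-- Physical space. -/
abbrev Space : Type := EuclideanSpace ℝ (Fin 3)

/-- The one-particle Hilbert space. -/
abbrev L2 : Type := Lp ℂ 2 (volume : Measure Space)

instance : SecondCountableTopology L2 :=
  haveI : Fact ((2 : ℝ≥0∞) ≠ ⊤) := ⟨by simp⟩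
  inferInstance

/-- The vector potential `a(x) = e × x / 2`, where `e` is the unit vector in `z`-direction. -/
def vectorPotential (x : Space) : Fin 3 → ℝ :=
  (1 / 2 : ℝ) • crossProduct ![0, 0, 1] (fun i => x i)

/-- The `j`-th component `-i ∂_j φ + β a_j φ` of the magnetic momentum of a smooth function. -/
def magneticMomentum (β : ℝ) (j : Fin 3) (φ : Space → ℂ) (x : Space) : ℂ :=
  -Complex.I * fderiv ℝ φ x (EuclideanSpace.single j 1) + ((β * vectorPotential x j : ℝ) : ℂ) * φ x

/-- `g = (-i ∂_j + β a_j) ψ` in the weak sense, with `ψ` and `g` square integrable. -/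
def HasWeakMagneticMomentum (β : ℝ) (j : Fin 3) (ψ g : L2) : Prop :=
  ∀ φ : Space → ℂ, ContDiff ℝ ∞ φ → HasCompactSupport φ →
    ∫ x, starRingEnd ℂ (magneticMomentum β j φ x) * ψ x = ∫ x, starRingEnd ℂ (φ x) * g x

/-- The closed quadratic form `⟨ψ, H_β ψ⟩ = ‖(-i∇ + β a) ψ‖²` of `H_β = (-i∇ + β a)²`. Its form
domain consists of the `ψ` in `L²` whose weak magnetic momentum is in `L²`; outside of the form
domain the value is `∞`. -/
def magneticForm (β : ℝ) (ψ : L2) : ℝ≥0∞ :=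
  ∑ j : Fin 3, ⨅ (g : L2) (_ : HasWeakMagneticMomentum β j ψ g), ‖g‖ₑ ^ 2

/-! ### Density matrices -/

/-- The index set of a fixed orthonormal basis of `L²`. -/
def basisIndex : Set L2 := (exists_hilbertBasis ℂ L2).choose

/-- A fixed orthonormal basis of `L²`, used to write down the trace. -/
def basis : HilbertBasis basisIndex ℂ L2 := (exists_hilbertBasis ℂ L2).choose_spec.choose

/-- Density matrices: non-negative trace class operators on `L²`. A non-negative operator is trace
class iff the sum of its diagonal matrix elements in an orthonormal basis is finite. -/
structure DensityMatrix where
  op : L2 →L[ℂ] L2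
  isPositive : op.IsPositive
  summable : Summable fun i => (⟪basis i, op (basis i)⟫_ℂ).re

/-- A diagonalization `Γ = ∑ w_k |ψ_k⟩⟨ψ_k|` by an orthonormal basis of eigenvectors. -/
structure Diagonalization (T : L2 →L[ℂ] L2) where
  ι : Type
  countable : Countable ι
  ψ : HilbertBasis ι ℂ L2
  w : ι → ℝ≥0
  apply_ψ : ∀ k, T (ψ k) = ((w k : ℝ) : ℂ) • ψ k

namespace DensityMatrix

theorem nonempty_diagonalization (Γ : DensityMatrix) : Nonempty (Diagonalization Γ.op) := by
  obtain ⟨ι, b, w, h⟩ := exists_eigenbasis Γ.isPositive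
    (isCompactOperator_of_summable Γ.isPositive basis Γ.summable)
  exact ⟨⟨ι, countable_of_hilbertBasis b, b, w, h⟩⟩

/-- A diagonalization of `Γ`. The quantities defined through it below do not depend on its
choice. -/
def diag (Γ : DensityMatrix) : Diagonalization Γ.op := Classical.choice Γ.nonempty_diagonalization

/-- `Tr[Γ]`. -/
def trace (Γ : DensityMatrix) : ℝ := ∑' i, (⟪basis i, Γ.op (basis i)⟫_ℂ).re

/-- The density `ρ_Γ = ∑ w_k |ψ_k|²`. -/
def density (Γ : DensityMatrix) (x : Space) : ℝ≥0∞ :=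
  ∑' k, (Γ.diag.w k : ℝ≥0∞) * ‖Γ.diag.ψ k x‖ₑ ^ 2

/-- The magnetic-kinetic energy `Tr[H_β Γ] = ∑ w_k ⟨ψ_k, H_β ψ_k⟩ ∈ [0, ∞]`. -/
def magneticKineticEnergy (β : ℝ) (Γ : DensityMatrix) : ℝ≥0∞ :=
  ∑' k, (Γ.diag.w k : ℝ≥0∞) * magneticForm β (Γ.diag.ψ k)

/-- The domain `Tr[H_β Γ] < ∞` of the magnetic Hartree functional. -/
def HasFiniteMagneticKineticEnergy (β : ℝ) (Γ : DensityMatrix) : Prop :=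
  magneticKineticEnergy β Γ < ⊤

end DensityMatrix

/-! ### The magnetic Hartree functional -/

/-- The attraction `∫ ρ(x) / |x| dx`. -/
def attraction (ρ : Space → ℝ≥0∞) : ℝ≥0∞ := ∫⁻ x, ρ x / ‖x‖ₑ

/-- The repulsion `D[ρ, σ] = ½ ∫∫ ρ(x) σ(y) / |x - y| dx dy`. -/
def repulsion (ρ σ : Space → ℝ≥0∞) : ℝ≥0∞ := (∫⁻ x, ∫⁻ y, ρ x * σ y / ‖x - y‖ₑ) / 2

/-- The magnetic Hartree functional
`Tr[(H_β - β) Γ] - ∫ ρ_Γ(x) / |x| dx + D[ρ_Γ, ρ_Γ]`, considered on its domain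
`Tr[H_β Γ] < ∞`. -/
def hartree (β : ℝ) (Γ : DensityMatrix) : ℝ :=
  ((Γ.magneticKineticEnergy β).toReal - β * Γ.trace) - (attraction Γ.density).toReal
    + (repulsion Γ.density Γ.density).toReal

/-- `Γ` minimizes the magnetic Hartree functional under the condition `Tr[Γ] ≤ lam`. -/
def IsMinimizer (β lam : ℝ) (Γ : DensityMatrix) : Prop :=
  Γ.HasFiniteMagneticKineticEnergy β ∧ Γ.trace ≤ lam ∧
    ∀ Γ' : DensityMatrix, Γ'.HasFiniteMagneticKineticEnergy β → Γ'.trace ≤ lam →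
      hartree β Γ ≤ hartree β Γ'

/-- The values of the magnetic Hartree functional on the density matrices with `Tr[Γ] = lam`; the
Hartree energy `E(lam, β)` is the infimum of this set. -/
def energyValues (β lam : ℝ) : Set ℝ :=
  {E | ∃ Γ : DensityMatrix, Γ.HasFiniteMagneticKineticEnergy β ∧ Γ.trace = lam ∧ hartree β Γ = E}

/-- The Hartree energy `E(lam, β)`. -/
def hartreeEnergy (lam β : ℝ) : ℝ := sInf (energyValues β lam)

end MagneticHartree

end

/-!
Existence of a minimizer is proved by the direct method. For a minimizing sequence under the
relaxed condition `Tr[Γ] ≤ lam` the kinetic energies stay bounded, because Hardy's inequality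
bounds the attraction by half of the kinetic energy plus a multiple of the trace
(`DensityMatrix.attraction_le`, `kinetic_le_hartree`). A subsequence converges in the weak operator
topology (`exists_subseq_tendsto`), and along it the functional is lower semicontinuous:

* `Tr[(H_β - β) Γ]` is nonnegative and a sum of nonnegative matrix elements of `Γ`. On the form
  domain `‖(π₁ - iπ₂)ψ‖² = ‖π₁ψ‖² + ‖π₂ψ‖² - β‖ψ‖²`, so that the energy above the lowest Landau level
  equals `∑ ⟨(π₁ + iπ₂)φ_n, Γ (π₁ + iπ₂)φ_n⟩ + ∑ ⟨π₃φ_n, Γ π₃φ_n⟩` for an orthonormal basis of test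
  functions `φ_n` whose span is a core of the momentum (`landauEnergy`,
  `DensityMatrix.magneticKineticEnergy_eq_landau`). Fatou's lemma for sums applies.
* The Coulomb kernel is an integral of products of Gaussians, `inv_enorm_eq_lintegral`, so
  that `D[ρ, ρ]` is an integral of squares of Gaussian means of `ρ`, each of which is again a sum of
  matrix elements of `Γ` (`DensityMatrix.repulsion_le_liminf`).
* The attraction is upper semicontinuous (`DensityMatrix.limsup_attraction_le`). In place of a
  compact embedding, the density of `Γ` is compared with the matrix elements of `Γ` between
  averaging kernels of small balls: averaging a form domain function over small magnetic
  translations changes it little (`lintegral_magAverage_sub_le`), and the averages depend on `Γ`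
  through matrix elements with dominated values
  (`DensityMatrix.limsup_lintegral_mul_density_le`). Near the nucleus Hardy's inequality is used.

The infimum under `Tr[Γ] = lam` is not larger than the relaxed one, because missing mass can be
put into the lowest Landau level and spread out along the magnetic field at arbitrarily small cost
(`exists_spread_out`, `exists_trace_eq_hartree_le`).

Densities of minimizers coincide because the Coulomb energy is strictly convex: Gaussian means
determine a density, as the Fourier transform of a Gaussian has no zeros
(`ae_eq_of_gaussPot_ae_eq`, `ae_eq_of_repulsion_le`).
-/

noncomputable section

namespace MagneticHartree

/-! ### Test functions and an orthonormal basis adapted to the magnetic momentum -/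

/-- The smooth compactly supported functions on `Space`. -/
def TestFun : Submodule ℂ (Space → ℂ) where
  carrier := {φ | ContDiff ℝ ∞ φ ∧ HasCompactSupport φ}
  add_mem' := fun ha hb => ⟨ha.1.add hb.1, ha.2.add hb.2⟩
  zero_mem' := ⟨contDiff_const, HasCompactSupport.zero⟩
  smul_mem' := fun c _ ha => ⟨ha.1.const_smul c, ha.2.smul_left (f := fun _ => c)⟩

namespace TestFun

theorem contDiff (φ : TestFun) : ContDiff ℝ ∞ (φ : Space → ℂ) := φ.2.1

theorem hasCompactSupport (φ : TestFun) : HasCompactSupport (φ : Space → ℂ) := φ.2.2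

theorem memLp (φ : TestFun) : MemLp (φ : Space → ℂ) 2 volume :=
  (TestFun.contDiff φ).continuous.memLp_of_hasCompactSupport (TestFun.hasCompactSupport φ)

/-- The class in `L²` of a test function. -/
def toL2 : TestFun →ₗ[ℂ] L2 where
  toFun φ := (TestFun.memLp φ).toLp
  map_add' φ η := MemLp.toLp_add (TestFun.memLp φ) (TestFun.memLp η)
  map_smul' c φ := MemLp.toLp_const_smul c (TestFun.memLp φ)

theorem coeFn_toL2 (φ : TestFun) : toL2 φ =ᵐ[volume] (φ : Space → ℂ) := (TestFun.memLp φ).coeFn_toLp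

theorem toL2_injective : Function.Injective toL2 := by
  intro φ η h
  have : (φ : Space → ℂ) =ᵐ[volume] η := (coeFn_toL2 φ).symm.trans (h ▸ coeFn_toL2 η)
  exact Subtype.ext (((TestFun.contDiff φ).continuous.ae_eq_iff_eq volume (TestFun.contDiff η).continuous).1 this)

theorem denseRange_toL2 : DenseRange toL2 := by
  refine (Lp.dense_hasCompactSupport_contDiff (E := Space) (F := ℂ) (μ := volume)
    (p := 2) (by simp)).mono ?_
  rintro f ⟨g, hfg, hg1, hg2⟩
  refine ⟨⟨g, hg2, hg1⟩, ?_⟩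
  exact Lp.ext ((coeFn_toL2 _).trans hfg.symm)

end TestFun

theorem contDiff_vectorPotential (j : Fin 3) :
    ContDiff ℝ ∞ (fun x : Space => vectorPotential x j) := by
  fin_cases j <;> simp [vectorPotential, crossProduct] <;> fun_prop

theorem vectorPotential_zero (x : Space) : vectorPotential x 0 = -(x 1) / 2 := by
  simp [vectorPotential, crossProduct]; ring

theorem vectorPotential_one (x : Space) : vectorPotential x 1 = x 0 / 2 := by
  simp [vectorPotential, crossProduct]; ring

theorem vectorPotential_two (x : Space) : vectorPotential x 2 = 0 := by
  simp [vectorPotential, crossProduct]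

theorem contDiff_magneticMomentum (β : ℝ) (j : Fin 3) {φ : Space → ℂ} (hφ : ContDiff ℝ ∞ φ) :
    ContDiff ℝ ∞ (magneticMomentum β j φ) := by
  unfold magneticMomentum
  have h1 : ContDiff ℝ ∞ (fun x => fderiv ℝ φ x (EuclideanSpace.single j 1)) :=
    (hφ.fderiv_right (m := ∞) (by simp)).clm_apply contDiff_const
  have h2 : ContDiff ℝ ∞ (fun x : Space => ((β * vectorPotential x j : ℝ) : ℂ)) :=
    Complex.ofRealCLM.contDiff.comp (contDiff_const.mul (contDiff_vectorPotential j))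
  exact (contDiff_const.mul h1).add (h2.mul hφ)

/-- The magnetic momentum as an operator on test functions. -/
def TestFun.mom (β : ℝ) (j : Fin 3) : TestFun →ₗ[ℂ] TestFun where
  toFun φ := ⟨magneticMomentum β j φ, contDiff_magneticMomentum β j (TestFun.contDiff φ), by
    unfold magneticMomentum
    exact (((TestFun.hasCompactSupport φ).fderiv_apply ℝ _).mul_left (f := fun _ => -Complex.I)).add
      ((TestFun.hasCompactSupport φ).mul_left
        (f := fun x : Space => ((β * vectorPotential x j : ℝ) : ℂ)))⟩
  map_add' φ η := by
    ext x
    simp only [Submodule.coe_add, magneticMomentum, Pi.add_apply]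
    rw [fderiv_add (((TestFun.contDiff φ).differentiable (by simp)) x)
      (((TestFun.contDiff η).differentiable (by simp)) x)]
    simp only [add_apply]
    ring
  map_smul' c φ := by
    ext x
    simp only [Submodule.coe_smul, magneticMomentum, Pi.smul_apply, RingHom.id_apply]
    rw [fderiv_const_smul (((TestFun.contDiff φ).differentiable (by simp)) x)]
    simp only [smul_apply, smul_eq_mul]
    ring

theorem TestFun.coe_mom (β : ℝ) (j : Fin 3) (φ : TestFun) :
    (TestFun.mom β j φ : Space → ℂ) = magneticMomentum β j φ := rfl

theorem inner_toL2 (φ : TestFun) (ψ : L2) :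
    ⟪TestFun.toL2 φ, ψ⟫_ℂ = ∫ x, starRingEnd ℂ ((φ : Space → ℂ) x) * ψ x := by
  rw [L2.inner_def]
  refine integral_congr_ae ?_
  filter_upwards [TestFun.coeFn_toL2 φ] with x hx
  rw [hx, RCLike.inner_apply, mul_comm]

theorem hasWeakMagneticMomentum_iff {β : ℝ} {j : Fin 3} {ψ g : L2} :
    HasWeakMagneticMomentum β j ψ g ↔
      ∀ φ : TestFun, ⟪TestFun.toL2 (TestFun.mom β j φ), ψ⟫_ℂ = ⟪TestFun.toL2 φ, g⟫_ℂ := by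
  simp only [inner_toL2, TestFun.coe_mom]
  exact ⟨fun h φ => h φ (TestFun.contDiff φ) (TestFun.hasCompactSupport φ), fun h φ h1 h2 => h ⟨φ, h1, h2⟩⟩

theorem eq_of_forall_inner_toL2 {f g : L2}
    (h : ∀ φ : TestFun, ⟪TestFun.toL2 φ, f⟫_ℂ = ⟪TestFun.toL2 φ, g⟫_ℂ) : f = g :=
  TestFun.denseRange_toL2.eq_of_inner_right ℂ h

theorem HasWeakMagneticMomentum.unique {β : ℝ} {j : Fin 3} {ψ g g' : L2}
    (h : HasWeakMagneticMomentum β j ψ g) (h' : HasWeakMagneticMomentum β j ψ g') : g = g' := by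
  rw [hasWeakMagneticMomentum_iff] at h h'
  exact eq_of_forall_inner_toL2 fun φ => (h φ).symm.trans (h' φ)

/-- A densely defined space `V` of nice vectors contains an orthonormal basis which is moreover a
core for a given linear map `A` on `V`: apply Gram–Schmidt to a sequence which is dense in the
graph of `A`. -/
theorem exists_hilbertBasis_core {H K V : Type*} [NormedAddCommGroup H] [InnerProductSpace ℂ H]
    [CompleteSpace H] [SecondCountableTopology H] [NormedAddCommGroup K] [NormedSpace ℂ K]
    [SecondCountableTopology K] [AddCommGroup V] [Module ℂ V] (i : V →ₗ[ℂ] H)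
    (hi : Function.Injective i) (hd : DenseRange i) (A : V →ₗ[ℂ] K) :
    ∃ (s : Set ℕ) (b : HilbertBasis s ℂ H) (e : s → V), (∀ n, i (e n) = b n) ∧
      ∀ φ : V, i.prod A φ ∈ closure (Submodule.span ℂ (Set.range fun n => i.prod A (e n)) :
        Set (H × K)) := by
  classical
  set G := i.prod A with hG
  have : Nonempty (Set.range G) := ⟨⟨G 0, 0, rfl⟩⟩
  obtain ⟨d, hdd⟩ := TopologicalSpace.exists_dense_seq (Set.range G)
  choose v hv using fun n => (d n).2
  have hclos : ∀ φ : V, G φ ∈ closure (Set.range fun n => G (v n)) := by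
    intro φ
    have h1 : (⟨G φ, φ, rfl⟩ : Set.range G) ∈ closure (Set.range d) := hdd _
    have h2 := image_closure_subset_closure_image (f := (Subtype.val : Set.range G → H × K))
      continuous_subtype_val ⟨_, h1, rfl⟩
    rw [← Set.range_comp] at h2
    convert h2 using 4 with n
    exact (hv n)
  set f : ℕ → H := fun n => i (v n) with hf
  set gs := InnerProductSpace.gramSchmidtNormed ℂ f with hgs
  let s : Set ℕ := {n | gs n ≠ 0}
  have hon : Orthonormal ℂ fun n : s => gs n := InnerProductSpace.gramSchmidtNormed_orthonormal' f
  have hspan : Submodule.span ℂ (Set.range fun n : s => gs n) = Submodule.span ℂ (Set.range f) := by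
    rw [← InnerProductSpace.span_gramSchmidt ℂ f, ← InnerProductSpace.span_gramSchmidtNormed_range]
    refine le_antisymm (Submodule.span_mono ?_) (Submodule.span_le.2 ?_)
    · rintro _ ⟨n, rfl⟩; exact ⟨n, rfl⟩
    · rintro _ ⟨n, rfl⟩
      by_cases h : gs n = 0
      · change gs n ∈ _
        rw [h]; exact Submodule.zero_mem _
      · exact Submodule.subset_span ⟨⟨n, h⟩, rfl⟩
  have hmapf : Submodule.span ℂ (Set.range f) = (Submodule.span ℂ (Set.range v)).map i := by
    rw [Submodule.map_span, ← Set.range_comp]; rfl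
  have hdense : ⊤ ≤ (Submodule.span ℂ (Set.range fun n : s => gs n)).topologicalClosure := by
    rw [hspan]
    intro x _
    have h1 : (Set.range i) ⊆ closure (Set.range f) := by
      rintro _ ⟨φ, rfl⟩
      have h2 := image_closure_subset_closure_image (f := (Prod.fst : H × K → H))
        continuous_fst ⟨_, hclos φ, rfl⟩
      rwa [← Set.range_comp] at h2
    have h3 : x ∈ closure (Set.range f) := closure_minimal h1 isClosed_closure (hd x)
    exact closure_mono Submodule.subset_span h3
  have hex : ∀ n : s, ∃ e ∈ Submodule.span ℂ (Set.range v), i e = gs n := by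
    intro n
    have : gs n ∈ (Submodule.span ℂ (Set.range v)).map i := by
      rw [← hmapf, ← hspan]
      exact Submodule.subset_span ⟨n, rfl⟩
    exact this
  choose e he1 he2 using hex
  refine ⟨s, HilbertBasis.mk hon hdense, e, fun n => by simp [he2], fun φ => ?_⟩
  refine closure_minimal ?_ isClosed_closure (hclos φ)
  rintro _ ⟨m, rfl⟩
  refine subset_closure ?_
  have h1 : i (v m) ∈ (Submodule.span ℂ (Set.range e)).map i := by
    rw [Submodule.map_span, ← Set.range_comp, show (i ∘ e) = fun n : s => gs n from funext he2,
      hspan]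
    exact Submodule.subset_span ⟨m, rfl⟩
  obtain ⟨y, hy, hyv⟩ := h1
  have hyv' : y = v m := hi hyv
  have h2 : G (v m) ∈ (Submodule.span ℂ (Set.range e)).map G := ⟨_, hyv' ▸ hy, rfl⟩
  rwa [Submodule.map_span, ← Set.range_comp] at h2

/-- All three components of the magnetic momentum. -/
def momentumMap (β : ℝ) : TestFun →ₗ[ℂ] (Fin 3 → L2) :=
  LinearMap.pi fun j => TestFun.toL2 ∘ₗ TestFun.mom β j

/-- The countable index set of the test function basis. -/
def testIndex (β : ℝ) : Set ℕ :=
  (exists_hilbertBasis_core _ TestFun.toL2_injective TestFun.denseRange_toL2 (momentumMap β)).choose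

/-- An orthonormal basis of `L²` which consists of test functions and whose span is a core of the
magnetic momentum. -/
def testBasis (β : ℝ) : HilbertBasis (testIndex β) ℂ L2 :=
  (exists_hilbertBasis_core _ TestFun.toL2_injective TestFun.denseRange_toL2
    (momentumMap β)).choose_spec.choose

/-- The test functions that represent the elements of `testBasis`. -/
def testVec (β : ℝ) : testIndex β → TestFun :=
  (exists_hilbertBasis_core _ TestFun.toL2_injective TestFun.denseRange_toL2
    (momentumMap β)).choose_spec.choose_spec.choose

theorem toL2_testVec (β : ℝ) (n : testIndex β) : TestFun.toL2 (testVec β n) = testBasis β n :=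
  (exists_hilbertBasis_core _ TestFun.toL2_injective TestFun.denseRange_toL2
    (momentumMap β)).choose_spec.choose_spec.choose_spec.1 n

theorem mem_closure_testVec (β : ℝ) (φ : TestFun) :
    TestFun.toL2.prod (momentumMap β) φ ∈ closure (Submodule.span ℂ
      (Set.range fun n => TestFun.toL2.prod (momentumMap β) (testVec β n)) :
        Set (L2 × (Fin 3 → L2))) :=
  (exists_hilbertBasis_core _ TestFun.toL2_injective TestFun.denseRange_toL2
    (momentumMap β)).choose_spec.choose_spec.choose_spec.2 φ

/-- It suffices to test the weak magnetic momentum with the elements of `testBasis`. -/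
theorem hasWeakMagneticMomentum_of_testVec {β : ℝ} {j : Fin 3} {ψ g : L2}
    (h : ∀ n, ⟪TestFun.toL2 (TestFun.mom β j (testVec β n)), ψ⟫_ℂ = ⟪testBasis β n, g⟫_ℂ) :
    HasWeakMagneticMomentum β j ψ g := by
  rw [hasWeakMagneticMomentum_iff]
  intro φ
  let S : Set (L2 × (Fin 3 → L2)) := {p | ⟪p.2 j, ψ⟫_ℂ = ⟪p.1, g⟫_ℂ}
  have hS : IsClosed S := isClosed_eq (by fun_prop) (by fun_prop)
  have hsub : (Submodule.span ℂ (Set.range fun n => TestFun.toL2.prod (momentumMap β)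
      (testVec β n)) : Set (L2 × (Fin 3 → L2))) ⊆ S := by
    intro p hp
    induction hp using Submodule.span_induction with
    | mem x hx =>
      obtain ⟨n, rfl⟩ := hx
      change ⟪TestFun.toL2 (TestFun.mom β j (testVec β n)), ψ⟫_ℂ = ⟪TestFun.toL2 (testVec β n), g⟫_ℂ
      rw [toL2_testVec]; exact h n
    | zero => simp [S]
    | add x y _ _ hx hy =>
      change ⟪x.2 j + y.2 j, ψ⟫_ℂ = ⟪x.1 + y.1, g⟫_ℂ
      rw [inner_add_left, inner_add_left, show ⟪x.2 j, ψ⟫_ℂ = _ from hx,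
        show ⟪y.2 j, ψ⟫_ℂ = _ from hy]
    | smul c x _ hx =>
      change ⟪c • x.2 j, ψ⟫_ℂ = ⟪c • x.1, g⟫_ℂ
      rw [inner_smul_left, inner_smul_left, show ⟪x.2 j, ψ⟫_ℂ = _ from hx]
  exact closure_minimal hsub hS (mem_closure_testVec β φ)

/-- Parseval's identity in extended nonnegative reals. -/
theorem tsum_enorm_inner_sq {ι H : Type*} [NormedAddCommGroup H] [InnerProductSpace ℂ H]
    (b : HilbertBasis ι ℂ H) (u : H) :
    ∑' i, ‖⟪b i, u⟫_ℂ‖ₑ ^ 2 = ‖u‖ₑ ^ 2 := by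
  have h1 := b.hasSum_inner_mul_inner u u
  have h2 : HasSum (fun i => ‖⟪b i, u⟫_ℂ‖ ^ 2) (‖u‖ ^ 2) := by
    have := Complex.hasSum_re h1
    rw [show (⟪u, u⟫_ℂ).re = ‖u‖ ^ 2 from inner_self_eq_norm_sq (𝕜 := ℂ) u] at this
    refine this.congr_fun ?_ |> fun h => h
    intro i
    rw [← inner_conj_symm u (b i), ← Complex.normSq_eq_conj_mul_self, Complex.ofReal_re,
      Complex.normSq_eq_norm_sq]
  have h3 : ∀ x : ℂ, ‖x‖ₑ ^ 2 = ENNReal.ofReal (‖x‖ ^ 2) := fun x => by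
    rw [ENNReal.ofReal_pow (norm_nonneg _), ofReal_norm]
  simp_rw [h3]
  rw [← ENNReal.ofReal_tsum_of_nonneg (fun _ => by positivity) h2.summable, h2.tsum_eq,
    ENNReal.ofReal_pow (norm_nonneg _), ofReal_norm]

/-- The component `‖(-i∂_j + β a_j) ψ‖²` of the magnetic form, expanded in `testBasis`. -/
theorem iInf_enorm_sq_eq_tsum (β : ℝ) (j : Fin 3) (u : L2) :
    ⨅ (g : L2) (_ : HasWeakMagneticMomentum β j u g), ‖g‖ₑ ^ 2 =
      ∑' n, ‖⟪TestFun.toL2 (TestFun.mom β j (testVec β n)), u⟫_ℂ‖ₑ ^ 2 := by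
  have key : ∀ g, HasWeakMagneticMomentum β j u g →
      ‖g‖ₑ ^ 2 = ∑' n, ‖⟪TestFun.toL2 (TestFun.mom β j (testVec β n)), u⟫_ℂ‖ₑ ^ 2 := by
    intro g hg
    rw [hasWeakMagneticMomentum_iff] at hg
    rw [← tsum_enorm_inner_sq (testBasis β)]
    simp_rw [hg, toL2_testVec]
  refine le_antisymm ?_ (le_iInf₂ fun g hg => (key g hg).ge)
  by_cases hfin : ∑' n, ‖⟪TestFun.toL2 (TestFun.mom β j (testVec β n)), u⟫_ℂ‖ₑ ^ 2 = ⊤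
  · rw [hfin]; exact le_top
  have hmem : Memℓp (fun n => ⟪TestFun.toL2 (TestFun.mom β j (testVec β n)), u⟫_ℂ) 2 := by
    refine memℓp_gen ?_
    have := ENNReal.summable_toReal hfin
    refine this.congr fun n => ?_
    simp
  let c : lp (fun _ : testIndex β => ℂ) 2 := ⟨_, hmem⟩
  have hg : HasWeakMagneticMomentum β j u ((testBasis β).repr.symm c) := by
    refine hasWeakMagneticMomentum_of_testVec fun n => ?_
    rw [← HilbertBasis.repr_apply_apply, LinearIsometryEquiv.apply_symm_apply]
  exact (iInf₂_le _ hg).trans (key _ hg).le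

theorem magneticForm_eq_tsum (β : ℝ) (u : L2) :
    magneticForm β u =
      ∑ j : Fin 3, ∑' n, ‖⟪TestFun.toL2 (TestFun.mom β j (testVec β n)), u⟫_ℂ‖ₑ ^ 2 := by
  simp only [magneticForm, iInf_enorm_sq_eq_tsum]

/-- On the form domain the magnetic form is the squared norm of the weak magnetic momentum. -/
theorem exists_weak_of_magneticForm_lt_top {β : ℝ} {u : L2} (h : magneticForm β u < ⊤) :
    ∃ g : Fin 3 → L2, (∀ j, HasWeakMagneticMomentum β j u (g j)) ∧
      magneticForm β u = ∑ j, ‖g j‖ₑ ^ 2 := by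
  have h1 : ∀ j, ∃ g, HasWeakMagneticMomentum β j u g := by
    intro j
    have h2 := (ENNReal.sum_lt_top.1 h) j (Finset.mem_univ j)
    simp only [iInf_lt_iff] at h2
    exact ⟨_, h2.choose_spec.choose⟩
  choose g hg using h1
  refine ⟨g, hg, Finset.sum_congr rfl fun j _ => le_antisymm (iInf₂_le _ (hg j)) ?_⟩
  exact le_iInf₂ fun g' hg' => by rw [(hg j).unique hg']

theorem magneticForm_eq_sum {β : ℝ} {u : L2} {g : Fin 3 → L2}
    (hg : ∀ j, HasWeakMagneticMomentum β j u (g j)) : magneticForm β u = ∑ j, ‖g j‖ₑ ^ 2 := by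
  refine Finset.sum_congr rfl fun j _ => le_antisymm (iInf₂_le _ (hg j)) ?_
  exact le_iInf₂ fun g' hg' => by rw [(hg j).unique hg']

/-! ### Multiplication operators and magnetic translations -/

theorem memLp_bounded_mul {m : Space → ℂ} (hm : Measurable m) {C : ℝ} (hC : ∀ x, ‖m x‖ ≤ C)
    (u : L2) : MemLp (fun x => m x * u x) 2 volume :=
  (Lp.memLp u).of_le_mul (c := C) (hm.aestronglyMeasurable.mul (Lp.aestronglyMeasurable u))
    (Eventually.of_forall fun x => by
      rw [norm_mul]; exact mul_le_mul_of_nonneg_right (hC x) (norm_nonneg _))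

/-- Multiplication of an `L²` function by a bounded measurable function. -/
def boundedMul (m : Space → ℂ) (hm : Measurable m) (C : ℝ) (hC : ∀ x, ‖m x‖ ≤ C) (u : L2) : L2 :=
  (memLp_bounded_mul hm hC u).toLp

theorem coeFn_boundedMul {m : Space → ℂ} (hm : Measurable m) {C : ℝ} (hC : ∀ x, ‖m x‖ ≤ C)
    (u : L2) : boundedMul m hm C hC u =ᵐ[volume] fun x => m x * u x :=
  (memLp_bounded_mul hm hC u).coeFn_toLp

theorem enorm_L2_sq (u : L2) : ‖u‖ₑ ^ 2 = ∫⁻ x, ‖u x‖ₑ ^ 2 := by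
  rw [Lp.enorm_def, eLpNorm_eq_lintegral_rpow_enorm_toReal (by simp) (by simp)]
  simp only [ENNReal.toReal_ofNat, ENNReal.rpow_ofNat]
  rw [← ENNReal.rpow_natCast, ← ENNReal.rpow_mul]
  simp

/-- Multiplication by a phase. -/
def phaseMul (m : Space → ℂ) (hm : Measurable m) (h : ∀ x, ‖m x‖ = 1) : L2 →ₗᵢ[ℂ] L2 where
  toFun := boundedMul m hm 1 fun x => (h x).le
  map_add' u v := by
    refine Lp.ext ?_
    filter_upwards [coeFn_boundedMul hm (fun x => (h x).le) (u + v), Lp.coeFn_add u v,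
      coeFn_boundedMul hm (fun x => (h x).le) u, coeFn_boundedMul hm (fun x => (h x).le) v,
      Lp.coeFn_add (boundedMul m hm 1 (fun x => (h x).le) u)
        (boundedMul m hm 1 (fun x => (h x).le) v)] with x h1 h2 h3 h4 h5
    rw [h1, h5, h2, Pi.add_apply, Pi.add_apply, h3, h4, mul_add]
  map_smul' c u := by
    refine Lp.ext ?_
    filter_upwards [coeFn_boundedMul hm (fun x => (h x).le) (c • u), Lp.coeFn_smul c u,
      coeFn_boundedMul hm (fun x => (h x).le) u,
      Lp.coeFn_smul c (boundedMul m hm 1 (fun x => (h x).le) u)] with x h1 h2 h3 h4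
    rw [h1, RingHom.id_apply, h4, h2, Pi.smul_apply, Pi.smul_apply, h3, smul_eq_mul, smul_eq_mul]
    ring
  norm_map' u := by
    have : ‖boundedMul m hm 1 (fun x => (h x).le) u‖ₑ ^ 2 = ‖u‖ₑ ^ 2 := by
      rw [enorm_L2_sq, enorm_L2_sq]
      refine lintegral_congr_ae ?_
      filter_upwards [coeFn_boundedMul hm (fun x => (h x).le) u] with x hx
      rw [hx, enorm_mul, ← ofReal_norm (m x), h x]; simp
    have h2 := congrArg ENNReal.toReal this
    simp only [ENNReal.toReal_pow, toReal_enorm] at h2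
    exact (sq_eq_sq₀ (norm_nonneg _) (norm_nonneg _)).1 h2

/-- The phase `exp (i t β a_j(x))`. -/
def phase (β : ℝ) (j : Fin 3) (t : ℝ) (x : Space) : ℂ :=
  Complex.exp (((t * (β * vectorPotential x j) : ℝ) : ℂ) * Complex.I)

theorem contDiff_phase (β : ℝ) (j : Fin 3) (t : ℝ) : ContDiff ℝ ∞ (phase β j t) := by
  have h : ContDiff ℝ ∞ (fun x : Space => ((t * (β * vectorPotential x j) : ℝ) : ℂ)) :=
    Complex.ofRealCLM.contDiff.comp
      (contDiff_const.mul (contDiff_const.mul (contDiff_vectorPotential j)))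
  exact (h.mul contDiff_const).cexp

theorem norm_phase (β : ℝ) (j : Fin 3) (t : ℝ) (x : Space) : ‖phase β j t x‖ = 1 :=
  Complex.norm_exp_ofReal_mul_I _

/-- The unit vector in direction `j`. -/
abbrev dir (j : Fin 3) : Space := EuclideanSpace.single j 1

/-- `a_j` does not depend on the `j`-th coordinate. -/
theorem vectorPotential_add_smul_dir (j : Fin 3) (t : ℝ) (x : Space) :
    vectorPotential (x + t • dir j) j = vectorPotential x j := by
  fin_cases j <;> simp [vectorPotential, crossProduct]

/-- The magnetic translation `(U_t u)(x) = exp (i t β a_j(x)) u(x + t e_j)`, that is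
`exp (i t (-i∂_j + β a_j))`. -/
def magTrans (β : ℝ) (j : Fin 3) (t : ℝ) : L2 →ₗᵢ[ℂ] L2 :=
  (phaseMul (phase β j t) (contDiff_phase β j t).continuous.measurable (norm_phase β j t)).comp
    (Lp.compMeasurePreservingₗᵢ ℂ (fun x => x + t • dir j) (measurePreserving_add_right volume _))

theorem coeFn_magTrans (β : ℝ) (j : Fin 3) (t : ℝ) (u : L2) :
    magTrans β j t u =ᵐ[volume] fun x => phase β j t x * u (x + t • dir j) := by
  have h1 := coeFn_boundedMul (contDiff_phase β j t).continuous.measurable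
    (fun x => (norm_phase β j t x).le)
    (Lp.compMeasurePreserving (fun x : Space => x + t • dir j)
      (measurePreserving_add_right volume _) u)
  have h2 := Lp.coeFn_compMeasurePreserving u (measurePreserving_add_right volume (t • dir j))
  refine h1.trans ?_
  filter_upwards [h2] with x hx
  rw [hx]; rfl

theorem inner_eq_integral (u v : L2) : ⟪u, v⟫_ℂ = ∫ x, starRingEnd ℂ (u x) * v x := by
  rw [L2.inner_def]
  exact integral_congr_ae (Eventually.of_forall fun x => by
    simp [RCLike.inner_apply, mul_comm])

theorem ae_add_right {p : Space → Prop} (v : Space) (h : ∀ᵐ x, p x) : ∀ᵐ x : Space, p (x + v) :=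
  (measurePreserving_add_right (volume : Measure Space) v).quasiMeasurePreserving.ae h

theorem conj_phase (β : ℝ) (j : Fin 3) (t : ℝ) (x : Space) :
    starRingEnd ℂ (phase β j t x) = phase β j (-t) x := by
  rw [phase, ← Complex.exp_conj, phase]
  congr 1
  simp

theorem phase_add_smul_dir (β : ℝ) (j : Fin 3) (s t : ℝ) (x : Space) :
    phase β j s (x + t • dir j) = phase β j s x := by
  rw [phase, vectorPotential_add_smul_dir, phase]

theorem inner_magTrans_left (β : ℝ) (j : Fin 3) (t : ℝ) (u v : L2) :
    ⟪magTrans β j t u, v⟫_ℂ = ⟪u, magTrans β j (-t) v⟫_ℂ := by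
  rw [inner_eq_integral, inner_eq_integral,
    ← integral_add_right_eq_self (fun x => starRingEnd ℂ (u x) * magTrans β j (-t) v x)
    (t • dir j)]
  refine integral_congr_ae ?_
  filter_upwards [coeFn_magTrans β j t u,
    ae_add_right (t • dir j) (coeFn_magTrans β j (-t) v)] with x h1 h2
  rw [h1, h2, map_mul, conj_phase, phase_add_smul_dir]
  simp [add_assoc]
  ring

/-- The magnetic translation of a test function. -/
def TestFun.trans (β : ℝ) (j : Fin 3) (t : ℝ) (φ : TestFun) : TestFun :=
  ⟨fun x => phase β j t x * (φ : Space → ℂ) (x + t • dir j),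
    (contDiff_phase β j t).mul ((TestFun.contDiff φ).comp (contDiff_id.add contDiff_const)),
    ((TestFun.hasCompactSupport φ).comp_homeomorph (Homeomorph.addRight (t • dir j))).mul_left
      (f := phase β j t)⟩

theorem TestFun.toL2_trans (β : ℝ) (j : Fin 3) (t : ℝ) (φ : TestFun) :
    TestFun.toL2 (TestFun.trans β j t φ) = magTrans β j t (TestFun.toL2 φ) := by
  refine Lp.ext ((TestFun.coeFn_toL2 _).trans ((coeFn_magTrans β j t _).trans ?_).symm)
  filter_upwards [ae_add_right (t • dir j) (TestFun.coeFn_toL2 φ)] with x hx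
  rw [hx]; rfl

theorem hasDerivAt_testFun_line (φ : TestFun) (j : Fin 3) (x : Space) (t : ℝ) :
    HasDerivAt (fun s : ℝ => (φ : Space → ℂ) (x + s • dir j))
      (fderiv ℝ (φ : Space → ℂ) (x + t • dir j) (dir j)) t := by
  have h1 : HasDerivAt (fun s : ℝ => x + s • dir j) (dir j) t := by
    simpa using ((hasDerivAt_id t).smul_const (dir j)).const_add x
  exact (((TestFun.contDiff φ).differentiable (by simp)) _).hasFDerivAt.comp_hasDerivAt t h1

/-- The magnetic momentum commutes with the translations it generates. -/
theorem TestFun.mom_trans (β : ℝ) (j : Fin 3) (t : ℝ) (φ : TestFun) :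
    TestFun.mom β j (TestFun.trans β j t φ) = TestFun.trans β j t (TestFun.mom β j φ) := by
  ext x
  have h1 := hasDerivAt_testFun_line (TestFun.trans β j t φ) j x 0
  have h2 : HasDerivAt (fun s : ℝ => (TestFun.trans β j t φ : Space → ℂ) (x + s • dir j))
      (phase β j t x * fderiv ℝ (φ : Space → ℂ) (x + t • dir j) (dir j)) 0 := by
    have h3 : HasDerivAt (fun s : ℝ => (φ : Space → ℂ) (x + s • dir j + t • dir j))
        (fderiv ℝ (φ : Space → ℂ) (x + t • dir j) (dir j)) 0 := by
      have := hasDerivAt_testFun_line φ j (x + t • dir j) 0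
      rw [zero_smul, add_zero] at this
      refine this.congr_of_eventuallyEq (Eventually.of_forall fun s => ?_)
      change (φ : Space → ℂ) _ = (φ : Space → ℂ) _
      rw [add_right_comm]
    refine (h3.const_mul (phase β j t x)).congr_of_eventuallyEq (Eventually.of_forall fun s => ?_)
    change phase β j t (x + s • dir j) * _ = _
    rw [phase_add_smul_dir]
  have h4 := h1.unique h2
  rw [zero_smul, add_zero] at h4
  change magneticMomentum β j (TestFun.trans β j t φ : Space → ℂ) x =
    phase β j t x * magneticMomentum β j (φ : Space → ℂ) (x + t • dir j)
  rw [magneticMomentum, magneticMomentum, h4, vectorPotential_add_smul_dir]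
  change _ + _ * (phase β j t x * (φ : Space → ℂ) (x + t • dir j)) = _
  ring

theorem hasDerivAt_trans (β : ℝ) (j : Fin 3) (φ : TestFun) (x : Space) (t : ℝ) :
    HasDerivAt (fun s : ℝ => (TestFun.trans β j s φ : Space → ℂ) x)
      (Complex.I * (TestFun.trans β j t (TestFun.mom β j φ) : Space → ℂ) x) t := by
  have h1 : HasDerivAt (fun s : ℝ => phase β j s x)
      (phase β j t x * (((β * vectorPotential x j : ℝ) : ℂ) * Complex.I)) t := by
    have h2 : HasDerivAt (fun s : ℝ => ((s * (β * vectorPotential x j) : ℝ) : ℂ) * Complex.I)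
        (((β * vectorPotential x j : ℝ) : ℂ) * Complex.I) t := by
      have := (((hasDerivAt_id t).mul_const (β * vectorPotential x j)).ofReal_comp).mul_const
        Complex.I
      simpa using this
    exact h2.cexp
  have h3 := h1.mul (hasDerivAt_testFun_line φ j x t)
  refine h3.congr_deriv ?_
  change _ = Complex.I * (phase β j t x * magneticMomentum β j (φ : Space → ℂ) (x + t • dir j))
  rw [magneticMomentum, vectorPotential_add_smul_dir]
  linear_combination ((phase β j t x) * fderiv ℝ (φ : Space → ℂ) (x + t • dir j) (dir j)) *
    Complex.I_mul_I

theorem hasDerivAt_inner_trans {β : ℝ} {j : Fin 3} {u g : L2}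
    (hg : HasWeakMagneticMomentum β j u g) (φ : TestFun) (t : ℝ) :
    HasDerivAt (fun s : ℝ => ⟪magTrans β j s (TestFun.toL2 φ), u⟫_ℂ)
      (-Complex.I * ⟪magTrans β j t (TestFun.toL2 φ), g⟫_ℂ) t := by
  rw [hasWeakMagneticMomentum_iff] at hg
  simp_rw [← TestFun.toL2_trans]
  rw [← hg, TestFun.mom_trans]
  simp_rw [inner_toL2]
  rw [← integral_const_mul]
  obtain ⟨R, hR⟩ := (TestFun.hasCompactSupport (TestFun.mom β j φ)).isCompact.isBounded.subset_closedBall 0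
  obtain ⟨C, hC⟩ := (TestFun.hasCompactSupport (TestFun.mom β j φ)).exists_bound_of_continuous
    (TestFun.contDiff (TestFun.mom β j φ)).continuous
  have hC0 : 0 ≤ C := (norm_nonneg _).trans (hC 0)
  set B : Set Space := Metric.closedBall 0 (R + (|t| + 1)) with hB
  have hint : Integrable (fun x => B.indicator (fun x => C * ‖u x‖) x) volume := by
    rw [integrable_indicator_iff Metric.isClosed_closedBall.measurableSet]
    have : IsFiniteMeasure (volume.restrict B) :=
      ⟨by rw [Measure.restrict_apply_univ]; exact (isCompact_closedBall _ _).measure_lt_top⟩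
    exact (((Lp.memLp u).restrict B).integrable one_le_two).norm.const_mul C
  have hmeas : ∀ s, ∀ η : TestFun, AEStronglyMeasurable
      (fun x => starRingEnd ℂ ((TestFun.trans β j s η : Space → ℂ) x) * u x) volume := fun s η =>
    ((Complex.continuous_conj.comp
      (TestFun.contDiff (TestFun.trans β j s η)).continuous).aestronglyMeasurable).mul
      (Lp.aestronglyMeasurable u)
  refine (hasDerivAt_integral_of_dominated_loc_of_deriv_le (Metric.ball_mem_nhds t one_pos)
    (F' := fun s x => -Complex.I *
      (starRingEnd ℂ ((TestFun.trans β j s (TestFun.mom β j φ) : Space → ℂ) x) * u x))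
    (bound := fun x => B.indicator (fun x => C * ‖u x‖) x)
    (Eventually.of_forall fun s => hmeas s φ) ?_ ?_ ?_ hint ?_).2
  · refine (L2.integrable_inner (𝕜 := ℂ) (TestFun.toL2 (TestFun.trans β j t φ)) u).congr ?_
    filter_upwards [TestFun.coeFn_toL2 (TestFun.trans β j t φ)] with x hx
    rw [hx, RCLike.inner_apply, mul_comm]
  · exact (hmeas t _).const_mul _
  · refine Eventually.of_forall fun x s hs => ?_
    rw [norm_mul, norm_mul, norm_neg, Complex.norm_I, one_mul, RCLike.norm_conj]
    change ‖phase β j s x * (TestFun.mom β j φ : Space → ℂ) (x + s • dir j)‖ * _ ≤ _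
    rw [norm_mul, norm_phase, one_mul]
    by_cases hx : x ∈ B
    · rw [Set.indicator_of_mem hx]
      exact mul_le_mul_of_nonneg_right (hC _) (norm_nonneg _)
    · rw [Set.indicator_of_notMem hx]
      have : (TestFun.mom β j φ : Space → ℂ) (x + s • dir j) = 0 := by
        by_contra hne
        refine hx ?_
        have h1 := hR (subset_tsupport _ hne)
        rw [mem_closedBall_zero_iff] at h1 ⊢
        have h2 : ‖x‖ ≤ ‖x + s • dir j‖ + ‖s • dir j‖ := by
          simpa using norm_sub_le (x + s • dir j) (s • dir j)
        have h3 : ‖s • dir j‖ = |s| := by simp [norm_smul]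
        have h4 : |s| ≤ |t| + 1 := by
          have := abs_sub_abs_le_abs_sub s t
          rw [Metric.mem_ball, Real.dist_eq] at hs
          linarith
        linarith
      simp [this]
  · refine Eventually.of_forall fun x s _ => ?_
    have h1 := (hasDerivAt_trans β j φ x s)
    have h2 := (Complex.conjCLE.toContinuousLinearMap.hasFDerivAt.comp_hasDerivAt s h1).mul_const (u x)
    refine h2.congr_deriv ?_
    simp [map_mul]
    ring

/-- The difference quotients of the magnetic translations are bounded by the weak derivative. -/
theorem norm_magTrans_sub_le {β : ℝ} {j : Fin 3} {u g : L2}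
    (hg : HasWeakMagneticMomentum β j u g) (t : ℝ) : ‖magTrans β j t u - u‖ ≤ |t| * ‖g‖ := by
  have h0 : ∀ v : L2, magTrans β j 0 v = v := fun v => by
    refine Lp.ext ((coeFn_magTrans β j 0 v).trans ?_)
    exact Eventually.of_forall fun x => by simp [phase]
  have h1 : ∀ φ : TestFun, ‖⟪TestFun.toL2 φ, magTrans β j t u - u⟫_ℂ‖ ≤
      |t| * ‖g‖ * ‖TestFun.toL2 φ‖ := by
    intro φ
    have h2 := Convex.norm_image_sub_le_of_norm_hasDerivWithin_le (C := ‖g‖ * ‖TestFun.toL2 φ‖)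
      (f := fun s : ℝ => ⟪magTrans β j s (TestFun.toL2 φ), u⟫_ℂ) (s := Set.univ) (x := 0) (y := -t)
      (fun s _ => (hasDerivAt_inner_trans hg φ s).hasDerivWithinAt) (fun s _ => by
        rw [norm_mul, norm_neg, Complex.norm_I, one_mul, mul_comm ‖g‖]
        refine (norm_inner_le_norm _ _).trans ?_
        rw [LinearIsometry.norm_map]) convex_univ trivial trivial
    rw [h0, inner_magTrans_left, neg_neg, ← inner_sub_right] at h2
    refine h2.trans (le_of_eq ?_)
    simp
    ring
  set w := magTrans β j t u - u
  have h3 : ∀ v : L2, ‖⟪v, w⟫_ℂ‖ ≤ |t| * ‖g‖ * ‖v‖ := fun v =>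
    TestFun.denseRange_toL2.induction_on (p := fun v => ‖⟪v, w⟫_ℂ‖ ≤ |t| * ‖g‖ * ‖v‖) v
      (isClosed_le (by fun_prop) (by fun_prop)) h1
  have h4 := h3 w
  rw [inner_self_eq_norm_sq_to_K] at h4
  have h5 : ‖w‖ ^ 2 ≤ |t| * ‖g‖ * ‖w‖ := by simpa using h4
  by_cases hw : ‖w‖ = 0
  · rw [hw]; positivity
  · have : 0 < ‖w‖ := lt_of_le_of_ne (norm_nonneg _) (Ne.symm hw)
    nlinarith

/-- Vectors that converge weakly on a dense set, and whose norms do not exceed the norm of the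
limit, converge. -/
theorem tendsto_of_inner_tendsto {ι V H : Type*} [NormedAddCommGroup H] [InnerProductSpace ℂ H]
    {l : Filter ι} {D : ι → H} {w : H} {S : V → H} (hS : DenseRange S)
    (hb : ∀ᶠ t in l, ‖D t‖ ≤ ‖w‖)
    (h : ∀ φ, Tendsto (fun t => ⟪S φ, D t⟫_ℂ) l (𝓝 ⟪S φ, w⟫_ℂ)) : Tendsto D l (𝓝 w) := by
  have h1 : ∀ ε > 0, ∀ᶠ t in l, ‖D t - w‖ ^ 2 < ε := by
    intro ε hε
    obtain ⟨φ, hφ⟩ := hS.exists_dist_lt w (ε := ε / (8 * (‖w‖ + 1))) (by positivity)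
    rw [dist_eq_norm, lt_div_iff₀ (by positivity)] at hφ
    filter_upwards [hb, Metric.tendsto_nhds.1 (h φ) (ε / 8) (by positivity)] with t ht1 ht2
    rw [dist_eq_norm, ← inner_sub_right] at ht2
    have e1 : ‖D t - w‖ ^ 2 = ‖D t‖ ^ 2 - 2 * (⟪w, D t⟫_ℂ).re + ‖w‖ ^ 2 := by
      rw [@norm_sub_sq ℂ, ← inner_conj_symm (D t) w, RCLike.conj_re]; rfl
    have e2 : ⟪w, D t⟫_ℂ = ⟪w - S φ, D t - w⟫_ℂ + ⟪S φ, D t - w⟫_ℂ + ⟪w, w⟫_ℂ := by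
      rw [inner_sub_left, inner_sub_right, inner_sub_right]; ring
    have e3 : (⟪w, w⟫_ℂ).re = ‖w‖ ^ 2 := inner_self_eq_norm_sq (𝕜 := ℂ) w
    have e4 := congrArg Complex.re e2
    rw [Complex.add_re, Complex.add_re, e3] at e4
    have e5 := (abs_le.1 (Complex.abs_re_le_norm ⟪S φ, D t - w⟫_ℂ)).1
    have e6 := (abs_le.1 (Complex.abs_re_le_norm ⟪w - S φ, D t - w⟫_ℂ)).1
    have e7 := norm_inner_le_norm (𝕜 := ℂ) (w - S φ) (D t - w)
    have e8 : ‖D t - w‖ ≤ 2 * ‖w‖ := (norm_sub_le _ _).trans (by linarith)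
    have e9 : ‖w - S φ‖ * ‖D t - w‖ ≤ ε / 4 := by
      nlinarith [norm_nonneg (w - S φ), norm_nonneg w]
    have e10 : ‖D t‖ ^ 2 ≤ ‖w‖ ^ 2 := pow_le_pow_left₀ (norm_nonneg _) ht1 2
    linarith
  rw [Metric.tendsto_nhds]
  intro ε hε
  filter_upwards [h1 (ε ^ 2) (by positivity)] with t ht
  rw [dist_eq_norm]
  exact lt_of_pow_lt_pow_left₀ 2 hε.le ht

/-- The difference quotients of the magnetic translations converge on the form domain. -/
theorem tendsto_diffQuot {β : ℝ} {j : Fin 3} {u g : L2} (hg : HasWeakMagneticMomentum β j u g) :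
    Tendsto (fun t : ℝ => ((t : ℂ)⁻¹) • (magTrans β j t u - u)) (𝓝[≠] 0)
      (𝓝 (Complex.I • g)) := by
  refine tendsto_of_inner_tendsto TestFun.denseRange_toL2 ?_ fun φ => ?_
  · filter_upwards [self_mem_nhdsWithin] with t ht
    have ht' : 0 < |t| := abs_pos.2 ht
    rw [norm_smul, norm_smul, Complex.norm_I, one_mul, norm_inv, Complex.norm_real,
      Real.norm_eq_abs, inv_mul_le_iff₀ ht']
    exact norm_magTrans_sub_le hg t
  · have h1 := (hasDerivAt_inner_trans hg φ (-0))
    have h2 := h1.scomp (0 : ℝ) (hasDerivAt_neg (0 : ℝ))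
    have h0 : ∀ v : L2, magTrans β j 0 v = v := fun v => by
      refine Lp.ext ((coeFn_magTrans β j 0 v).trans ?_)
      exact Eventually.of_forall fun x => by simp [phase]
    rw [hasDerivAt_iff_tendsto_slope] at h2
    rw [neg_zero, h0] at h2
    refine (h2.congr' ?_).trans_eq ?_ 
    · filter_upwards with t
      simp only [slope, Function.comp, vsub_eq_sub, neg_zero, h0, sub_zero, inner_magTrans_left,
        neg_neg, inner_smul_right, inner_sub_right]
      simp
    · rw [inner_smul_right]; simp

/-! ### The Landau lower bound and Hardy's inequality -/

/-- The Weyl relation `U¹_s U²_t = exp (i β s t) U²_t U¹_s`, in a weak form. -/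
theorem inner_magTrans_weyl (β : ℝ) (s t : ℝ) (u : L2) :
    ⟪magTrans β 0 s u, magTrans β 1 t u⟫_ℂ =
      Complex.exp (((-(β * s * t) : ℝ) : ℂ) * Complex.I) *
        ⟪magTrans β 1 (-t) u, magTrans β 0 (-s) u⟫_ℂ := by
  rw [inner_eq_integral, inner_eq_integral, ← integral_const_mul,
    ← integral_add_right_eq_self (fun x => Complex.exp (((-(β * s * t) : ℝ) : ℂ) * Complex.I) *
      (starRingEnd ℂ (magTrans β 1 (-t) u x) * magTrans β 0 (-s) u x)) (s • dir 0 + t • dir 1)]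
  refine integral_congr_ae ?_
  filter_upwards [coeFn_magTrans β 0 s u, coeFn_magTrans β 1 t u,
    ae_add_right (s • dir 0 + t • dir 1) (coeFn_magTrans β 1 (-t) u),
    ae_add_right (s • dir 0 + t • dir 1) (coeFn_magTrans β 0 (-s) u)] with x h1 h2 h3 h4
  rw [h1, h2, h3, h4, map_mul, map_mul, conj_phase, conj_phase, neg_neg,
    show x + (s • dir 0 + t • dir 1) + -t • dir 1 = x + s • dir 0 by rw [neg_smul]; abel,
    show x + (s • dir 0 + t • dir 1) + -s • dir 0 = x + t • dir 1 by rw [neg_smul]; abel]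
  have h5 : phase β 0 (-s) x * phase β 1 t x = Complex.exp (((-(β * s * t) : ℝ) : ℂ) * Complex.I) *
      (phase β 1 t (x + (s • dir 0 + t • dir 1)) * phase β 0 (-s) (x + (s • dir 0 + t • dir 1))) := by
    simp only [phase, ← Complex.exp_add, vectorPotential_zero, vectorPotential_one]
    congr 1
    simp
    ring
  linear_combination (starRingEnd ℂ (u (x + s • dir 0)) * u (x + t • dir 1)) * h5

theorem tendsto_magTrans {β : ℝ} {j : Fin 3} {u g : L2} (hg : HasWeakMagneticMomentum β j u g) :
    Tendsto (fun t : ℝ => magTrans β j t u) (𝓝 0) (𝓝 u) := by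
  rw [tendsto_iff_norm_sub_tendsto_zero]
  refine squeeze_zero (fun _ => norm_nonneg _) (fun t => norm_magTrans_sub_le hg t) ?_
  have : Tendsto (fun t : ℝ => |t| * ‖g‖) (𝓝 0) (𝓝 (|0| * ‖g‖)) :=
    (continuous_abs.tendsto 0).mul_const _
  simpa using this

/-- The commutation relation `[π₁, π₂] = -iβ` in the sense of quadratic forms on the form domain. -/
theorem inner_sub_inner_eq {β : ℝ} {u g₀ g₁ : L2} (h₀ : HasWeakMagneticMomentum β 0 u g₀)
    (h₁ : HasWeakMagneticMomentum β 1 u g₁) :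
    ⟪g₀, g₁⟫_ℂ - ⟪g₁, g₀⟫_ℂ = -Complex.I * β * (‖u‖ : ℂ) ^ 2 := by
  have hneg : Tendsto (fun t : ℝ => -t) (𝓝[≠] 0) (𝓝[≠] 0) := by
    refine tendsto_nhdsWithin_iff.2 ⟨?_, ?_⟩
    · have := (continuous_neg.tendsto (0 : ℝ)).mono_left (nhdsWithin_le_nhds (s := {0}ᶜ))
      simpa using this
    · filter_upwards [self_mem_nhdsWithin] with t ht
      simpa using ht
  have t1 := (tendsto_diffQuot h₀).inner (𝕜 := ℂ) (tendsto_diffQuot h₁)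
  have t2 := ((tendsto_diffQuot h₁).comp hneg).inner (𝕜 := ℂ) ((tendsto_diffQuot h₀).comp hneg)
  have t3 := t1.sub t2
  have t4 : Tendsto (fun t : ℝ => (((t : ℂ) ^ 2)⁻¹ *
      (1 - Complex.exp (((β * t * t : ℝ) : ℂ) * Complex.I))) *
        ⟪magTrans β 0 t u, magTrans β 1 t u⟫_ℂ) (𝓝[≠] 0) (𝓝 ((-Complex.I * β) * ⟪u, u⟫_ℂ)) := by
    refine Tendsto.mul ?_ (((tendsto_magTrans h₀).inner (tendsto_magTrans h₁)).mono_left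
      nhdsWithin_le_nhds)
    have d : HasDerivAt (fun y : ℝ => Complex.exp (((β * y : ℝ) : ℂ) * Complex.I))
        (β * Complex.I) 0 := by
      have d1 : HasDerivAt (fun y : ℝ => ((β * y : ℝ) : ℂ) * Complex.I) (β * Complex.I) 0 := by
        have := (((hasDerivAt_id (0 : ℝ)).const_mul β).ofReal_comp).mul_const Complex.I
        simpa using this
      simpa using d1.cexp
    rw [hasDerivAt_iff_tendsto_slope] at d
    have hsq : Tendsto (fun t : ℝ => t * t) (𝓝[≠] 0) (𝓝[≠] 0) := by
      refine tendsto_nhdsWithin_iff.2 ⟨?_, ?_⟩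
      · have := ((show Continuous fun t : ℝ => t * t by fun_prop).tendsto 0).mono_left
          (nhdsWithin_le_nhds (s := {0}ᶜ))
        simpa using this
      · filter_upwards [self_mem_nhdsWithin] with t ht
        simpa using ht
    have d2 := (d.comp hsq).neg
    refine (d2.congr' ?_).trans_eq (by ring_nf)
    filter_upwards with t
    simp [slope]
    ring_nf
  have huniq := tendsto_nhds_unique (t3.congr' ?_) t4
  · rw [inner_smul_left, inner_smul_right, inner_smul_left, inner_smul_right,
      inner_self_eq_norm_sq_to_K] at huniq
    simp only [Complex.conj_I] at huniq
    have hI := Complex.I_mul_I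
    change _ = -Complex.I * β * ((‖u‖ : ℝ) : ℂ) ^ 2 at huniq
    linear_combination huniq + (⟪g₀, g₁⟫_ℂ - ⟪g₁, g₀⟫_ℂ) * hI
  · filter_upwards [self_mem_nhdsWithin] with t ht
    have ht0 : (t : ℂ) ≠ 0 := by simpa using ht
    have w := inner_magTrans_weyl β t t u
    have w' : ⟪magTrans β 1 (-t) u, magTrans β 0 (-t) u⟫_ℂ =
        Complex.exp (((β * t * t : ℝ) : ℂ) * Complex.I) *
          ⟪magTrans β 0 t u, magTrans β 1 t u⟫_ℂ := by
      rw [w, ← mul_assoc, ← Complex.exp_add]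
      simp
    have a1 := inner_magTrans_left β 0 t u u
    have a2 := inner_magTrans_left β 1 (-t) u u
    rw [neg_neg] at a2
    simp only [Function.comp, inner_smul_left, inner_smul_right, inner_sub_left, inner_sub_right,
      map_inv₀, map_neg, Complex.conj_ofReal, Complex.ofReal_neg]
    rw [w', a1, a2]
    field_simp
    ring

/-- On the form domain `‖π₁u‖² + ‖π₂u‖² - β‖u‖² = ‖(π₁ - iπ₂)u‖²`; in particular the lowest Landau
level has energy `β`. -/
theorem norm_sub_I_smul_sq {β : ℝ} {u g₀ g₁ : L2} (h₀ : HasWeakMagneticMomentum β 0 u g₀)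
    (h₁ : HasWeakMagneticMomentum β 1 u g₁) :
    ‖g₀ - Complex.I • g₁‖ ^ 2 + β * ‖u‖ ^ 2 = ‖g₀‖ ^ 2 + ‖g₁‖ ^ 2 := by
  have h := inner_sub_inner_eq h₀ h₁
  rw [← inner_conj_symm g₁ g₀] at h
  have h2 := congrArg Complex.im h
  rw [@norm_sub_sq ℂ, inner_smul_right, norm_smul]
  have h3 : (-Complex.I * β * (‖u‖ : ℂ) ^ 2).im = -(β * ‖u‖ ^ 2) := by
    rw [show -Complex.I * β * (‖u‖ : ℂ) ^ 2 = ((-(β * ‖u‖ ^ 2) : ℝ) : ℂ) * Complex.I by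
      push_cast; ring]
    simp [-Complex.ofReal_neg]
  rw [h3, Complex.sub_im, Complex.conj_im] at h2
  have h4 : RCLike.re (Complex.I * ⟪g₀, g₁⟫_ℂ) = -(⟪g₀, g₁⟫_ℂ).im := by
    simp
  rw [h4]
  simp
  linarith

theorem norm_L2_sq (u : L2) : ‖u‖ ^ 2 = ∫ x, ‖u x‖ ^ 2 := by
  have h := inner_eq_integral u u
  rw [inner_self_eq_norm_sq_to_K] at h
  have h2 : ∫ x, starRingEnd ℂ (u x) * u x = ((∫ x, ‖u x‖ ^ 2 : ℝ) : ℂ) := by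
    rw [← integral_complex_ofReal]
    refine integral_congr_ae (Eventually.of_forall fun x => ?_)
    change starRingEnd ℂ (u x) * u x = _
    rw [← Complex.normSq_eq_conj_mul_self, Complex.normSq_eq_norm_sq]
  rw [h2] at h
  exact Complex.ofReal_injective (by push_cast; exact h)

theorem integrable_norm_sq (u : L2) : Integrable (fun x => ‖u x‖ ^ 2) volume :=
  (memLp_two_iff_integrable_sq_norm (Lp.aestronglyMeasurable u)).1 (Lp.memLp u)

/-- Integration by parts for the density of a form domain function. -/
theorem two_re_inner_boundedMul {β : ℝ} {j : Fin 3} {u g : L2}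
    (hg : HasWeakMagneticMomentum β j u g) {F : Space → ℝ} (hF : ContDiff ℝ 1 F) {C : ℝ}
    (hC : ∀ x, ‖F x‖ ≤ C) {C' : ℝ} (hC' : ∀ x, ‖fderiv ℝ F x‖ ≤ C')
    (hm : Measurable fun x => (F x : ℂ)) (hb : ∀ x, ‖(F x : ℂ)‖ ≤ C) :
    2 * (⟪boundedMul (fun x => (F x : ℂ)) hm C hb u, Complex.I • g⟫_ℂ).re =
      -∫ x, fderiv ℝ F x (dir j) * ‖u x‖ ^ 2 := by
  set Fu := boundedMul (fun x => (F x : ℂ)) hm C hb u with hFu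
  have hC0 : 0 ≤ C := (norm_nonneg _).trans (hC 0)
  have hFm : Measurable F := hF.continuous.measurable
  have hdiff : Differentiable ℝ F := hF.differentiable (by simp)
  have hint : ∀ v : L2, Integrable (fun x => F x * ‖v x‖ ^ 2) volume := fun v =>
    (integrable_norm_sq v).bdd_mul hFm.aestronglyMeasurable (Eventually.of_forall hC)
  have hlip : ∀ x y, ‖F y - F x‖ ≤ C' * ‖y - x‖ := fun x y =>
    Convex.norm_image_sub_le_of_norm_fderiv_le (fun z _ => hdiff z) (fun z _ => hC' z)
      convex_univ trivial trivial
  -- the expansion of `|U_t u|² - |u|²`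
  have key : ∀ t : ℝ, 2 * (⟪Fu, magTrans β j t u - u⟫_ℂ).re =
      (∫ x, (F (x + -t • dir j) - F x) * ‖u x‖ ^ 2) -
        ∫ x, F x * ‖(magTrans β j t u - u : L2) x‖ ^ 2 := by
    intro t
    set v := magTrans β j t u with hv
    have e1 : (⟪Fu, v - u⟫_ℂ).re = ∫ x, (⟪Fu x, (v - u : L2) x⟫_ℂ).re := by
      rw [L2.inner_def]
      exact (integral_re (L2.integrable_inner (𝕜 := ℂ) Fu (v - u))).symm
    have e2 : ∫ x, F x * ‖v x‖ ^ 2 = ∫ x, F (x + -t • dir j) * ‖u x‖ ^ 2 := by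
      rw [← integral_add_right_eq_self (fun x => F (x + -t • dir j) * ‖u x‖ ^ 2) (t • dir j)]
      refine integral_congr_ae ?_
      filter_upwards [coeFn_magTrans β j t u] with x hx
      rw [hv, hx, norm_mul, norm_phase, one_mul, neg_smul, add_neg_cancel_right]
    have i2 : Integrable (fun x => F (x + -t • dir j) * ‖u x‖ ^ 2) volume :=
      (integrable_norm_sq u).bdd_mul (hF.continuous.comp (continuous_id.add
        continuous_const)).aestronglyMeasurable (Eventually.of_forall fun x => hC _)
    simp_rw [sub_mul]
    rw [e1, integral_sub i2 (hint u), ← e2, ← integral_sub (hint v) (hint u),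
      ← integral_sub (f := fun x => F x * ‖v x‖ ^ 2 - F x * ‖u x‖ ^ 2)
        ((hint v).sub (hint u)) (hint _), ← integral_const_mul]
    refine integral_congr_ae ?_
    filter_upwards [coeFn_boundedMul hm hb u, Lp.coeFn_sub v u] with x h1 h2
    rw [hFu, h1, h2, RCLike.inner_apply]
    simp only [Pi.sub_apply, map_mul, Complex.conj_ofReal]
    have n : ∀ z : ℂ, ‖z‖ ^ 2 = z.re * z.re + z.im * z.im := fun z => by
      rw [← Complex.normSq_eq_norm_sq, Complex.normSq_apply]
    rw [n, n, n]
    simp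
    ring
  have lim1 : Tendsto (fun t : ℝ => 2 * (⟪Fu, ((t : ℂ)⁻¹) • (magTrans β j t u - u)⟫_ℂ).re)
      (𝓝[≠] 0) (𝓝 (2 * (⟪Fu, Complex.I • g⟫_ℂ).re)) :=
    ((Complex.continuous_re.tendsto _).comp
      (tendsto_const_nhds.inner (tendsto_diffQuot hg))).const_mul 2
  have lim2 : Tendsto (fun t : ℝ => ∫ x, (t⁻¹ * (F (x + -t • dir j) - F x)) * ‖u x‖ ^ 2)
      (𝓝[≠] 0) (𝓝 (∫ x, -(fderiv ℝ F x (dir j)) * ‖u x‖ ^ 2)) := by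
    refine tendsto_integral_filter_of_dominated_convergence (fun x => C' * ‖u x‖ ^ 2) ?_ ?_
      ((integrable_norm_sq u).const_mul _) ?_
    · refine Eventually.of_forall fun t => ?_
      have : Continuous fun x : Space => t⁻¹ * (F (x + -t • dir j) - F x) := by
        have := hF.continuous
        fun_prop
      exact this.aestronglyMeasurable.mul (integrable_norm_sq u).1
    · filter_upwards [self_mem_nhdsWithin] with t ht
      refine Eventually.of_forall fun x => ?_
      rw [norm_mul, norm_pow, norm_norm]
      refine mul_le_mul_of_nonneg_right ?_ (by positivity)
      rw [norm_mul, norm_inv]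
      have ht' : 0 < ‖t‖ := norm_pos_iff.2 ht
      rw [inv_mul_le_iff₀ ht']
      refine (hlip _ _).trans (le_of_eq ?_)
      simp [norm_smul, mul_comm]
    · refine Eventually.of_forall fun x => ?_
      refine Tendsto.mul_const _ ?_
      have h1 : HasDerivAt (fun s : ℝ => x + -s • dir j) (-dir j) 0 := by
        simpa using (((hasDerivAt_id (0 : ℝ)).neg).smul_const (dir j)).const_add x
      have h2 : HasDerivAt (fun s : ℝ => F (x + -s • dir j)) (fderiv ℝ F x (-dir j)) 0 := by
        have := (hdiff (x + -(0 : ℝ) • dir j)).hasFDerivAt.comp_hasDerivAt (0 : ℝ) h1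
        rw [neg_zero, zero_smul, add_zero] at this
        exact this
      rw [hasDerivAt_iff_tendsto_slope] at h2
      rw [map_neg] at h2
      refine h2.congr fun t => ?_
      simp [slope]
  have lim3 : Tendsto (fun t : ℝ => t⁻¹ * ∫ x, F x * ‖(magTrans β j t u - u : L2) x‖ ^ 2)
      (𝓝[≠] 0) (𝓝 0) := by
    refine squeeze_zero_norm' (a := fun t => C * (|t| * ‖g‖ ^ 2)) ?_ ?_
    · filter_upwards [self_mem_nhdsWithin] with t ht
      have ht' : 0 < |t| := abs_pos.2 ht
      rw [norm_mul, norm_inv, Real.norm_eq_abs t, inv_mul_le_iff₀ ht']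
      refine (norm_integral_le_integral_norm _).trans ?_
      calc ∫ x, ‖F x * ‖(magTrans β j t u - u : L2) x‖ ^ 2‖
          ≤ ∫ x, C * ‖(magTrans β j t u - u : L2) x‖ ^ 2 := by
            refine integral_mono (hint _).norm ((integrable_norm_sq _).const_mul _) fun x => ?_
            change ‖F x * _‖ ≤ _
            rw [norm_mul, norm_pow, norm_norm]
            exact mul_le_mul_of_nonneg_right (hC x) (by positivity)
        _ = C * ‖magTrans β j t u - u‖ ^ 2 := by rw [integral_const_mul, norm_L2_sq]
        _ ≤ C * (|t| * ‖g‖) ^ 2 := by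
            gcongr; exact norm_magTrans_sub_le hg t
        _ = _ := by ring
    · have : Tendsto (fun t : ℝ => C * (|t| * ‖g‖ ^ 2)) (𝓝[≠] 0) (𝓝 (C * (|0| * ‖g‖ ^ 2))) :=
        (((continuous_abs.tendsto (0 : ℝ)).mul_const _).const_mul _).mono_left nhdsWithin_le_nhds
      simpa using this
  have lim4 := lim2.sub lim3
  rw [sub_zero] at lim4
  have := tendsto_nhds_unique lim1 (lim4.congr fun t => ?_)
  · rw [this, ← integral_neg]
    simp
  · rw [inner_smul_right]
    have k := key t
    simp_rw [mul_assoc, integral_const_mul]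
    rw [← mul_sub, ← k, ← Complex.ofReal_inv, Complex.re_ofReal_mul]
    ring

theorem norm_sq_eq_sum (y : Space) : ‖y‖ ^ 2 = ∑ j, y j ^ 2 := by
  rw [EuclideanSpace.norm_sq_eq]; simp

theorem abs_coord_le (y : Space) (j : Fin 3) : |y j| ≤ ‖y‖ := by
  simpa using PiLp.norm_apply_le y j

/-- The regularized Hardy inequality. It follows from expanding
`0 ≤ ∑ ‖(π_j - i F_j / 2) u‖²` with the vector field `F(x) = (x - p) / (|x - p|² + δ²)`. -/
theorem hardy_regularized {β : ℝ} {u : L2} {g : Fin 3 → L2}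
    (hg : ∀ j, HasWeakMagneticMomentum β j u (g j)) (p : Space) {δ : ℝ} (hδ : 0 < δ) :
    ∫ x, (‖x - p‖ ^ 2 + δ ^ 2)⁻¹ * ‖u x‖ ^ 2 ≤ 4 * ∑ j, ‖g j‖ ^ 2 := by
  set q : Space → ℝ := fun x => ‖x - p‖ ^ 2 + δ ^ 2 with hq
  have hqpos : ∀ x, 0 < q x := fun x => by positivity
  have hqδ : ∀ x, δ ^ 2 ≤ q x := fun x => by simp only [hq]; nlinarith [sq_nonneg ‖x - p‖]
  have hqr : ∀ x, ‖x - p‖ ^ 2 ≤ q x := fun x => by simp only [hq]; nlinarith [sq_nonneg δ]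
  have hqsm : ContDiff ℝ 1 q := by
    have : ContDiff ℝ 1 fun x : Space => ‖x - p‖ ^ 2 := (contDiff_id.sub contDiff_const).norm_sq ℝ
    exact this.add contDiff_const
  let F : Fin 3 → Space → ℝ := fun j x => (x j - p j) * (q x)⁻¹
  have hF : ∀ j, ContDiff ℝ 1 (F j) := fun j => by
    have h1 : ContDiff ℝ 1 fun x : Space => x j - p j := by fun_prop
    exact h1.mul (hqsm.inv fun x => (hqpos x).ne')
  have hd : ∀ j x, HasFDerivAt (F j)
      ((x j - p j) • (-(q x ^ 2)⁻¹ • (2 • innerSL ℝ (x - p))) +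
        (q x)⁻¹ • (EuclideanSpace.proj j : Space →L[ℝ] ℝ)) x := fun j x => by
    have h1 : HasFDerivAt (fun x : Space => x j - p j) (EuclideanSpace.proj j : Space →L[ℝ] ℝ) x :=
      (EuclideanSpace.proj j : Space →L[ℝ] ℝ).hasFDerivAt.sub_const _
    have h2 : HasFDerivAt q (2 • innerSL ℝ (x - p)) x := by
      have := ((hasFDerivAt_id x).sub_const p).norm_sq.add_const (δ ^ 2)
      exact this
    exact h1.mul ((hasDerivAt_inv (hqpos x).ne').comp_hasFDerivAt x h2)
  have hcoord : ∀ j (x : Space), |x j - p j| ≤ ‖x - p‖ := fun j x => abs_coord_le (x - p) j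
  have hFb : ∀ j x, ‖F j x‖ ≤ δ⁻¹ := fun j x => by
    simp only [F]
    rw [norm_mul, norm_inv, Real.norm_eq_abs, Real.norm_eq_abs, abs_of_pos (hqpos x),
      ← div_eq_mul_inv, div_le_iff₀ (hqpos x)]
    refine (hcoord j x).trans ?_
    rw [inv_mul_eq_div, le_div_iff₀ hδ]
    simp only [hq]
    nlinarith [sq_nonneg (‖x - p‖ - δ), sq_nonneg ‖x - p‖, sq_nonneg δ]
  have hF'b : ∀ j x, ‖fderiv ℝ (F j) x‖ ≤ 3 * (δ ^ 2)⁻¹ := fun j x => by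
    rw [(hd j x).fderiv]
    have hi : (q x)⁻¹ ≤ (δ ^ 2)⁻¹ := inv_anti₀ (by positivity) (hqδ x)
    have e1 : ‖(x j - p j) • (-(q x ^ 2)⁻¹ • (2 • innerSL ℝ (x - p)))‖ ≤ 2 * (q x)⁻¹ := by
      rw [norm_smul, norm_smul, norm_neg, norm_inv, Real.norm_eq_abs,
        Real.norm_of_nonneg (sq_nonneg _)]
      have : ‖(2 • innerSL ℝ (x - p) : Space →L[ℝ] ℝ)‖ ≤ 2 * ‖x - p‖ := by
        refine (norm_nsmul_le).trans ?_
        rw [innerSL_apply_norm]; simp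
      calc |x j - p j| * ((q x ^ 2)⁻¹ * ‖(2 • innerSL ℝ (x - p) : Space →L[ℝ] ℝ)‖)
          ≤ ‖x - p‖ * ((q x ^ 2)⁻¹ * (2 * ‖x - p‖)) := by
            gcongr; exact hcoord j x
        _ = 2 * (‖x - p‖ ^ 2 * (q x ^ 2)⁻¹) := by ring
        _ ≤ 2 * (q x * (q x ^ 2)⁻¹) := by gcongr; exact hqr x
        _ = 2 * (q x)⁻¹ := by have := (hqpos x).ne'; field_simp
    have e2 : ‖(q x)⁻¹ • (EuclideanSpace.proj j : Space →L[ℝ] ℝ)‖ ≤ (q x)⁻¹ := by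
      rw [norm_smul, norm_inv, Real.norm_of_nonneg (hqpos x).le]
      refine mul_le_of_le_one_right (by have := hqpos x; positivity) ?_
      refine ContinuousLinearMap.opNorm_le_bound _ zero_le_one fun y => ?_
      rw [one_mul]; exact abs_coord_le y j
    refine (norm_add_le _ _).trans ?_
    linarith
  have hm : ∀ j, Measurable fun x => (F j x : ℂ) := fun j =>
    Complex.measurable_ofReal.comp (hF j).continuous.measurable
  have hb : ∀ j x, ‖(F j x : ℂ)‖ ≤ δ⁻¹ := fun j x => by rw [Complex.norm_real]; exact hFb j x
  have hpart : ∀ j, ∫ x, (1 / 2 * fderiv ℝ (F j) x (dir j) - 1 / 4 * F j x ^ 2) * ‖u x‖ ^ 2 ≤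
      ‖g j‖ ^ 2 := by
    intro j
    have h1 := two_re_inner_boundedMul (hg j) (hF j) (hFb j) (hF'b j) (hm j) (hb j)
    set Fu := boundedMul (fun x => (F j x : ℂ)) (hm j) δ⁻¹ (hb j) u with hFu
    have h2 : ‖Fu‖ ^ 2 = ∫ x, F j x ^ 2 * ‖u x‖ ^ 2 := by
      rw [norm_L2_sq]
      refine integral_congr_ae ?_
      filter_upwards [coeFn_boundedMul (hm j) (hb j) u] with x hx
      rw [hFu, hx, norm_mul, Complex.norm_real, mul_pow, Real.norm_eq_abs, sq_abs]
    have h3 : 0 ≤ ‖Complex.I • g j + (1 / 2 : ℂ) • Fu‖ ^ 2 := by positivity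
    rw [@norm_add_sq ℂ, norm_smul, norm_smul, Complex.norm_I, one_mul, inner_smul_right,
      ← inner_conj_symm] at h3
    have h4 : RCLike.re ((1 / 2 : ℂ) * starRingEnd ℂ ⟪Fu, Complex.I • g j⟫_ℂ) =
        1 / 2 * (⟪Fu, Complex.I • g j⟫_ℂ).re := by
      rw [show (1 / 2 : ℂ) = ((1 / 2 : ℝ) : ℂ) by push_cast; rfl]
      exact (Complex.re_ofReal_mul _ _).trans (congrArg _ (Complex.conj_re _))
    rw [h4, mul_pow, h2] at h3
    have i1 : Integrable (fun x => fderiv ℝ (F j) x (dir j) * ‖u x‖ ^ 2) volume := by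
      refine (integrable_norm_sq u).bdd_mul (c := 3 * (δ ^ 2)⁻¹)
        (((hF j).continuous_fderiv (by simp)).clm_apply continuous_const).aestronglyMeasurable
        (Eventually.of_forall fun x => ?_)
      refine (ContinuousLinearMap.le_opNorm _ _).trans ?_
      simpa using hF'b j x
    have i2 : Integrable (fun x => F j x ^ 2 * ‖u x‖ ^ 2) volume := by
      refine (integrable_norm_sq u).bdd_mul (c := δ⁻¹ ^ 2)
        ((hF j).continuous.pow 2).aestronglyMeasurable
        (Eventually.of_forall fun x => ?_)
      rw [norm_pow]
      exact pow_le_pow_left₀ (norm_nonneg _) (hFb j x) 2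
    have h5 : ∫ x, (1 / 2 * fderiv ℝ (F j) x (dir j) - 1 / 4 * F j x ^ 2) * ‖u x‖ ^ 2 =
        1 / 2 * (∫ x, fderiv ℝ (F j) x (dir j) * ‖u x‖ ^ 2) -
          1 / 4 * ∫ x, F j x ^ 2 * ‖u x‖ ^ 2 := by
      rw [← integral_const_mul, ← integral_const_mul, ← integral_sub (i1.const_mul _)
        (i2.const_mul _)]
      exact integral_congr_ae (Eventually.of_forall fun x => by simp only []; ring)
    rw [h5]
    have h6 : ‖(1 / 2 : ℂ)‖ ^ 2 = 1 / 4 := by norm_num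
    rw [h6] at h3
    linarith
  have i3 : ∀ j, Integrable (fun x => (1 / 2 * fderiv ℝ (F j) x (dir j) - 1 / 4 * F j x ^ 2) *
      ‖u x‖ ^ 2) volume := by
    intro j
    refine (integrable_norm_sq u).bdd_mul (c := 1 / 2 * (3 * (δ ^ 2)⁻¹) + 1 / 4 * δ⁻¹ ^ 2)
        (((continuous_const.mul (((hF j).continuous_fderiv (by simp)).clm_apply
          continuous_const)).sub (continuous_const.mul
            ((hF j).continuous.pow 2))).aestronglyMeasurable)
        (Eventually.of_forall fun x => ?_)
    refine (norm_sub_le _ _).trans ?_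
    rw [norm_mul, norm_mul, norm_pow]
    have a1 : ‖fderiv ℝ (F j) x (dir j)‖ ≤ 3 * (δ ^ 2)⁻¹ := by
      refine (ContinuousLinearMap.le_opNorm _ _).trans ?_
      simpa using hF'b j x
    have a2 := pow_le_pow_left₀ (norm_nonneg _) (hFb j x) 2
    norm_num at a1 a2 ⊢
    linarith
  have i4 : Integrable (fun x => (q x)⁻¹ * ‖u x‖ ^ 2) volume := by
    refine (integrable_norm_sq u).bdd_mul (c := (δ ^ 2)⁻¹)
      ((hqsm.inv fun x => (hqpos x).ne').continuous).aestronglyMeasurable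
      (Eventually.of_forall fun x => ?_)
    rw [norm_inv, Real.norm_of_nonneg (hqpos x).le]
    exact inv_anti₀ (by positivity) (hqδ x)
  have hsum : ∫ x, (1 / 4) * ((q x)⁻¹ * ‖u x‖ ^ 2) ≤ ∑ j, ‖g j‖ ^ 2 := by
    refine le_trans ?_ (Finset.sum_le_sum fun j _ => hpart j)
    rw [← integral_finsetSum _ fun j _ => i3 j]
    refine integral_mono (i4.const_mul _) (integrable_finsetSum _ fun j _ => i3 j) fun x => ?_
    simp only []
    rw [← Finset.sum_mul, ← mul_assoc]
    refine mul_le_mul_of_nonneg_right ?_ (by positivity)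
    have hp := (hqpos x)
    have hn : ‖x - p‖ ^ 2 = ∑ j, (x j - p j) ^ 2 := norm_sq_eq_sum (x - p)
    have hder : ∀ j, fderiv ℝ (F j) x (dir j) =
        (q x)⁻¹ - 2 * (x j - p j) ^ 2 * (q x ^ 2)⁻¹ := fun j => by
      rw [(hd j x).fderiv]
      simp [dir, EuclideanSpace.inner_single_right]
      ring
    have hr := hqr x
    have hsumval : ∑ j, (1 / 2 * fderiv ℝ (F j) x (dir j) - 1 / 4 * F j x ^ 2) =
        3 / 2 * (q x)⁻¹ - 5 / 4 * ‖x - p‖ ^ 2 * (q x ^ 2)⁻¹ := by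
      rw [hn, Fin.sum_univ_three, Fin.sum_univ_three, hder, hder, hder]
      simp only [F, mul_pow, inv_pow]
      ring
    rw [hsumval]
    have : ‖x - p‖ ^ 2 * (q x ^ 2)⁻¹ ≤ (q x)⁻¹ := by
      calc ‖x - p‖ ^ 2 * (q x ^ 2)⁻¹ ≤ q x * (q x ^ 2)⁻¹ := by gcongr
        _ = (q x)⁻¹ := by have := hp.ne'; field_simp
    linarith
  rw [integral_const_mul] at hsum
  simp only [hq] at hsum ⊢
  linarith

/-- **Hardy's inequality** for the magnetic form, centred at an arbitrary point. -/
theorem hardy (β : ℝ) (u : L2) (p : Space) :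
    ∫⁻ x, ‖u x‖ₑ ^ 2 / ‖x - p‖ₑ ^ 2 ≤ 4 * magneticForm β u := by
  by_cases htop : magneticForm β u = ⊤
  · rw [htop, ENNReal.mul_top (by simp)]; exact le_top
  obtain ⟨g, hg, hform⟩ := exists_weak_of_magneticForm_lt_top (lt_top_iff_ne_top.2 htop)
  have hsum : ∑ j, ‖g j‖ₑ ^ 2 = ENNReal.ofReal (∑ j, ‖g j‖ ^ 2) := by
    rw [ENNReal.ofReal_sum_of_nonneg fun _ _ => by positivity]
    simp_rw [ENNReal.ofReal_pow (norm_nonneg _), ofReal_norm]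
  set f : ℕ → Space → ℝ≥0∞ := fun n x =>
    ‖u x‖ₑ ^ 2 / (‖x - p‖ₑ ^ 2 + ENNReal.ofReal ((1 / ((n : ℝ) + 1)) ^ 2)) with hf
  have humeas : Measurable fun x => ‖u x‖ₑ ^ 2 := (Lp.stronglyMeasurable u).measurable.enorm.pow_const 2
  have hmeas : ∀ n, Measurable (f n) := fun n => by
    refine humeas.div ?_
    fun_prop
  have hbound : ∀ n, ∫⁻ x, f n x ≤ 4 * magneticForm β u := by
    intro n
    have hδ : (0 : ℝ) < 1 / ((n : ℝ) + 1) := by positivity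
    have h1 := hardy_regularized hg p hδ
    have h2 : ∀ x, f n x = ENNReal.ofReal ((‖x - p‖ ^ 2 + (1 / ((n : ℝ) + 1)) ^ 2)⁻¹ * ‖u x‖ ^ 2) :=
        fun x => by
      rw [ENNReal.ofReal_mul (by positivity), ENNReal.ofReal_inv_of_pos (by positivity),
        ENNReal.ofReal_add (by positivity) (by positivity), ENNReal.ofReal_pow (norm_nonneg _),
        ENNReal.ofReal_pow (norm_nonneg _), ofReal_norm, ofReal_norm, mul_comm]
      rfl
    simp_rw [h2]
    rw [← ofReal_integral_eq_lintegral_ofReal, hform, hsum]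
    · rw [show (4 : ℝ≥0∞) = ENNReal.ofReal 4 by simp, ← ENNReal.ofReal_mul (by norm_num)]
      exact ENNReal.ofReal_le_ofReal h1
    · refine (integrable_norm_sq u).bdd_mul (c := ((1 / ((n : ℝ) + 1)) ^ 2)⁻¹) ?_ ?_
      · refine Continuous.aestronglyMeasurable ?_
        exact Continuous.inv₀ (by fun_prop) fun x => by positivity
      · refine Eventually.of_forall fun x => ?_
        rw [norm_inv, Real.norm_of_nonneg (by positivity)]
        exact inv_anti₀ (by positivity) (by nlinarith [sq_nonneg ‖x - p‖])
    · exact Eventually.of_forall fun x => by positivity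
  have hlim : ∀ᵐ x : Space, ‖u x‖ₑ ^ 2 / ‖x - p‖ₑ ^ 2 = liminf (fun n => f n x) atTop := by
    have hp : ∀ᵐ x : Space, x ≠ p := by
      simp [ae_iff]
    filter_upwards [hp] with x hx
    refine (Tendsto.liminf_eq ?_).symm
    have h0 : Tendsto (fun n : ℕ => ENNReal.ofReal ((1 / ((n : ℝ) + 1)) ^ 2)) atTop (𝓝 0) := by
      have h1 : Tendsto (fun n : ℕ => (1 / ((n : ℝ) + 1)) ^ 2) atTop (𝓝 0) := by
        simpa using (tendsto_one_div_add_atTop_nhds_zero_nat (𝕜 := ℝ)).pow 2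
      simpa using ENNReal.tendsto_ofReal h1
    have hne : ‖x - p‖ₑ ^ 2 ≠ 0 := by simpa [sub_eq_zero] using hx
    refine ENNReal.Tendsto.div tendsto_const_nhds (Or.inr hne) ?_ (Or.inl (by simp))
    simpa using (tendsto_const_nhds (x := ‖x - p‖ₑ ^ 2)).add h0
  rw [lintegral_congr_ae hlim]
  refine (lintegral_liminf_le hmeas).trans ?_
  refine (liminf_le_liminf (Eventually.of_forall hbound)).trans ?_
  simp

/-! ### Density matrices in terms of diagonal matrix elements -/

/-- The diagonal matrix element `⟨f, T f⟩` of a positive operator. -/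
def quad (T : L2 →L[ℂ] L2) (f : L2) : ℝ≥0∞ := ENNReal.ofReal (⟪f, T f⟫_ℂ).re

/-- The sum of the diagonal matrix elements of `T` in a family of vectors. -/
def sumQuad {ι : Type*} (f : ι → L2) (T : L2 →L[ℂ] L2) : ℝ≥0∞ := ∑' i, quad T (f i)

theorem enorm_sq_eq_ofReal {E : Type*} [SeminormedAddCommGroup E] (x : E) :
    ‖x‖ₑ ^ 2 = ENNReal.ofReal (‖x‖ ^ 2) := by
  rw [ENNReal.ofReal_pow (norm_nonneg _), ofReal_norm]

theorem enorm_inner_symm (x y : L2) : ‖⟪x, y⟫_ℂ‖ₑ = ‖⟪y, x⟫_ℂ‖ₑ := by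
  rw [← ofReal_norm, ← ofReal_norm, norm_inner_symm]

namespace DensityMatrix

theorem quad_eq_tsum (Γ : DensityMatrix) (f : L2) :
    quad Γ.op f = ∑' k, (Γ.diag.w k : ℝ≥0∞) * ‖⟪Γ.diag.ψ k, f⟫_ℂ‖ₑ ^ 2 := by
  have h1 := Complex.hasSum_re (Γ.diag.ψ.hasSum_inner_mul_inner f (Γ.op f))
  have h2 : ∀ k, (⟪f, Γ.diag.ψ k⟫_ℂ * ⟪Γ.diag.ψ k, Γ.op f⟫_ℂ).re =
      (Γ.diag.w k : ℝ) * ‖⟪Γ.diag.ψ k, f⟫_ℂ‖ ^ 2 := by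
    intro k
    have hs : ⟪Γ.diag.ψ k, Γ.op f⟫_ℂ = ⟪Γ.op (Γ.diag.ψ k), f⟫_ℂ :=
      (Γ.isPositive.isSymmetric _ _).symm
    rw [hs, Γ.diag.apply_ψ, inner_smul_left, Complex.conj_ofReal, ← inner_conj_symm f,
      mul_left_comm, ← Complex.normSq_eq_conj_mul_self, Complex.re_ofReal_mul, Complex.ofReal_re,
      Complex.normSq_eq_norm_sq]
  rw [quad, ← h1.tsum_eq]
  simp_rw [h2]
  rw [ENNReal.ofReal_tsum_of_nonneg (fun k => by positivity) (h1.summable.congr fun k => (h2 k))]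
  refine tsum_congr fun k => ?_
  rw [ENNReal.ofReal_mul (by positivity), enorm_sq_eq_ofReal, ENNReal.ofReal_coe_nnreal]

theorem sumQuad_eq_tsum {ι : Type*} (Γ : DensityMatrix) (f : ι → L2) :
    sumQuad f Γ.op = ∑' k, (Γ.diag.w k : ℝ≥0∞) * ∑' i, ‖⟪f i, Γ.diag.ψ k⟫_ℂ‖ₑ ^ 2 := by
  simp_rw [sumQuad, quad_eq_tsum]
  rw [ENNReal.tsum_comm]
  refine tsum_congr fun k => ?_
  rw [ENNReal.tsum_mul_left]
  simp_rw [enorm_inner_symm]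

/-- The trace may be computed in every orthonormal basis. -/
theorem sumQuad_hilbertBasis {ι : Type*} (Γ : DensityMatrix) (b : HilbertBasis ι ℂ L2) :
    sumQuad b Γ.op = ∑' k, (Γ.diag.w k : ℝ≥0∞) := by
  rw [sumQuad_eq_tsum]
  refine tsum_congr fun k => ?_
  rw [tsum_enorm_inner_sq, ← ofReal_norm, Γ.diag.ψ.orthonormal.1 k]
  simp

theorem inner_nonneg (Γ : DensityMatrix) (f : L2) : 0 ≤ (⟪f, Γ.op f⟫_ℂ).re :=
  Γ.isPositive.re_inner_nonneg_right f

theorem trace_nonneg (Γ : DensityMatrix) : 0 ≤ Γ.trace :=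
  tsum_nonneg fun _ => Γ.inner_nonneg _

theorem ofReal_trace (Γ : DensityMatrix) :
    ENNReal.ofReal Γ.trace = ∑' k, (Γ.diag.w k : ℝ≥0∞) := by
  rw [← Γ.sumQuad_hilbertBasis basis, trace,
    ENNReal.ofReal_tsum_of_nonneg (fun _ => Γ.inner_nonneg _) Γ.summable]
  rfl

/-- `⟨f, Γ f⟩ ≤ Tr[Γ] ‖f‖²`. -/
theorem quad_le (Γ : DensityMatrix) (f : L2) :
    quad Γ.op f ≤ ENNReal.ofReal Γ.trace * ‖f‖ₑ ^ 2 := by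
  rw [quad_eq_tsum, ofReal_trace, ← ENNReal.tsum_mul_right]
  refine ENNReal.tsum_le_tsum fun k => ?_
  gcongr
  rw [← ofReal_norm, ← ofReal_norm]
  refine ENNReal.ofReal_le_ofReal ((norm_inner_le_norm _ _).trans ?_)
  rw [Γ.diag.ψ.orthonormal.1 k, one_mul]

instance (Γ : DensityMatrix) : Countable Γ.diag.ι := Γ.diag.countable

theorem measurable_enorm_sq (u : L2) : Measurable fun x => ‖u x‖ₑ ^ 2 :=
  (Lp.stronglyMeasurable u).measurable.enorm.pow_const 2

theorem measurable_density (Γ : DensityMatrix) : Measurable Γ.density :=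
  Measurable.tsum fun _ => (measurable_enorm_sq _).const_mul _

/-- Integration against the density, term by term. -/
theorem lintegral_mul_density (Γ : DensityMatrix) {V : Space → ℝ≥0∞} (hV : Measurable V) :
    ∫⁻ x, V x * Γ.density x =
      ∑' k, (Γ.diag.w k : ℝ≥0∞) * ∫⁻ x, V x * ‖Γ.diag.ψ k x‖ₑ ^ 2 := by
  simp_rw [density, ← ENNReal.tsum_mul_left]
  rw [lintegral_tsum fun k => (show Measurable fun x => V x * ((Γ.diag.w k : ℝ≥0∞) *
    ‖Γ.diag.ψ k x‖ₑ ^ 2) from hV.mul ((measurable_enorm_sq _).const_mul _)).aemeasurable]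
  refine tsum_congr fun k => ?_
  rw [← lintegral_const_mul _ (show Measurable fun x => V x * ‖Γ.diag.ψ k x‖ₑ ^ 2 from
    hV.mul (measurable_enorm_sq _))]
  exact lintegral_congr fun x => by ring

theorem lintegral_density (Γ : DensityMatrix) : ∫⁻ x, Γ.density x = ENNReal.ofReal Γ.trace := by
  have := Γ.lintegral_mul_density (V := fun _ => 1) measurable_const
  simp only [one_mul] at this
  rw [this, ofReal_trace]
  refine tsum_congr fun k => ?_
  rw [← enorm_L2_sq, ← ofReal_norm, Γ.diag.ψ.orthonormal.1 k]
  simp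

end DensityMatrix

theorem inner_boundedMul_ofReal {v : Space → ℝ} {C : ℝ} (hm : Measurable fun x => (v x : ℂ))
    (hb : ∀ x, ‖(v x : ℂ)‖ ≤ C) (f u : L2) :
    ⟪boundedMul _ hm C hb f, u⟫_ℂ = ⟪f, boundedMul _ hm C hb u⟫_ℂ := by
  rw [inner_eq_integral, inner_eq_integral]
  refine integral_congr_ae ?_
  filter_upwards [coeFn_boundedMul hm hb f, coeFn_boundedMul hm hb u] with x h1 h2
  rw [h1, h2, map_mul, Complex.conj_ofReal]
  ring

theorem tsum_enorm_inner_boundedMul_sq {v : Space → ℝ} {C : ℝ}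
    (hm : Measurable fun x => (v x : ℂ)) (hb : ∀ x, ‖(v x : ℂ)‖ ≤ C) (u : L2) :
    ∑' i, ‖⟪boundedMul _ hm C hb (basis i), u⟫_ℂ‖ₑ ^ 2 =
      ∫⁻ x, ENNReal.ofReal (v x ^ 2) * ‖u x‖ₑ ^ 2 := by
  simp_rw [inner_boundedMul_ofReal]
  rw [tsum_enorm_inner_sq, enorm_L2_sq]
  refine lintegral_congr_ae ?_
  filter_upwards [coeFn_boundedMul hm hb u] with x h
  rw [h, enorm_mul, mul_pow, enorm_sq_eq_ofReal ((v x : ℂ)), Complex.norm_real, Real.norm_eq_abs,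
    sq_abs]

/-- Expectation values of the bounded potential `v²` are sums of diagonal matrix elements. -/
theorem DensityMatrix.lintegral_sq_mul_density (Γ : DensityMatrix) {v : Space → ℝ} {C : ℝ}
    (hm : Measurable fun x => (v x : ℂ)) (hb : ∀ x, ‖(v x : ℂ)‖ ≤ C) :
    ∫⁻ x, ENNReal.ofReal (v x ^ 2) * Γ.density x =
      sumQuad (fun i => boundedMul _ hm C hb (basis i)) Γ.op := by
  have hv : Measurable fun x => ENNReal.ofReal (v x ^ 2) := by
    have : Measurable v := Complex.measurable_re.comp hm
    fun_prop
  rw [Γ.lintegral_mul_density hv, Γ.sumQuad_eq_tsum]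
  simp_rw [tsum_enorm_inner_boundedMul_sq]

/-- The vectors `(-i∂_j + β a_j) e_n` for the test function basis `e_n`. -/
def momVec (β : ℝ) (j : Fin 3) (n : testIndex β) : L2 :=
  TestFun.toL2 (TestFun.mom β j (testVec β n))

theorem DensityMatrix.magneticKineticEnergy_eq (β : ℝ) (Γ : DensityMatrix) :
    Γ.magneticKineticEnergy β = ∑ j, sumQuad (momVec β j) Γ.op := by
  simp_rw [magneticKineticEnergy, magneticForm_eq_tsum, Γ.sumQuad_eq_tsum, Finset.mul_sum]
  rw [Summable.tsum_finsetSum fun _ _ => ENNReal.summable]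
  rfl

/-- The energy `Tr[(H_β - β) Γ]`, written as
`Tr[(π₁ - iπ₂)^* (π₁ - iπ₂) Γ] + Tr[π₃² Γ]`. -/
def landauEnergy (β : ℝ) (T : L2 →L[ℂ] L2) : ℝ≥0∞ :=
  sumQuad (fun n => momVec β 0 n + Complex.I • momVec β 1 n) T + sumQuad (momVec β 2) T

theorem magneticForm_eq_landau {β : ℝ} (hβ : 0 ≤ β) {u : L2} (h : magneticForm β u < ⊤) :
    magneticForm β u = (∑' n, ‖⟪momVec β 0 n + Complex.I • momVec β 1 n, u⟫_ℂ‖ₑ ^ 2 +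
      ∑' n, ‖⟪momVec β 2 n, u⟫_ℂ‖ₑ ^ 2) + ENNReal.ofReal β * ‖u‖ₑ ^ 2 := by
  obtain ⟨g, hg, hform⟩ := exists_weak_of_magneticForm_lt_top h
  have hg' := fun j => hasWeakMagneticMomentum_iff.1 (hg j)
  have h1 : ∀ j n, ⟪momVec β j n, u⟫_ℂ = ⟪testBasis β n, g j⟫_ℂ := fun j n => by
    rw [momVec, hg', toL2_testVec]
  have h2 : ∀ n, ⟪momVec β 0 n + Complex.I • momVec β 1 n, u⟫_ℂ =
      ⟪testBasis β n, g 0 - Complex.I • g 1⟫_ℂ := fun n => by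
    rw [inner_add_left, inner_smul_left, h1, h1, inner_sub_right, inner_smul_right, Complex.conj_I]
    ring
  simp_rw [h2, h1]
  rw [tsum_enorm_inner_sq, tsum_enorm_inner_sq, hform, Fin.sum_univ_three]
  have h3 : ‖g 0 - Complex.I • g 1‖ₑ ^ 2 + ENNReal.ofReal β * ‖u‖ₑ ^ 2 =
      ‖g 0‖ₑ ^ 2 + ‖g 1‖ₑ ^ 2 := by
    simp_rw [enorm_sq_eq_ofReal]
    rw [← ENNReal.ofReal_mul hβ, ← ENNReal.ofReal_add (by positivity) (by positivity),
      ← ENNReal.ofReal_add (by positivity) (by positivity), norm_sub_I_smul_sq (hg 0) (hg 1)]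
  rw [← h3]
  ring

namespace DensityMatrix

theorem magneticKineticEnergy_eq_landau {β : ℝ} (hβ : 0 ≤ β) {Γ : DensityMatrix}
    (h : Γ.HasFiniteMagneticKineticEnergy β) :
    Γ.magneticKineticEnergy β = landauEnergy β Γ.op + ENNReal.ofReal β * ENNReal.ofReal Γ.trace := by
  rw [landauEnergy, Γ.sumQuad_eq_tsum, Γ.sumQuad_eq_tsum, ofReal_trace, ← ENNReal.tsum_mul_left,
    ← ENNReal.tsum_add, ← ENNReal.tsum_add, magneticKineticEnergy]
  refine tsum_congr fun k => ?_
  by_cases hw : Γ.diag.w k = 0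
  · simp [hw]
  have hk : magneticForm β (Γ.diag.ψ k) < ⊤ := by
    have h1 := ENNReal.ne_top_of_tsum_ne_top h.ne k
    by_contra htop
    rw [not_lt, top_le_iff] at htop
    rw [htop] at h1
    exact h1 (ENNReal.mul_top (by simpa using hw))
  rw [magneticForm_eq_landau hβ hk, ← mul_add, mul_add]
  congr 1
  rw [← ofReal_norm, Γ.diag.ψ.orthonormal.1 k]
  simp [mul_comm]

theorem landauEnergy_ne_top {β : ℝ} (hβ : 0 ≤ β) {Γ : DensityMatrix}
    (h : Γ.HasFiniteMagneticKineticEnergy β) : landauEnergy β Γ.op ≠ ⊤ := by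
  have h1 := magneticKineticEnergy_eq_landau hβ h
  have h2 : Γ.magneticKineticEnergy β ≠ ⊤ := h.ne
  rw [h1] at h2
  exact (ENNReal.add_ne_top.1 h2).1

theorem toReal_magneticKineticEnergy {β : ℝ} (hβ : 0 ≤ β) {Γ : DensityMatrix}
    (h : Γ.HasFiniteMagneticKineticEnergy β) :
    (Γ.magneticKineticEnergy β).toReal = (landauEnergy β Γ.op).toReal + β * Γ.trace := by
  rw [magneticKineticEnergy_eq_landau hβ h, ENNReal.toReal_add (landauEnergy_ne_top hβ h)
    (ENNReal.mul_ne_top (by simp) (by simp)), ENNReal.toReal_mul, ENNReal.toReal_ofReal hβ,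
    ENNReal.toReal_ofReal Γ.trace_nonneg]

theorem hartree_eq {β : ℝ} (hβ : 0 ≤ β) {Γ : DensityMatrix}
    (h : Γ.HasFiniteMagneticKineticEnergy β) :
    hartree β Γ = (landauEnergy β Γ.op).toReal - (attraction Γ.density).toReal
      + (repulsion Γ.density Γ.density).toReal := by
  rw [hartree, toReal_magneticKineticEnergy hβ h]
  ring

/-! ### Linear combinations and pure states -/

/-- The combination `a Γ₁ + b Γ₂` with nonnegative coefficients. -/
def comb (a b : ℝ≥0) (Γ₁ Γ₂ : DensityMatrix) : DensityMatrix where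
  op := ((a : ℝ) : ℂ) • Γ₁.op + ((b : ℝ) : ℂ) • Γ₂.op
  isPositive := (Γ₁.isPositive.smul_of_nonneg (by exact_mod_cast a.2)).add
    (Γ₂.isPositive.smul_of_nonneg (by exact_mod_cast b.2))
  summable := by
    refine ((Γ₁.summable.mul_left (a : ℝ)).add (Γ₂.summable.mul_left (b : ℝ))).congr fun i => ?_
    change _ = (⟪basis i, ((a : ℝ) : ℂ) • Γ₁.op (basis i) +
      ((b : ℝ) : ℂ) • Γ₂.op (basis i)⟫_ℂ).re
    rw [inner_add_right, inner_smul_right, inner_smul_right, Complex.add_re,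
      Complex.re_ofReal_mul, Complex.re_ofReal_mul]

theorem re_inner_comb (a b : ℝ≥0) (Γ₁ Γ₂ : DensityMatrix) (f : L2) :
    (⟪f, (comb a b Γ₁ Γ₂).op f⟫_ℂ).re = a * (⟪f, Γ₁.op f⟫_ℂ).re + b * (⟪f, Γ₂.op f⟫_ℂ).re := by
  change (⟪f, ((a : ℝ) : ℂ) • Γ₁.op f + ((b : ℝ) : ℂ) • Γ₂.op f⟫_ℂ).re = _
  rw [inner_add_right, inner_smul_right, inner_smul_right, Complex.add_re,
    Complex.re_ofReal_mul, Complex.re_ofReal_mul]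

theorem trace_comb (a b : ℝ≥0) (Γ₁ Γ₂ : DensityMatrix) :
    (comb a b Γ₁ Γ₂).trace = a * Γ₁.trace + b * Γ₂.trace := by
  simp_rw [trace, re_inner_comb]
  rw [(Γ₁.summable.mul_left _).tsum_add (Γ₂.summable.mul_left _), tsum_mul_left, tsum_mul_left]

theorem quad_comb (a b : ℝ≥0) (Γ₁ Γ₂ : DensityMatrix) (f : L2) :
    quad (comb a b Γ₁ Γ₂).op f = a * quad Γ₁.op f + b * quad Γ₂.op f := by
  rw [quad, re_inner_comb, ENNReal.ofReal_add (mul_nonneg a.coe_nonneg (Γ₁.inner_nonneg f))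
    (mul_nonneg b.coe_nonneg (Γ₂.inner_nonneg f)), ENNReal.ofReal_mul a.coe_nonneg,
    ENNReal.ofReal_mul b.coe_nonneg]
  simp [quad]

theorem sumQuad_comb {ι : Type*} (a b : ℝ≥0) (Γ₁ Γ₂ : DensityMatrix) (f : ι → L2) :
    sumQuad f (comb a b Γ₁ Γ₂).op = a * sumQuad f Γ₁.op + b * sumQuad f Γ₂.op := by
  simp_rw [sumQuad, quad_comb, ENNReal.tsum_add, ENNReal.tsum_mul_left]

theorem magneticKineticEnergy_comb (β : ℝ) (a b : ℝ≥0) (Γ₁ Γ₂ : DensityMatrix) :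
    (comb a b Γ₁ Γ₂).magneticKineticEnergy β =
      a * Γ₁.magneticKineticEnergy β + b * Γ₂.magneticKineticEnergy β := by
  simp_rw [magneticKineticEnergy_eq, sumQuad_comb, Finset.sum_add_distrib, Finset.mul_sum]

theorem landauEnergy_comb (β : ℝ) (a b : ℝ≥0) (Γ₁ Γ₂ : DensityMatrix) :
    landauEnergy β (comb a b Γ₁ Γ₂).op = a * landauEnergy β Γ₁.op + b * landauEnergy β Γ₂.op := by
  simp_rw [landauEnergy, sumQuad_comb]
  ring

theorem HasFiniteMagneticKineticEnergy.comb {β : ℝ} {Γ₁ Γ₂ : DensityMatrix}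
    (h₁ : Γ₁.HasFiniteMagneticKineticEnergy β) (h₂ : Γ₂.HasFiniteMagneticKineticEnergy β)
    (a b : ℝ≥0) : (comb a b Γ₁ Γ₂).HasFiniteMagneticKineticEnergy β := by
  rw [HasFiniteMagneticKineticEnergy, magneticKineticEnergy_comb]
  exact ENNReal.add_lt_top.2 ⟨ENNReal.mul_lt_top (by simp) h₁, ENNReal.mul_lt_top (by simp) h₂⟩

/-- Two integrable densities coincide almost everywhere if their sums of matrix elements over
all indicator functions coincide. -/
theorem density_ae_eq (Γ : DensityMatrix) {σ : Space → ℝ≥0∞} (hσ : Measurable σ)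
    (h : ∀ (v : Space → ℝ) (hm : Measurable fun x => (v x : ℂ)) (hb : ∀ x, ‖(v x : ℂ)‖ ≤ 1),
      sumQuad (fun i => boundedMul _ hm 1 hb (basis i)) Γ.op =
        ∫⁻ x, ENNReal.ofReal (v x ^ 2) * σ x) : Γ.density =ᵐ[volume] σ := by
  refine ae_eq_of_forall_setLIntegral_eq_of_sigmaFinite Γ.measurable_density hσ fun s hs _ => ?_
  have hb : ∀ x, ‖((s.indicator (fun _ => (1 : ℝ)) x : ℝ) : ℂ)‖ ≤ 1 := fun x => by
    by_cases hx : x ∈ s <;> simp [hx]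
  have hm : Measurable fun x => ((s.indicator (fun _ => (1 : ℝ)) x : ℝ) : ℂ) :=
    Complex.measurable_ofReal.comp (measurable_const.indicator hs)
  have h1 := (Γ.lintegral_sq_mul_density hm hb).trans (h _ hm hb)
  have h2 : ∀ τ : Space → ℝ≥0∞, ∫⁻ x, ENNReal.ofReal (s.indicator (fun _ => (1 : ℝ)) x ^ 2) * τ x =
      ∫⁻ x in s, τ x := fun τ => by
    rw [← lintegral_indicator hs]
    refine lintegral_congr fun x => ?_
    by_cases hx : x ∈ s <;> simp [hx]
  rwa [h2, h2] at h1

theorem density_comb (a b : ℝ≥0) (Γ₁ Γ₂ : DensityMatrix) :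
    (comb a b Γ₁ Γ₂).density =ᵐ[volume] fun x => a * Γ₁.density x + b * Γ₂.density x := by
  refine density_ae_eq _ ((Γ₁.measurable_density.const_mul _).add
    (Γ₂.measurable_density.const_mul _)) fun v hm hb => ?_
  have hv : Measurable fun x => ENNReal.ofReal (v x ^ 2) := by
    have : Measurable v := Complex.measurable_re.comp hm
    fun_prop
  have h1 : ∀ Γ : DensityMatrix, Measurable fun x => ENNReal.ofReal (v x ^ 2) * Γ.density x :=
    fun Γ => hv.mul Γ.measurable_density
  rw [sumQuad_comb, ← Γ₁.lintegral_sq_mul_density, ← Γ₂.lintegral_sq_mul_density,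
    ← lintegral_const_mul _ (h1 Γ₁), ← lintegral_const_mul _ (h1 Γ₂),
    ← lintegral_add_left ((h1 Γ₁).const_mul _)]
  exact lintegral_congr fun x => by ring

/-- The rank one operator `|φ⟩⟨φ|`. -/
def pure (φ : L2) : DensityMatrix where
  op := (innerSL ℂ φ).smulRight φ
  isPositive := by
    refine (ContinuousLinearMap.isPositive_iff_complex _).2 fun x => ?_
    have : ⟪((innerSL ℂ φ).smulRight φ) x, x⟫_ℂ = ((‖⟪φ, x⟫_ℂ‖ ^ 2 : ℝ) : ℂ) := by
      simp only [ContinuousLinearMap.smulRight_apply, innerSL_apply_apply, inner_smul_left]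
      rw [← Complex.normSq_eq_conj_mul_self, Complex.normSq_eq_norm_sq]
    rw [this]
    exact ⟨congrArg _ (Complex.ofReal_re _), by
      simp only [RCLike.re_to_complex, Complex.ofReal_re]; positivity⟩
  summable := by
    have h : ∀ i, (⟪basis i, ((innerSL ℂ φ).smulRight φ) (basis i)⟫_ℂ).re =
        (⟪φ, basis i⟫_ℂ * ⟪basis i, φ⟫_ℂ).re := fun i => by
      simp [inner_smul_right]
    simp_rw [h]
    exact (Complex.hasSum_re (basis.hasSum_inner_mul_inner φ φ)).summable

theorem re_inner_pure (φ f : L2) : (⟪f, (pure φ).op f⟫_ℂ).re = ‖⟪f, φ⟫_ℂ‖ ^ 2 := by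
  simp only [pure, ContinuousLinearMap.smulRight_apply, innerSL_apply_apply, inner_smul_right]
  rw [← inner_conj_symm, ← Complex.normSq_eq_conj_mul_self, Complex.normSq_eq_norm_sq,
    Complex.ofReal_re]

theorem quad_pure (φ f : L2) : quad (pure φ).op f = ‖⟪f, φ⟫_ℂ‖ₑ ^ 2 := by
  rw [quad, re_inner_pure, enorm_sq_eq_ofReal]

theorem trace_pure (φ : L2) : (pure φ).trace = ‖φ‖ ^ 2 := by
  have h : ENNReal.ofReal (pure φ).trace = ENNReal.ofReal (‖φ‖ ^ 2) := by
    rw [ofReal_trace, ← sumQuad_hilbertBasis _ basis, sumQuad]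
    simp_rw [quad_pure]
    rw [tsum_enorm_inner_sq, enorm_sq_eq_ofReal]
  exact (ENNReal.ofReal_eq_ofReal_iff (trace_nonneg _) (by positivity)).1 h

theorem magneticKineticEnergy_pure (β : ℝ) (φ : L2) :
    (pure φ).magneticKineticEnergy β = magneticForm β φ := by
  simp_rw [magneticKineticEnergy_eq, sumQuad, quad_pure, magneticForm_eq_tsum]
  rfl

theorem density_pure (φ : L2) : (pure φ).density =ᵐ[volume] fun x => ‖φ x‖ₑ ^ 2 := by
  refine density_ae_eq _ (measurable_enorm_sq φ) fun v hm hb => ?_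
  simp_rw [sumQuad, quad_pure]
  exact tsum_enorm_inner_boundedMul_sq hm hb φ

/-! ### Semicontinuity -/

theorem tsum_liminf_le {ι : Type*} [Countable ι] (F : ℕ → ι → ℝ≥0∞) :
    ∑' i, liminf (fun n => F n i) atTop ≤ liminf (fun n => ∑' i, F n i) atTop := by
  let _ : MeasurableSpace ι := ⊤
  have h := lintegral_liminf_le (μ := Measure.count) (f := F) (u := atTop)
    fun n => measurable_from_top
  simp_rw [lintegral_count] at h
  exact h

/-- Sums of diagonal matrix elements are weakly lower semicontinuous. -/
theorem sumQuad_le_liminf {ι : Type*} [Countable ι] (f : ι → L2) {Tn : ℕ → (L2 →L[ℂ] L2)}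
    {T : L2 →L[ℂ] L2} (h : ∀ x, Tendsto (fun n => ⟪x, Tn n x⟫_ℂ) atTop (𝓝 ⟪x, T x⟫_ℂ)) :
    sumQuad f T ≤ liminf (fun n => sumQuad f (Tn n)) atTop := by
  refine le_trans (le_of_eq ?_) (tsum_liminf_le fun n i => quad (Tn n) (f i))
  refine tsum_congr fun i => (Tendsto.liminf_eq ?_).symm
  exact ENNReal.tendsto_ofReal ((Complex.continuous_re.tendsto _).comp (h _))

theorem le_liminf_add {a b : ℝ≥0∞} {F G : ℕ → ℝ≥0∞} (ha : a ≤ liminf F atTop)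
    (hb : b ≤ liminf G atTop) : a + b ≤ liminf (fun n => F n + G n) atTop := by
  have h := tsum_liminf_le fun n (i : Bool) => cond i (F n) (G n)
  simp only [tsum_bool, cond_true, cond_false] at h
  rw [add_comm a]
  simp_rw [add_comm (F _)]
  exact (add_le_add hb ha).trans h

theorem landauEnergy_le_liminf (β : ℝ) {Tn : ℕ → (L2 →L[ℂ] L2)}
    {T : L2 →L[ℂ] L2} (h : ∀ x, Tendsto (fun n => ⟪x, Tn n x⟫_ℂ) atTop (𝓝 ⟪x, T x⟫_ℂ)) :
    landauEnergy β T ≤ liminf (fun n => landauEnergy β (Tn n)) atTop :=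
  le_liminf_add (sumQuad_le_liminf _ h) (sumQuad_le_liminf _ h)

theorem magneticKineticEnergy_le_liminf (β : ℝ) {Γn : ℕ → DensityMatrix} {Γ : DensityMatrix}
    (h : ∀ x, Tendsto (fun n => ⟪x, (Γn n).op x⟫_ℂ) atTop (𝓝 ⟪x, Γ.op x⟫_ℂ)) :
    Γ.magneticKineticEnergy β ≤ liminf (fun n => (Γn n).magneticKineticEnergy β) atTop := by
  simp_rw [magneticKineticEnergy_eq, Fin.sum_univ_three]
  exact le_liminf_add (le_liminf_add (sumQuad_le_liminf _ h) (sumQuad_le_liminf _ h))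
    (sumQuad_le_liminf _ h)

end DensityMatrix

/-! ### Positivity of the Coulomb energy -/

/-- If an interaction kernel is a superposition `∫ w(p) G(p,x) G(p,y) dμ(p)`, then the interaction
energy of two densities is the superposition of the products of their potentials. -/
theorem lintegral_kernel_factor {α γ : Type*} [MeasurableSpace α] [MeasurableSpace γ]
    {ν : Measure α} {μ : Measure γ} [SFinite ν] [SFinite μ] {ρ σ : α → ℝ≥0∞} (hρ : Measurable ρ)
    (hσ : Measurable σ) {w : γ → ℝ≥0∞} (hw : Measurable w) {G : γ → α → ℝ≥0∞}
    (hG : Measurable (Function.uncurry G)) :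
    ∫⁻ x, ∫⁻ y, ρ x * σ y * (∫⁻ p, w p * (G p x * G p y) ∂μ) ∂ν ∂ν =
      ∫⁻ p, w p * ((∫⁻ x, ρ x * G p x ∂ν) * ∫⁻ y, σ y * G p y ∂ν) ∂μ := by
  have hGp : ∀ p, Measurable (G p) := fun p => hG.comp measurable_prodMk_left
  have hGx : ∀ x, Measurable fun p => G p x := fun x => hG.comp measurable_prodMk_right
  have hBσ : Measurable fun p => ∫⁻ y, σ y * G p y ∂ν := by
    refine Measurable.lintegral_prod_right' (f := fun q : γ × α => σ q.2 * G q.1 q.2) ?_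
    exact (hσ.comp measurable_snd).mul hG
  have h1 : ∀ x, ∫⁻ y, ρ x * σ y * (∫⁻ p, w p * (G p x * G p y) ∂μ) ∂ν =
      ∫⁻ p, ρ x * G p x * (w p * ∫⁻ y, σ y * G p y ∂ν) ∂μ := by
    intro x
    have h2 : ∀ y, ρ x * σ y * (∫⁻ p, w p * (G p x * G p y) ∂μ) =
        ∫⁻ p, ρ x * G p x * w p * (σ y * G p y) ∂μ := fun y => by
      rw [← lintegral_const_mul _ (show Measurable fun p => w p * (G p x * G p y) from
        hw.mul ((hGx x).mul (hGx y)))]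
      exact lintegral_congr fun p => by ring
    simp_rw [h2]
    rw [lintegral_lintegral_swap]
    · refine lintegral_congr fun p => ?_
      rw [lintegral_const_mul _ (show Measurable fun y => σ y * G p y from hσ.mul (hGp p))]
      ring
    · refine Measurable.aemeasurable ?_
      have hG' : Measurable fun q : α × γ => G q.2 q.1 := hG.comp measurable_swap
      exact (((hGx x).comp measurable_snd).const_mul (ρ x) |>.mul (hw.comp measurable_snd)).mul
        ((hσ.comp measurable_fst).mul hG')
  simp_rw [h1]
  rw [lintegral_lintegral_swap]
  · refine lintegral_congr fun p => ?_
    rw [lintegral_mul_const _ (show Measurable fun x => ρ x * G p x from hρ.mul (hGp p))]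
    ring
  · refine Measurable.aemeasurable ?_
    have hG' : Measurable fun q : α × γ => G q.2 q.1 := hG.comp measurable_swap
    exact ((hρ.comp measurable_fst).mul hG').mul ((hw.mul hBσ).comp measurable_snd)

/-- The Gaussian `exp (-2 s² |x - z|²)`, as a function of `p = (s, z)` and `x`. -/
@[irreducible] def gaussKernel (p : ℝ × Space) (x : Space) : ℝ≥0∞ :=
  ENNReal.ofReal (Real.exp (-(2 * p.1 ^ 2) * ‖x - p.2‖ ^ 2))

theorem measurable_gaussKernel : Measurable (Function.uncurry gaussKernel) := by
  unfold gaussKernel Function.uncurry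
  fun_prop

theorem measurable_gaussKernel_apply (p : ℝ × Space) : Measurable (gaussKernel p) := by
  unfold gaussKernel
  fun_prop

theorem measurable_gaussKernel_param (x : Space) : Measurable fun p => gaussKernel p x := by
  unfold gaussKernel
  fun_prop

theorem measurable_gaussKernel_scale (s : ℝ) (x : Space) :
    Measurable fun z => gaussKernel (s, z) x := by
  unfold gaussKernel
  fun_prop

theorem measurable_gaussKernel_prod (s : ℝ) :
    Measurable fun q : Space × Space => gaussKernel (s, q.2) q.1 := by
  unfold gaussKernel
  fun_prop

theorem integrable_gauss {b : ℝ} (hb : 0 < b) :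
    Integrable (fun z : Space => Real.exp (-b * ‖z‖ ^ 2)) volume := by
  have h := (GaussianFourier.integrable_cexp_neg_mul_sq_norm_add (V := Space) (b := (b : ℂ))
    (by simpa using hb) 0 0).re
  refine h.congr (Eventually.of_forall fun z => ?_)
  simp only [inner_zero_left, Complex.ofReal_zero, mul_zero, add_zero]
  rw [show (-(b : ℂ) * (‖z‖ : ℂ) ^ 2) = ((-b * ‖z‖ ^ 2 : ℝ) : ℂ) by push_cast; ring,
    ← Complex.ofReal_exp]
  exact Complex.ofReal_re _

/-- The normalization `∫ exp (-4 s² |z|²) dz`. -/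
def gaussMass (s : ℝ) : ℝ≥0∞ := ∫⁻ z : Space, ENNReal.ofReal (Real.exp (-(4 * s ^ 2) * ‖z‖ ^ 2))

theorem gaussMass_ne_zero (s : ℝ) : gaussMass s ≠ 0 := by
  rw [gaussMass, Ne, lintegral_eq_zero_iff (by fun_prop)]
  intro h
  have h2 : ∀ᵐ _ : Space, False := by
    filter_upwards [h] with z hz
    have h3 := Real.exp_pos (-(4 * s ^ 2) * ‖z‖ ^ 2)
    rw [Pi.zero_apply, ENNReal.ofReal_eq_zero] at hz
    exact absurd h3 hz.not_gt
  exact h2.exists.choose_spec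

theorem gaussMass_ne_top {s : ℝ} (hs : 0 < s) : gaussMass s ≠ ⊤ :=
  ((integrable_gauss (b := 4 * s ^ 2) (by positivity)).lintegral_lt_top).ne

theorem lintegral_gaussKernel_mul (s : ℝ) (x y : Space) :
    ∫⁻ z, gaussKernel (s, z) x * gaussKernel (s, z) y =
      ENNReal.ofReal (Real.exp (-(‖x - y‖ ^ 2) * s ^ 2)) * gaussMass s := by
  have h1 : ∀ z : Space, gaussKernel (s, z) x * gaussKernel (s, z) y =
      ENNReal.ofReal (Real.exp (-(‖x - y‖ ^ 2) * s ^ 2)) *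
        ENNReal.ofReal (Real.exp (-(4 * s ^ 2) * ‖z - (1 / 2 : ℝ) • (x + y)‖ ^ 2)) := by
    intro z
    simp only [gaussKernel]
    rw [← ENNReal.ofReal_mul (Real.exp_pos _).le, ← ENNReal.ofReal_mul (Real.exp_pos _).le,
      ← Real.exp_add, ← Real.exp_add]
    congr 2
    have hp := parallelogram_law_with_norm ℝ (x - z) (y - z)
    have e1 : (x - z) - (y - z) = x - y := by abel
    have e2 : ‖(x - z) + (y - z)‖ = 2 * ‖z - (1 / 2 : ℝ) • (x + y)‖ := by
      rw [show (x - z) + (y - z) = (-2 : ℝ) • (z - (1 / 2 : ℝ) • (x + y)) by module, norm_smul]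
      norm_num
    rw [e1, e2] at hp
    linear_combination (s ^ 2) * hp
  simp_rw [h1]
  rw [lintegral_const_mul _ (by fun_prop), gaussMass]
  congr 1
  exact lintegral_sub_right_eq_self
    (fun z : Space => ENNReal.ofReal (Real.exp (-(4 * s ^ 2) * ‖z‖ ^ 2))) ((1 / 2 : ℝ) • (x + y))

/-- The weight of the Gaussian `gaussKernel (s, z)` in the Coulomb kernel. -/
@[irreducible] def gaussWeight (p : ℝ × Space) : ℝ≥0∞ := ENNReal.ofReal (2 / √Real.pi) * (gaussMass p.1)⁻¹

theorem measurable_gaussWeight : Measurable gaussWeight := by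
  have h : Measurable gaussMass := by
    refine Measurable.lintegral_prod_right' (f := fun q : ℝ × Space =>
      ENNReal.ofReal (Real.exp (-(4 * q.1 ^ 2) * ‖q.2‖ ^ 2))) ?_
    fun_prop
  unfold gaussWeight
  exact (h.comp measurable_fst).inv.const_mul _

/-- The parameter space `(0, ∞) × ℝ³` of the Gaussians. -/
def gaussMeasure : Measure (ℝ × Space) := (volume.restrict (Set.Ioi 0)).prod volume

instance : SFinite gaussMeasure := by unfold gaussMeasure; infer_instance

/-- The Coulomb kernel is a superposition of products of Gaussians. -/
theorem inv_enorm_eq_lintegral (x y : Space) :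
    ‖x - y‖ₑ⁻¹ = ∫⁻ p, gaussWeight p * (gaussKernel p x * gaussKernel p y) ∂gaussMeasure := by
  have hGx := measurable_gaussKernel_param
  have hmeas : Measurable fun p => gaussWeight p * (gaussKernel p x * gaussKernel p y) :=
    measurable_gaussWeight.mul ((hGx x).mul (hGx y))
  rw [gaussMeasure, lintegral_prod _ hmeas.aemeasurable]
  have h1 : ∀ s ∈ Set.Ioi (0 : ℝ), ∫⁻ z : Space,
      gaussWeight (s, z) * (gaussKernel (s, z) x * gaussKernel (s, z) y) =
      ENNReal.ofReal (2 / √Real.pi) * ENNReal.ofReal (Real.exp (-(‖x - y‖ ^ 2) * s ^ 2)) := by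
    intro s hs
    have hm : Measurable fun z : Space => gaussKernel (s, z) x * gaussKernel (s, z) y :=
      (measurable_gaussKernel_scale s x).mul (measurable_gaussKernel_scale s y)
    simp only [gaussWeight]
    rw [lintegral_const_mul _ hm, lintegral_gaussKernel_mul, mul_assoc]
    congr 1
    rw [mul_comm, mul_assoc, ENNReal.mul_inv_cancel (gaussMass_ne_zero s) (gaussMass_ne_top hs),
      mul_one]
  refine Eq.trans ?_ (setLIntegral_congr_fun measurableSet_Ioi h1).symm
  rw [lintegral_const_mul _ (by fun_prop)]
  have hpi : 0 < √Real.pi := Real.sqrt_pos.2 Real.pi_pos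
  by_cases hxy : x = y
  · subst hxy
    simp [ENNReal.mul_top, hpi]
  have hd : 0 < ‖x - y‖ := norm_pos_iff.2 (sub_ne_zero.2 hxy)
  rw [← ofReal_integral_eq_lintegral_ofReal
    ((integrable_exp_neg_mul_sq (by positivity)).integrableOn)
    (Eventually.of_forall fun _ => (Real.exp_pos _).le), integral_gaussian_Ioi,
    ← ENNReal.ofReal_mul (by positivity), ← ofReal_norm, ← ENNReal.ofReal_inv_of_pos hd]
  congr 1
  rw [Real.sqrt_div Real.pi_pos.le, Real.sqrt_sq hd.le]
  field_simp

/-- The Gaussian potential of a density. -/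
@[irreducible] def gaussPot (ρ : Space → ℝ≥0∞) (p : ℝ × Space) : ℝ≥0∞ := ∫⁻ x, ρ x * gaussKernel p x

theorem measurable_gaussPot {ρ : Space → ℝ≥0∞} (hρ : Measurable ρ) : Measurable (gaussPot ρ) := by
  unfold gaussPot
  refine Measurable.lintegral_prod_right' (f := fun q : (ℝ × Space) × Space =>
    ρ q.2 * gaussKernel q.1 q.2) ?_
  exact (hρ.comp measurable_snd).mul measurable_gaussKernel

theorem repulsion_eq_lintegral {ρ σ : Space → ℝ≥0∞} (hρ : Measurable ρ) (hσ : Measurable σ) :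
    repulsion ρ σ = (∫⁻ p, gaussWeight p * (gaussPot ρ p * gaussPot σ p) ∂gaussMeasure) / 2 := by
  rw [repulsion]
  congr 1
  simp_rw [div_eq_mul_inv, inv_enorm_eq_lintegral, gaussPot]
  exact lintegral_kernel_factor hρ hσ measurable_gaussWeight measurable_gaussKernel

theorem ENNReal_mul_add_mul_le (a b : ℝ≥0∞) : a * b + a * b ≤ a * a + b * b := by
  rcases eq_or_ne a ⊤ with rfl | ha
  · simp
  rcases eq_or_ne b ⊤ with rfl | hb
  · simp
  lift a to ℝ≥0 using ha
  lift b to ℝ≥0 using hb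
  norm_cast
  rw [← NNReal.coe_le_coe]
  push_cast
  nlinarith [sq_nonneg ((a : ℝ) - b)]

theorem ENNReal_eq_of_mul_add_mul_eq {a b : ℝ≥0∞} (ha : a ≠ ⊤) (hb : b ≠ ⊤)
    (h : a * b + a * b = a * a + b * b) : a = b := by
  lift a to ℝ≥0 using ha
  lift b to ℝ≥0 using hb
  norm_cast at h ⊢
  rw [← NNReal.coe_inj] at h ⊢
  push_cast at h
  have : ((a : ℝ) - b) ^ 2 = 0 := by linarith
  have := pow_eq_zero_iff (two_ne_zero) |>.1 this
  linarith

theorem gaussPot_ne_top {ρ : Space → ℝ≥0∞} (h : ∫⁻ x, ρ x ≠ ⊤) (p : ℝ × Space) :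
    gaussPot ρ p ≠ ⊤ := by
  rw [gaussPot]
  refine ne_top_of_le_ne_top h (lintegral_mono fun x => ?_)
  refine mul_le_of_le_one_right' ?_
  rw [gaussKernel, ← ENNReal.ofReal_one]
  refine ENNReal.ofReal_le_ofReal (Real.exp_le_one_iff.2 ?_)
  nlinarith [mul_nonneg (sq_nonneg p.1) (sq_nonneg ‖x - p.2‖)]

/-- The centred Gaussian measure with density `exp (-2 s² |z|²)`. -/
def gaussGamma (s : ℝ) : Measure Space :=
  volume.withDensity fun z => ENNReal.ofReal (Real.exp (-(2 * s ^ 2) * ‖z‖ ^ 2))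

theorem isFiniteMeasure_gaussGamma {s : ℝ} (hs : 0 < s) : IsFiniteMeasure (gaussGamma s) :=
  isFiniteMeasure_withDensity
    (integrable_gauss (b := 2 * s ^ 2) (by positivity)).lintegral_lt_top.ne

/-- The Gaussian potential is the density of a convolution. -/
theorem withDensity_conv_gaussGamma {τ : Space → ℝ≥0∞} (hτ : Measurable τ) {s : ℝ} (hs : 0 < s) :
    (volume.withDensity τ) ∗ gaussGamma s = volume.withDensity fun z => gaussPot τ (s, z) := by
  have : IsFiniteMeasure (gaussGamma s) := isFiniteMeasure_gaussGamma hs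
  have hgm : Measurable fun z : Space => ENNReal.ofReal (Real.exp (-(2 * s ^ 2) * ‖z‖ ^ 2)) := by
    fun_prop
  have hpm : Measurable fun z => gaussPot τ (s, z) :=
    (measurable_gaussPot hτ).comp measurable_prodMk_left
  ext A hA
  obtain ⟨f, hf, hfm⟩ : ∃ f : Space → ℝ≥0∞, f = A.indicator 1 ∧ Measurable f :=
    ⟨_, rfl, measurable_const.indicator hA⟩
  rw [← lintegral_indicator_one hA, ← lintegral_indicator_one hA, ← hf]
  have hadd : ∀ x, Measurable fun y : Space => f (x + y) := fun x =>
    hfm.comp (measurable_const_add x)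
  have hinner : Measurable fun x : Space => ∫⁻ y, f (x + y) ∂(gaussGamma s) :=
    Measurable.lintegral_prod_right' (f := fun q : Space × Space => f (q.1 + q.2))
      (hfm.comp (measurable_fst.add measurable_snd))
  rw [Measure.lintegral_conv hfm, lintegral_withDensity_eq_lintegral_mul _ hτ hinner,
    lintegral_withDensity_eq_lintegral_mul _ hpm hfm]
  have hkx : ∀ z, Measurable fun x => τ x * gaussKernel (s, z) x := fun z =>
    hτ.mul (measurable_gaussKernel_apply (s, z))
  have e1 : ∀ x, ∫⁻ y, f (x + y) ∂(gaussGamma s) = ∫⁻ z, f z * gaussKernel (s, z) x := by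
    intro x
    rw [gaussGamma, lintegral_withDensity_eq_lintegral_mul _ hgm (hadd x),
      ← lintegral_add_left_eq_self (fun z => f z * gaussKernel (s, z) x) x]
    refine lintegral_congr fun y => ?_
    simp only [Pi.mul_apply, gaussKernel, sub_add_cancel_left, norm_neg]
    ring
  have e2 : ∀ x, τ x * ∫⁻ z, f z * gaussKernel (s, z) x =
      ∫⁻ z, f z * (τ x * gaussKernel (s, z) x) := fun x => by
    rw [← lintegral_const_mul _ (show Measurable fun z => f z * gaussKernel (s, z) x from
      hfm.mul (measurable_gaussKernel_scale s x))]
    exact lintegral_congr fun z => by ring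
  simp only [Pi.mul_apply, e1, e2]
  rw [lintegral_lintegral_swap]
  · refine lintegral_congr fun z => ?_
    rw [lintegral_const_mul _ (hkx z), mul_comm, gaussPot]
  · refine Measurable.aemeasurable ?_
    exact (hfm.comp measurable_snd).mul
      ((hτ.comp measurable_fst).mul (measurable_gaussKernel_prod s))

theorem charFun_gaussGamma_ne_zero {s : ℝ} (hs : 0 < s) (t : Space) :
    charFun (gaussGamma s) t ≠ 0 := by
  have hb : 0 < 2 * s ^ 2 := by positivity
  have hgm : Measurable fun z : Space => ENNReal.ofReal (Real.exp (-(2 * s ^ 2) * ‖z‖ ^ 2)) := by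
    fun_prop
  have e1 : charFun (gaussGamma s) t = ∫ z : Space,
      Complex.exp (-((2 * s ^ 2 : ℝ) : ℂ) * (‖z‖ : ℂ) ^ 2 + Complex.I * ((⟪t, z⟫_ℝ : ℝ) : ℂ)) := by
    rw [charFun_apply, gaussGamma, integral_withDensity_eq_integral_toReal_smul hgm
      (Eventually.of_forall fun _ => ENNReal.ofReal_lt_top)]
    refine integral_congr_ae (Eventually.of_forall fun z => ?_)
    simp only []
    rw [ENNReal.toReal_ofReal (Real.exp_pos _).le, Complex.exp_add, real_inner_comm t z,
      mul_comm Complex.I, Complex.real_smul, Complex.ofReal_exp]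
    push_cast
    rfl
  rw [e1, GaussianFourier.integral_cexp_neg_mul_sq_norm_add (by rwa [Complex.ofReal_re])]
  have hpib : (Real.pi : ℂ) / ((2 * s ^ 2 : ℝ) : ℂ) ≠ 0 :=
    div_ne_zero (by exact_mod_cast Real.pi_ne_zero) (by exact_mod_cast hb.ne')
  exact mul_ne_zero (by rw [Complex.cpow_def_of_ne_zero hpib]; exact Complex.exp_ne_zero _)
    (Complex.exp_ne_zero _)

/-- The Gaussian potential at a fixed scale determines an integrable density. -/
theorem ae_eq_of_gaussPot_ae_eq {ρ σ : Space → ℝ≥0∞} (hρ : Measurable ρ) (hσ : Measurable σ)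
    (hρi : ∫⁻ x, ρ x ≠ ⊤) (hσi : ∫⁻ x, σ x ≠ ⊤) {s : ℝ} (hs : 0 < s)
    (h : ∀ᵐ z : Space, gaussPot ρ (s, z) = gaussPot σ (s, z)) : ρ =ᵐ[volume] σ := by
  have : IsFiniteMeasure (gaussGamma s) := isFiniteMeasure_gaussGamma hs
  have : IsFiniteMeasure (volume.withDensity ρ) := isFiniteMeasure_withDensity hρi
  have : IsFiniteMeasure (volume.withDensity σ) := isFiniteMeasure_withDensity hσi
  have heq : (volume.withDensity ρ) ∗ gaussGamma s = (volume.withDensity σ) ∗ gaussGamma s := by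
    rw [withDensity_conv_gaussGamma hρ hs, withDensity_conv_gaussGamma hσ hs]
    exact withDensity_congr_ae h
  have hμ : volume.withDensity ρ = volume.withDensity σ := by
    refine Measure.ext_of_charFun (funext fun t => ?_)
    have := congrArg (fun μ => charFun μ t) heq
    simp only [charFun_conv] at this
    exact mul_right_cancel₀ (charFun_gaussGamma_ne_zero hs t) this
  exact (withDensity_eq_iff hρ.aemeasurable hσ.aemeasurable hρi).1 hμ

theorem repulsion_add_repulsion_le {ρ σ : Space → ℝ≥0∞} (hρ : Measurable ρ) (hσ : Measurable σ) :
    repulsion ρ σ + repulsion ρ σ ≤ repulsion ρ ρ + repulsion σ σ := by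
  have hm : ∀ {τ κ : Space → ℝ≥0∞}, Measurable τ → Measurable κ →
      Measurable fun p => gaussWeight p * (gaussPot τ p * gaussPot κ p) := fun h1 h2 =>
    measurable_gaussWeight.mul ((measurable_gaussPot h1).mul (measurable_gaussPot h2))
  rw [repulsion_eq_lintegral hρ hσ, repulsion_eq_lintegral hρ hρ, repulsion_eq_lintegral hσ hσ,
    ENNReal.div_add_div_same, ENNReal.div_add_div_same, ← lintegral_add_left (hm hρ hσ),
    ← lintegral_add_left (hm hρ hρ)]
  refine ENNReal.div_le_div_right (lintegral_mono fun p => ?_) _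
  calc _ = gaussWeight p * (gaussPot ρ p * gaussPot σ p + gaussPot ρ p * gaussPot σ p) :=
        (mul_add _ _ _).symm
    _ ≤ gaussWeight p * (gaussPot ρ p * gaussPot ρ p + gaussPot σ p * gaussPot σ p) :=
        mul_le_mul_right (ENNReal_mul_add_mul_le _ _) _
    _ = _ := mul_add _ _ _

/-- Strict positivity of the Coulomb energy: equality in `2 D[ρ, σ] ≤ D[ρ, ρ] + D[σ, σ]` forces
`ρ = σ`. -/
theorem ae_eq_of_repulsion_le {ρ σ : Space → ℝ≥0∞} (hρ : Measurable ρ) (hσ : Measurable σ)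
    (hρi : ∫⁻ x, ρ x ≠ ⊤) (hσi : ∫⁻ x, σ x ≠ ⊤) (hfin : repulsion ρ σ ≠ ⊤)
    (h : repulsion ρ ρ + repulsion σ σ ≤ repulsion ρ σ + repulsion ρ σ) : ρ =ᵐ[volume] σ := by
  have hm : ∀ {τ κ : Space → ℝ≥0∞}, Measurable τ → Measurable κ →
      Measurable fun p => gaussWeight p * (gaussPot τ p * gaussPot κ p) := fun h1 h2 =>
    measurable_gaussWeight.mul ((measurable_gaussPot h1).mul (measurable_gaussPot h2))
  rw [repulsion_eq_lintegral hρ hσ] at hfin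
  have hfin' : ∫⁻ p, gaussWeight p * (gaussPot ρ p * gaussPot σ p) ∂gaussMeasure ≠ ⊤ := by
    intro htop
    rw [htop] at hfin
    exact hfin (by simp [ENNReal.top_div])
  rw [repulsion_eq_lintegral hρ hσ, repulsion_eq_lintegral hρ hρ, repulsion_eq_lintegral hσ hσ,
    ENNReal.div_add_div_same, ENNReal.div_add_div_same,
    ENNReal.div_le_iff (by simp) (by simp), ENNReal.div_mul_cancel (by simp) (by simp),
    ← lintegral_add_left (hm hρ hσ), ← lintegral_add_left (hm hρ hρ)] at h
  have hae := ae_eq_of_ae_le_of_lintegral_le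
    (f := fun p => gaussWeight p * (gaussPot ρ p * gaussPot σ p) +
      gaussWeight p * (gaussPot ρ p * gaussPot σ p))
    (g := fun p => gaussWeight p * (gaussPot ρ p * gaussPot ρ p) +
      gaussWeight p * (gaussPot σ p * gaussPot σ p)) (Eventually.of_forall fun p => by
        calc _ = gaussWeight p * (gaussPot ρ p * gaussPot σ p + gaussPot ρ p * gaussPot σ p) :=
              (mul_add _ _ _).symm
          _ ≤ gaussWeight p * (gaussPot ρ p * gaussPot ρ p + gaussPot σ p * gaussPot σ p) :=
              mul_le_mul_right (ENNReal_mul_add_mul_le _ _) _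
          _ = _ := mul_add _ _ _)
    (by rw [lintegral_add_left (hm hρ hσ)]; exact ENNReal.add_ne_top.2 ⟨hfin', hfin'⟩)
    ((hm hρ hρ).add (hm hσ hσ)).aemeasurable h
  have hae2 := Measure.ae_ae_of_ae_prod (show ∀ᵐ p ∂((volume.restrict (Set.Ioi (0 : ℝ))).prod
    (volume : Measure Space)), _ from hae)
  have hae3 : ∀ᵐ s ∂(volume.restrict (Set.Ioi (0 : ℝ))), 0 < s ∧
      ∀ᵐ z : Space, gaussPot ρ (s, z) = gaussPot σ (s, z) := by
    filter_upwards [hae2, ae_restrict_mem measurableSet_Ioi] with s h1 hs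
    refine ⟨hs, ?_⟩
    filter_upwards [h1] with z hz
    refine ENNReal_eq_of_mul_add_mul_eq (gaussPot_ne_top hρi _) (gaussPot_ne_top hσi _) ?_
    refine (ENNReal.mul_right_inj ?_ ?_).1
      ((mul_add _ _ _).trans (hz.trans (mul_add _ _ _).symm))
    · rw [gaussWeight]
      refine mul_ne_zero ?_ (ENNReal.inv_ne_zero.2 (gaussMass_ne_top hs))
      have hpi : 0 < √Real.pi := Real.sqrt_pos.2 Real.pi_pos
      simp [hpi]
    · rw [gaussWeight]
      exact ENNReal.mul_ne_top (by simp) (ENNReal.inv_ne_top.2 (gaussMass_ne_zero _))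
  have : (ae (volume.restrict (Set.Ioi (0 : ℝ)))).NeBot := by
    rw [ae_neBot]
    intro h0
    have := congrArg (fun μ : Measure ℝ => μ Set.univ) h0
    simp at this
  obtain ⟨s, hs, hs'⟩ := hae3.exists
  exact ae_eq_of_gaussPot_ae_eq hρ hσ hρi hσi hs hs'

theorem repulsion_congr_ae {ρ ρ' σ σ' : Space → ℝ≥0∞} (h : ρ =ᵐ[volume] ρ') (h' : σ =ᵐ[volume] σ') :
    repulsion ρ σ = repulsion ρ' σ' := by
  rw [repulsion, repulsion]
  congr 1
  refine lintegral_congr_ae ?_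
  filter_upwards [h] with x hx
  refine lintegral_congr_ae ?_
  filter_upwards [h'] with y hy
  rw [hx, hy]

/-- The Coulomb energy of a linear combination. -/
theorem repulsion_comb {ρ σ : Space → ℝ≥0∞} (hρ : Measurable ρ) (hσ : Measurable σ) (a b : ℝ≥0∞) :
    repulsion (fun x => a * ρ x + b * σ x) (fun x => a * ρ x + b * σ x) =
      a * a * repulsion ρ ρ + 2 * (a * b) * repulsion ρ σ + b * b * repulsion σ σ := by
  have hpot : ∀ p, gaussPot (fun x => a * ρ x + b * σ x) p = a * gaussPot ρ p + b * gaussPot σ p := by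
    intro p
    have h1 : Measurable fun x => ρ x * gaussKernel p x :=
      hρ.mul (measurable_gaussKernel_apply p)
    have h2 : Measurable fun x => σ x * gaussKernel p x :=
      hσ.mul (measurable_gaussKernel_apply p)
    have h3 : Measurable fun x => a * (ρ x * gaussKernel p x) := h1.const_mul a
    rw [gaussPot, gaussPot, gaussPot, ← lintegral_const_mul _ h1, ← lintegral_const_mul _ h2,
      ← lintegral_add_left h3]
    exact lintegral_congr fun x => by ring
  have hm : ∀ {τ κ : Space → ℝ≥0∞}, Measurable τ → Measurable κ →
      Measurable fun p => gaussWeight p * (gaussPot τ p * gaussPot κ p) := fun h1 h2 =>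
    measurable_gaussWeight.mul ((measurable_gaussPot h1).mul (measurable_gaussPot h2))
  have hab : Measurable fun x => a * ρ x + b * σ x := (hρ.const_mul a).add (hσ.const_mul b)
  rw [repulsion_eq_lintegral hab hab, repulsion_eq_lintegral hρ hσ,
    repulsion_eq_lintegral hρ hρ, repulsion_eq_lintegral hσ hσ]
  have h1 : ∀ p, gaussWeight p * (gaussPot (fun x => a * ρ x + b * σ x) p *
      gaussPot (fun x => a * ρ x + b * σ x) p) =
      a * a * (gaussWeight p * (gaussPot ρ p * gaussPot ρ p)) +
        (2 * (a * b) * (gaussWeight p * (gaussPot ρ p * gaussPot σ p)) +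
        b * b * (gaussWeight p * (gaussPot σ p * gaussPot σ p))) := fun p => by
    rw [hpot]; ring
  simp_rw [h1]
  rw [lintegral_add_left ((hm hρ hρ).const_mul _), lintegral_add_left ((hm hρ hσ).const_mul _),
    lintegral_const_mul _ (hm hρ hρ), lintegral_const_mul _ (hm hρ hσ),
    lintegral_const_mul _ (hm hσ hσ)]
  simp only [div_eq_mul_inv]
  ring

/-! ### Finiteness of the Coulomb terms -/

theorem inv_enorm_le (d : Space) : ‖d‖ₑ⁻¹ ≤ 8⁻¹ * (‖d‖ₑ ^ 2)⁻¹ + 2 := by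
  by_cases hd : d = 0
  · subst hd
    simp [ENNReal.mul_top]
  have h : 0 < ‖d‖ := norm_pos_iff.2 hd
  rw [← ofReal_norm, ← ENNReal.ofReal_pow h.le, ← ENNReal.ofReal_inv_of_pos h,
    ← ENNReal.ofReal_inv_of_pos (by positivity),
    show (8 : ℝ≥0∞)⁻¹ = ENNReal.ofReal (8⁻¹) by
      rw [ENNReal.ofReal_inv_of_pos (by norm_num)]; simp,
    ← ENNReal.ofReal_mul (by norm_num)]
  refine (ENNReal.ofReal_le_ofReal (q := 8⁻¹ * (‖d‖ ^ 2)⁻¹ + 2) ?_).trans_eq (by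
    rw [ENNReal.ofReal_add (by positivity) (by norm_num), ENNReal.ofReal_ofNat])
  have : 0 ≤ (8⁻¹ : ℝ) * (‖d‖⁻¹ - 4) ^ 2 := by positivity
  rw [← inv_pow]
  nlinarith

namespace DensityMatrix

/-- Hardy's inequality for densities. -/
theorem lintegral_density_div_sq_le (β : ℝ) (Γ : DensityMatrix) (p : Space) :
    ∫⁻ x, (‖x - p‖ₑ ^ 2)⁻¹ * Γ.density x ≤ 4 * Γ.magneticKineticEnergy β := by
  rw [Γ.lintegral_mul_density (by fun_prop), magneticKineticEnergy, ← ENNReal.tsum_mul_left]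
  refine ENNReal.tsum_le_tsum fun k => ?_
  rw [mul_left_comm]
  gcongr
  refine le_trans (le_of_eq ?_) (hardy β _ p)
  exact lintegral_congr fun x => by rw [mul_comm, div_eq_mul_inv]

theorem lintegral_density_div_le (β : ℝ) (Γ : DensityMatrix) (p : Space) :
    ∫⁻ x, Γ.density x / ‖x - p‖ₑ ≤
      2⁻¹ * Γ.magneticKineticEnergy β + 2 * ENNReal.ofReal Γ.trace := by
  calc ∫⁻ x, Γ.density x / ‖x - p‖ₑ
      ≤ ∫⁻ x, (8⁻¹ * ((‖x - p‖ₑ ^ 2)⁻¹ * Γ.density x) + 2 * Γ.density x) := by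
        refine lintegral_mono fun x => ?_
        rw [div_eq_mul_inv, mul_comm, ← mul_assoc, ← add_mul]
        gcongr
        exact inv_enorm_le _
    _ = 8⁻¹ * (∫⁻ x, (‖x - p‖ₑ ^ 2)⁻¹ * Γ.density x) + 2 * ∫⁻ x, Γ.density x := by
        have hm : Measurable fun x => (‖x - p‖ₑ ^ 2)⁻¹ * Γ.density x :=
          (by fun_prop : Measurable fun x : Space => (‖x - p‖ₑ ^ 2)⁻¹).mul Γ.measurable_density
        rw [lintegral_add_right _ (Γ.measurable_density.const_mul _), lintegral_const_mul _ hm,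
          lintegral_const_mul _ Γ.measurable_density]
    _ ≤ 8⁻¹ * (4 * Γ.magneticKineticEnergy β) + 2 * ENNReal.ofReal Γ.trace := by
        rw [lintegral_density]
        gcongr
        exact lintegral_density_div_sq_le β Γ p
    _ = _ := by
        rw [← mul_assoc]
        congr 2
        rw [show (8 : ℝ≥0∞) = 2 * 4 by norm_num, ENNReal.mul_inv (by simp) (by simp), mul_assoc,
          ENNReal.inv_mul_cancel (by simp) (by simp), mul_one]

theorem attraction_le (β : ℝ) (Γ : DensityMatrix) :
    attraction Γ.density ≤ 2⁻¹ * Γ.magneticKineticEnergy β + 2 * ENNReal.ofReal Γ.trace := by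
  have := lintegral_density_div_le β Γ 0
  simpa [attraction] using this

theorem attraction_lt_top {β : ℝ} {Γ : DensityMatrix} (h : Γ.HasFiniteMagneticKineticEnergy β) :
    attraction Γ.density < ⊤ := by
  refine (attraction_le β Γ).trans_lt (ENNReal.add_lt_top.2
    ⟨ENNReal.mul_lt_top (by simp) h, ENNReal.mul_lt_top (by simp) (by simp)⟩)

end DensityMatrix

/-- The interaction energy is bounded by the mass of one density and the Coulomb potential of the
other. -/
theorem repulsion_le {ρ σ : Space → ℝ≥0∞} (hρ : Measurable ρ) (hσm : Measurable σ)
    {M : ℝ≥0∞}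
    (hσ : ∀ x, ∫⁻ y, σ y / ‖y - x‖ₑ ≤ M) : repulsion ρ σ ≤ (∫⁻ x, ρ x) * M := by
  rw [repulsion]
  refine (ENNReal.div_le_of_le_mul (le_trans ?_ (le_mul_of_one_le_right' (by norm_num))))
  rw [← lintegral_mul_const _ hρ]
  refine lintegral_mono fun x => ?_
  simp_rw [mul_div_assoc, enorm_sub_rev x]
  rw [lintegral_const_mul _ (show Measurable fun y : Space => σ y / ‖y - x‖ₑ from
    hσm.div (by fun_prop))]
  gcongr
  exact hσ x

theorem DensityMatrix.repulsion_lt_top {β : ℝ} {Γ : DensityMatrix}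
    (h : Γ.HasFiniteMagneticKineticEnergy β) : repulsion Γ.density Γ.density < ⊤ := by
  refine (repulsion_le Γ.measurable_density Γ.measurable_density
    fun x => Γ.lintegral_density_div_le β x).trans_lt ?_
  rw [Γ.lintegral_density]
  exact ENNReal.mul_lt_top (by simp) (ENNReal.add_lt_top.2
    ⟨ENNReal.mul_lt_top (by simp) h, ENNReal.mul_lt_top (by simp) (by simp)⟩)

/-! ### Semicontinuity of the repulsion -/

instance : Countable basisIndex := countable_of_hilbertBasis basis

theorem DensityMatrix.gaussPot_le_liminf {Γn : ℕ → DensityMatrix} {Γ : DensityMatrix}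
    (h : ∀ x, Tendsto (fun n => ⟪x, (Γn n).op x⟫_ℂ) atTop (𝓝 ⟪x, Γ.op x⟫_ℂ)) (p : ℝ × Space) :
    gaussPot Γ.density p ≤ liminf (fun n => gaussPot (Γn n).density p) atTop := by
  have hm : Measurable fun x : Space => ((Real.exp (-(p.1 ^ 2) * ‖x - p.2‖ ^ 2) : ℝ) : ℂ) := by
    fun_prop
  have hb : ∀ x : Space, ‖((Real.exp (-(p.1 ^ 2) * ‖x - p.2‖ ^ 2) : ℝ) : ℂ)‖ ≤ 1 := fun x => by
    rw [Complex.norm_real, Real.norm_of_nonneg (Real.exp_pos _).le, Real.exp_le_one_iff]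
    nlinarith [mul_nonneg (sq_nonneg p.1) (sq_nonneg ‖x - p.2‖)]
  have key : ∀ Γ : DensityMatrix, gaussPot Γ.density p =
      sumQuad (fun i => boundedMul _ hm 1 hb (basis i)) Γ.op := fun Γ => by
    rw [← Γ.lintegral_sq_mul_density hm hb, gaussPot]
    refine lintegral_congr fun x => ?_
    rw [mul_comm, gaussKernel, ← Real.exp_nat_mul]
    congr 3
    push_cast
    ring
  simp_rw [key]
  exact sumQuad_le_liminf _ h

theorem DensityMatrix.repulsion_le_liminf {Γn : ℕ → DensityMatrix} {Γ : DensityMatrix}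
    (h : ∀ x, Tendsto (fun n => ⟪x, (Γn n).op x⟫_ℂ) atTop (𝓝 ⟪x, Γ.op x⟫_ℂ)) :
    repulsion Γ.density Γ.density ≤
      liminf (fun n => repulsion (Γn n).density (Γn n).density) atTop := by
  have e : ∀ Γ : DensityMatrix, repulsion Γ.density Γ.density =
      ∫⁻ p, gaussWeight p * (gaussPot Γ.density p ^ 2) * 2⁻¹ ∂gaussMeasure := fun Γ => by
    have hm := measurable_gaussPot Γ.measurable_density
    rw [repulsion_eq_lintegral Γ.measurable_density Γ.measurable_density, div_eq_mul_inv,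
      ← lintegral_mul_const _ (show Measurable fun p => gaussWeight p *
        (gaussPot Γ.density p * gaussPot Γ.density p) from
          measurable_gaussWeight.mul (hm.mul hm))]
    simp_rw [sq]
  simp_rw [e]
  refine le_trans (lintegral_mono fun p => ?_) (lintegral_liminf_le fun n =>
    (measurable_gaussWeight.mul
      ((measurable_gaussPot (Γn n).measurable_density).pow_const 2)).mul_const _)
  have hw : gaussWeight p ≠ ⊤ := by
    rw [gaussWeight]
    exact ENNReal.mul_ne_top (by simp) (ENNReal.inv_ne_top.2 (gaussMass_ne_zero _))
  have hmono : Monotone fun t : ℝ≥0∞ => gaussWeight p * t ^ 2 * 2⁻¹ := fun a b hab => by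
    simp only []; gcongr
  have hcont : Continuous fun t : ℝ≥0∞ => gaussWeight p * t ^ 2 * 2⁻¹ :=
    (ENNReal.continuous_mul_const (by simp)).comp
      ((ENNReal.continuous_const_mul hw).comp (ENNReal.continuous_pow 2))
  exact (hmono (gaussPot_le_liminf h p)).trans
    (hmono.map_liminf_of_continuousAt _ hcont.continuousAt).le

/-! ### Weak compactness of density matrices -/

theorem DensityMatrix.norm_op_apply_le (Γ : DensityMatrix) (f : L2) :
    ‖Γ.op f‖ ≤ Γ.trace * ‖f‖ := by
  have h : ‖Γ.op f‖ₑ ^ 2 ≤ ENNReal.ofReal ((Γ.trace * ‖f‖) ^ 2) := by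
    rw [← tsum_enorm_inner_sq Γ.diag.ψ, mul_pow, ENNReal.ofReal_mul (by positivity),
      ENNReal.ofReal_pow (by positivity : 0 ≤ ‖f‖), ofReal_norm, ← tsum_enorm_inner_sq Γ.diag.ψ f,
      ← ENNReal.tsum_mul_left]
    refine ENNReal.tsum_le_tsum fun k => ?_
    have hs : ⟪Γ.diag.ψ k, Γ.op f⟫_ℂ = ((Γ.diag.w k : ℝ) : ℂ) * ⟪Γ.diag.ψ k, f⟫_ℂ := by
      have : ⟪Γ.diag.ψ k, Γ.op f⟫_ℂ = ⟪Γ.op (Γ.diag.ψ k), f⟫_ℂ :=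
        (Γ.isPositive.isSymmetric _ _).symm
      rw [this, Γ.diag.apply_ψ, inner_smul_left, Complex.conj_ofReal]
    rw [hs, enorm_mul, mul_pow, ENNReal.ofReal_pow Γ.trace_nonneg, ofReal_trace]
    gcongr
    have h1 : ‖((Γ.diag.w k : ℝ) : ℂ)‖ₑ = (Γ.diag.w k : ℝ≥0∞) := by
      rw [← ofReal_norm, Complex.norm_real, Real.norm_of_nonneg (Γ.diag.w k).coe_nonneg,
        ENNReal.ofReal_coe_nnreal]
    rw [h1]
    exact ENNReal.le_tsum k
  rw [enorm_sq_eq_ofReal, ENNReal.ofReal_le_ofReal_iff (by positivity)] at h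
  exact (sq_le_sq₀ (norm_nonneg _) (mul_nonneg Γ.trace_nonneg (norm_nonneg _))).1 h

/-- A uniformly Lipschitz sequence of functions that is Cauchy on a dense set is Cauchy
everywhere. -/
theorem cauchySeq_of_dense {E F ι : Type*} [SeminormedAddCommGroup E] [SeminormedAddCommGroup F]
    {G : ℕ → E → F} {C : ℝ} (hG : ∀ n x y, ‖G n x - G n y‖ ≤ C * ‖x - y‖) {d : ι → E}
    (hd : DenseRange d) (h : ∀ i, CauchySeq fun n => G n (d i)) (x : E) :
    CauchySeq fun n => G n x := by
  have hC' : ∀ n x y, ‖G n x - G n y‖ ≤ (|C| + 1) * ‖x - y‖ := fun n x y =>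
    (hG n x y).trans (mul_le_mul_of_nonneg_right ((le_abs_self C).trans (by linarith))
      (norm_nonneg _))
  rw [Metric.cauchySeq_iff]
  intro ε hε
  obtain ⟨i, hi⟩ := hd.exists_dist_lt x (ε := ε / (3 * (|C| + 1))) (by positivity)
  obtain ⟨N, hN⟩ := Metric.cauchySeq_iff.1 (h i) (ε / 3) (by positivity)
  refine ⟨N, fun m hm n hn => ?_⟩
  rw [dist_eq_norm, lt_div_iff₀ (by positivity)] at hi
  have h1 := hC' m x (d i)
  have h2 := hC' n x (d i)
  have h3 := hN m hm n hn
  rw [dist_eq_norm] at h3 ⊢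
  have h4 : G m x - G n x = (G m x - G m (d i)) + (G m (d i) - G n (d i)) -
      (G n x - G n (d i)) := by abel
  rw [h4]
  refine (norm_sub_le _ _).trans_lt ?_
  have h5 := norm_add_le (G m x - G m (d i)) (G m (d i) - G n (d i))
  nlinarith

/-- Density matrices of bounded trace are sequentially compact in the weak operator topology. -/
theorem exists_subseq_tendsto {Γn : ℕ → DensityMatrix} {lam : ℝ} (hlam : ∀ n, (Γn n).trace ≤ lam) :
    ∃ (φ : ℕ → ℕ) (Γ : DensityMatrix), StrictMono φ ∧ Γ.trace ≤ lam ∧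
      ∀ x y, Tendsto (fun n => ⟪x, (Γn (φ n)).op y⟫_ℂ) atTop (𝓝 ⟪x, Γ.op y⟫_ℂ) := by
  have hlam0 : 0 ≤ lam := (Γn 0).trace_nonneg.trans (hlam 0)
  have hop : ∀ n f, ‖(Γn n).op f‖ ≤ lam * ‖f‖ := fun n f =>
    ((Γn n).norm_op_apply_le f).trans (mul_le_mul_of_nonneg_right (hlam n) (norm_nonneg _))
  have hin : ∀ n x y, ‖⟪(Γn n).op x, y⟫_ℂ‖ ≤ lam * ‖x‖ * ‖y‖ := fun n x y =>
    (norm_inner_le_norm _ _).trans (mul_le_mul_of_nonneg_right (hop n x) (norm_nonneg _))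
  let d : ℕ → L2 := TopologicalSpace.denseSeq L2
  have hd : DenseRange d := TopologicalSpace.denseRange_denseSeq L2
  let M : ℕ → ℕ × ℕ → ℂ := fun n ij => ⟪(Γn n).op (d ij.1), d ij.2⟫_ℂ
  have hK : IsCompact (Set.univ.pi fun ij : ℕ × ℕ =>
      Metric.closedBall (0 : ℂ) (lam * ‖d ij.1‖ * ‖d ij.2‖)) :=
    isCompact_univ_pi fun ij => isCompact_closedBall _ _
  obtain ⟨a, -, φ, hφ, ha⟩ := hK.tendsto_subseq (x := M) fun n ij _ => by
    rw [mem_closedBall_zero_iff]; exact hin n _ _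
  rw [tendsto_pi_nhds] at ha
  have hc1 : ∀ i y, CauchySeq fun n => ⟪(Γn (φ n)).op (d i), y⟫_ℂ := fun i y =>
    cauchySeq_of_dense (G := fun n y => ⟪(Γn (φ n)).op (d i), y⟫_ℂ) (C := lam * ‖d i‖)
      (fun n x y => by rw [← inner_sub_right]; exact hin _ _ _) hd
      (fun j => (ha (i, j)).cauchySeq) y
  have hc2 : ∀ x y, CauchySeq fun n => ⟪(Γn (φ n)).op x, y⟫_ℂ := fun x y =>
    cauchySeq_of_dense (G := fun n x => ⟪(Γn (φ n)).op x, y⟫_ℂ) (C := lam * ‖y‖)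
      (fun n x x' => by
        rw [← inner_sub_left, ← map_sub]
        exact (hin _ _ _).trans (le_of_eq (by ring))) hd (fun i => hc1 i y) x
  choose B hB using fun x y => cauchySeq_tendsto_of_complete (hc2 x y)
  let Bl : L2 →ₗ⋆[ℂ] L2 →ₗ[ℂ] ℂ := LinearMap.mk₂'ₛₗ (starRingEnd ℂ) (RingHom.id ℂ) B
    (fun x x' y => tendsto_nhds_unique (hB _ _) (by
      simpa only [map_add, inner_add_left] using (hB x y).add (hB x' y)))
    (fun c x y => tendsto_nhds_unique (hB _ _) (by
      simpa only [map_smul, inner_smul_left, smul_eq_mul] using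
        (hB x y).const_mul (starRingEnd ℂ c)))
    (fun x y y' => tendsto_nhds_unique (hB _ _) (by
      simpa only [inner_add_right] using (hB x y).add (hB x y')))
    (fun c x y => tendsto_nhds_unique (hB _ _) (by
      simpa only [inner_smul_right, smul_eq_mul, RingHom.id_apply] using (hB x y).const_mul c))
  let Bc : L2 →L⋆[ℂ] L2 →L[ℂ] ℂ := Bl.mkContinuous₂ lam fun x y =>
    le_of_tendsto (hB x y).norm (Eventually.of_forall fun n => hin _ _ _)
  let T : L2 →L[ℂ] L2 := InnerProductSpace.continuousLinearMapOfBilin Bc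
  have hT : ∀ x y, Tendsto (fun n => ⟪(Γn (φ n)).op x, y⟫_ℂ) atTop (𝓝 ⟪T x, y⟫_ℂ) := by
    intro x y
    rw [InnerProductSpace.continuousLinearMapOfBilin_apply]
    exact hB x y
  have hsymm : ∀ x y, ⟪T x, y⟫_ℂ = ⟪x, T y⟫_ℂ := by
    intro x y
    refine tendsto_nhds_unique (hT x y) ?_
    have h1 := (Complex.continuous_conj.tendsto _).comp (hT y x)
    rw [inner_conj_symm] at h1
    refine h1.congr fun n => ?_
    rw [Function.comp, inner_conj_symm]
    exact ((Γn (φ n)).isPositive.isSymmetric x y).symm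
  have hT' : ∀ x y, Tendsto (fun n => ⟪x, (Γn (φ n)).op y⟫_ℂ) atTop (𝓝 ⟪x, T y⟫_ℂ) := by
    intro x y
    rw [← hsymm]
    refine (hT x y).congr fun n => ?_
    exact (Γn (φ n)).isPositive.isSymmetric x y
  have hre : ∀ x, Tendsto (fun n => (⟪x, (Γn (φ n)).op x⟫_ℂ).re) atTop (𝓝 (⟪x, T x⟫_ℂ).re) :=
    fun x => (Complex.continuous_re.tendsto _).comp (hT' x x)
  have hpos : ∀ x, 0 ≤ (⟪x, T x⟫_ℂ).re := fun x =>
    ge_of_tendsto' (hre x) fun n => (Γn (φ n)).inner_nonneg x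
  have hTpos : T.IsPositive := by
    refine ⟨fun x y => hsymm x y, fun x => ?_⟩
    have := hpos x
    rw [← hsymm] at this
    exact this
  have hsum : ∀ s : Finset basisIndex, ∑ i ∈ s, (⟪basis i, T (basis i)⟫_ℂ).re ≤ lam := fun s =>
    le_of_tendsto' (tendsto_finsetSum s fun i _ => hre (basis i)) fun n =>
      ((Γn (φ n)).summable.sum_le_tsum s fun i _ => (Γn (φ n)).inner_nonneg _).trans (hlam (φ n))
  refine ⟨φ, ⟨T, hTpos, summable_of_sum_le (fun i => hpos _) hsum⟩, hφ, ?_, hT'⟩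
  exact Real.tsum_le_of_sum_le (fun i => hpos _) hsum

/-! ### Local compactness by averaging over magnetic translations -/

/-- The phase of the magnetic translation by the vector `t`, which is the product of the
translations along the three axes. -/
def transPhase (β : ℝ) (x t : Space) : ℂ :=
  phase β 0 (t 0) x * phase β 1 (t 1) (x + t 0 • dir 0)

theorem norm_transPhase (β : ℝ) (x t : Space) : ‖transPhase β x t‖ = 1 := by
  rw [transPhase, norm_mul, norm_phase, norm_phase, one_mul]

theorem continuous_transPhase (β : ℝ) : Continuous fun q : Space × Space => transPhase β q.1 q.2 := by
  simp only [transPhase, phase, vectorPotential_zero, vectorPotential_one]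
  fun_prop

theorem sum_smul_dir (t : Space) : t 0 • dir 0 + t 1 • dir 1 + t 2 • dir 2 = t := by
  ext i
  fin_cases i <;> simp [dir]

/-- A form domain function changes little under small magnetic translations. -/
theorem lintegral_transPhase_sub_le (β : ℝ) (u : L2) (t : Space) :
    ∫⁻ x, ‖transPhase β x t * u (x + t) - u x‖ₑ ^ 2 ≤
      ENNReal.ofReal (3 * ‖t‖ ^ 2) * magneticForm β u := by
  by_cases ht0 : t = 0
  · subst ht0
    simp [transPhase, phase]
  by_cases htop : magneticForm β u = ⊤
  · rw [htop, ENNReal.mul_top]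
    · exact le_top
    · have : 0 < ‖t‖ := norm_pos_iff.2 ht0
      simpa using this
  obtain ⟨g, hg, hform⟩ := exists_weak_of_magneticForm_lt_top (lt_top_iff_ne_top.2 htop)
  set v := magTrans β 0 (t 0) (magTrans β 1 (t 1) (magTrans β 2 (t 2) u)) with hv
  have hae : ∀ᵐ x, v x - u x = transPhase β x t * u (x + t) - u x := by
    filter_upwards [coeFn_magTrans β 0 (t 0) (magTrans β 1 (t 1) (magTrans β 2 (t 2) u)),
      ae_add_right (t 0 • dir 0) (coeFn_magTrans β 1 (t 1) (magTrans β 2 (t 2) u)),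
      ae_add_right (t 0 • dir 0 + t 1 • dir 1) (coeFn_magTrans β 2 (t 2) u)] with x h1 h2 h3
    rw [← add_assoc] at h3
    rw [hv, h1, h2, h3, transPhase]
    have h4 : x + t 0 • dir 0 + t 1 • dir 1 + t 2 • dir 2 = x + t := by
      rw [add_assoc, add_assoc, ← add_assoc (t 0 • dir 0), sum_smul_dir]
    have h5 : phase β 2 (t 2) (x + t 0 • dir 0 + t 1 • dir 1) = 1 := by
      simp [phase, vectorPotential_two]
    rw [h4, h5]
    ring
  have hnorm : ‖v - u‖ ≤ ‖t‖ * ∑ j, ‖g j‖ := by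
    have h0 := norm_magTrans_sub_le (hg 0) (t 0)
    have h1 := norm_magTrans_sub_le (hg 1) (t 1)
    have h2 := norm_magTrans_sub_le (hg 2) (t 2)
    have e : v - u = (magTrans β 0 (t 0) (magTrans β 1 (t 1) (magTrans β 2 (t 2) u - u))) +
        (magTrans β 0 (t 0) (magTrans β 1 (t 1) u - u)) + (magTrans β 0 (t 0) u - u) := by
      simp only [map_sub, hv]
      abel
    rw [e, Fin.sum_univ_three, mul_add, mul_add]
    refine (norm_add₃_le).trans ?_
    simp only [LinearIsometry.norm_map]
    have b : ∀ j, |t j| * ‖g j‖ ≤ ‖t‖ * ‖g j‖ := fun j =>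
      mul_le_mul_of_nonneg_right (abs_coord_le t j) (norm_nonneg _)
    linarith [b 0, b 1, b 2]
  have hsq : ‖v - u‖ ^ 2 ≤ 3 * ‖t‖ ^ 2 * ∑ j, ‖g j‖ ^ 2 := by
    refine (pow_le_pow_left₀ (norm_nonneg _) hnorm 2).trans ?_
    rw [mul_pow, mul_comm 3, mul_assoc]
    refine mul_le_mul_of_nonneg_left ?_ (by positivity)
    rw [Fin.sum_univ_three, Fin.sum_univ_three]
    nlinarith [sq_nonneg (‖g 0‖ - ‖g 1‖), sq_nonneg (‖g 0‖ - ‖g 2‖), sq_nonneg (‖g 1‖ - ‖g 2‖)]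
  have hsum : ∑ j, ‖g j‖ₑ ^ 2 = ENNReal.ofReal (∑ j, ‖g j‖ ^ 2) := by
    rw [ENNReal.ofReal_sum_of_nonneg fun _ _ => by positivity]
    simp_rw [enorm_sq_eq_ofReal]
  calc ∫⁻ x, ‖transPhase β x t * u (x + t) - u x‖ₑ ^ 2 = ‖v - u‖ₑ ^ 2 := by
        rw [enorm_L2_sq]
        refine lintegral_congr_ae ?_
        filter_upwards [hae, Lp.coeFn_sub v u] with x h1 h2
        rw [h2, Pi.sub_apply, h1]
    _ ≤ _ := by
        rw [hform, hsum, enorm_sq_eq_ofReal, ← ENNReal.ofReal_mul (by positivity)]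
        exact ENNReal.ofReal_le_ofReal hsq

/-- The uniform probability measure on the ball of radius `h`. -/
def ballMeasure (h : ℝ) : Measure Space := ProbabilityTheory.cond volume (Metric.ball 0 h)

theorem isProbabilityMeasure_ballMeasure {h : ℝ} (hh : 0 < h) :
    IsProbabilityMeasure (ballMeasure h) :=
  ProbabilityTheory.cond_isProbabilityMeasure_of_finite (Metric.measure_ball_pos _ _ hh).ne'
    measure_ball_lt_top.ne

/-- The average of the magnetic translations of `u` over a small ball. -/
def magAverage (β h : ℝ) (u : L2) (x : Space) : ℂ :=
  ∫ t, transPhase β x t * u (x + t) ∂(ballMeasure h)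

/-- The integral kernel of `magAverage`. -/
def averageFun (β h : ℝ) (x y : Space) : ℂ :=
  starRingEnd ℂ (transPhase β x (y - x)) *
    (Metric.ball (0 : Space) h).indicator
      (fun _ => (((volume (Metric.ball (0 : Space) h))⁻¹.toReal : ℝ) : ℂ)) (y - x)

theorem norm_averageFun_le (β h : ℝ) (x y : Space) : ‖averageFun β h x y‖ ≤
    (Metric.ball x h).indicator (fun _ => (volume (Metric.ball (0 : Space) h))⁻¹.toReal) y := by
  rw [averageFun, norm_mul, RCLike.norm_conj, norm_transPhase, one_mul]
  by_cases hy : y - x ∈ Metric.ball (0 : Space) h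
  · have hy' : y ∈ Metric.ball x h := by
      simpa [dist_eq_norm] using hy
    rw [Set.indicator_of_mem hy, Set.indicator_of_mem hy', Complex.norm_real,
      Real.norm_of_nonneg ENNReal.toReal_nonneg]
  · rw [Set.indicator_of_notMem hy, norm_zero]
    exact Set.indicator_nonneg (fun _ _ => ENNReal.toReal_nonneg) _

theorem measurable_averageFun (β h : ℝ) (x : Space) : Measurable (averageFun β h x) := by
  have h1 : Continuous fun y : Space => starRingEnd ℂ (transPhase β x (y - x)) :=
    Complex.continuous_conj.comp ((continuous_transPhase β).comp (by fun_prop : Continuous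
      fun y : Space => (x, y - x)))
  exact h1.measurable.mul ((measurable_const.indicator measurableSet_ball).comp
    (measurable_id.sub_const x))

theorem lintegral_averageFun_sq_le (β h : ℝ) (x : Space) :
    ∫⁻ y, ‖averageFun β h x y‖ₑ ^ 2 ≤
      ENNReal.ofReal ((volume (Metric.ball (0 : Space) h))⁻¹.toReal ^ 2) *
        volume (Metric.ball (0 : Space) h) := by
  have e : volume (Metric.ball x h) = volume (Metric.ball (0 : Space) h) :=
    Measure.addHaar_ball_center volume x h
  rw [← e, ← lintegral_indicator_const measurableSet_ball, e]
  refine lintegral_mono fun y => ?_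
  have h1 := norm_averageFun_le β h x y
  rw [enorm_sq_eq_ofReal]
  by_cases hy : y ∈ Metric.ball x h
  · rw [Set.indicator_of_mem hy] at h1 ⊢
    exact ENNReal.ofReal_le_ofReal (pow_le_pow_left₀ (norm_nonneg _) h1 2)
  · rw [Set.indicator_of_notMem hy] at h1 ⊢
    rw [norm_le_zero_iff.1 h1]; simp

theorem memLp_averageFun (β h : ℝ) (x : Space) : MemLp (averageFun β h x) 2 volume := by
  refine ⟨(measurable_averageFun β h x).aestronglyMeasurable, ?_⟩
  rw [eLpNorm_lt_top_iff_lintegral_rpow_enorm_lt_top (by simp) (by simp)]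
  simp only [ENNReal.toReal_ofNat, ENNReal.rpow_ofNat]
  exact (lintegral_averageFun_sq_le β h x).trans_lt
    (ENNReal.mul_lt_top (by simp) measure_ball_lt_top)

/-- The integral kernel of `magAverage` as an element of `L²`. -/
def averageVec (β h : ℝ) (x : Space) : L2 := (memLp_averageFun β h x).toLp

theorem enorm_averageVec_sq_le (β h : ℝ) (x : Space) : ‖averageVec β h x‖ₑ ^ 2 ≤
    ENNReal.ofReal ((volume (Metric.ball (0 : Space) h))⁻¹.toReal ^ 2) *
        volume (Metric.ball (0 : Space) h) := by
  rw [enorm_L2_sq]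
  refine le_trans (le_of_eq (lintegral_congr_ae ?_)) (lintegral_averageFun_sq_le β h x)
  filter_upwards [(memLp_averageFun β h x).coeFn_toLp] with y hy
  rw [averageVec, hy]

theorem inner_averageVec (β h : ℝ) (x : Space) (u : L2) :
    ⟪averageVec β h x, u⟫_ℂ = magAverage β h u x := by
  rw [inner_eq_integral, ← integral_add_left_eq_self _ x, magAverage, ballMeasure,
    ProbabilityTheory.cond, integral_smul_measure, ← integral_indicator measurableSet_ball,
    ← integral_smul]
  refine integral_congr_ae ?_
  have h1 : ∀ᵐ t : Space, averageVec β h x (x + t) = averageFun β h x (x + t) := by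
    have := ae_add_right x (memLp_averageFun β h x).coeFn_toLp
    filter_upwards [this] with t ht
    rw [add_comm x t]
    exact ht
  filter_upwards [h1] with t ht
  rw [ht, averageFun, add_sub_cancel_left]
  by_cases hy : t ∈ Metric.ball (0 : Space) h
  · rw [Set.indicator_of_mem hy, Set.indicator_of_mem hy]
    simp
    ring
  · rw [Set.indicator_of_notMem hy, Set.indicator_of_notMem hy]
    simp

theorem stronglyMeasurable_translate (β : ℝ) (u : L2) :
    StronglyMeasurable fun q : Space × Space => transPhase β q.1 q.2 * u (q.1 + q.2) :=
  (continuous_transPhase β).stronglyMeasurable.mul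
    ((Lp.stronglyMeasurable u).comp_measurable (measurable_fst.add measurable_snd))

theorem measurable_magAverage (β : ℝ) {h : ℝ} (hh : 0 < h) (u : L2) :
    Measurable (magAverage β h u) := by
  have := isProbabilityMeasure_ballMeasure hh
  exact ((stronglyMeasurable_translate β u).integral_prod_right' (ν := ballMeasure h)).measurable

/-- Jensen's inequality for the square. -/
theorem sq_lintegral_le {α : Type*} [MeasurableSpace α] (μ : Measure α) [IsProbabilityMeasure μ]
    {f : α → ℝ≥0∞} (hf : Measurable f) : (∫⁻ t, f t ∂μ) ^ 2 ≤ ∫⁻ t, f t ^ 2 ∂μ := by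
  have h := ENNReal.lintegral_mul_le_Lp_mul_Lq μ (Real.HolderConjugate.two_two) hf.aemeasurable
    (measurable_const (a := (1 : ℝ≥0∞))).aemeasurable
  simp only [Pi.mul_apply, mul_one, ENNReal.one_rpow, lintegral_const, measure_univ,
    ENNReal.rpow_ofNat, one_pow, ENNReal.one_rpow, mul_one] at h
  calc (∫⁻ t, f t ∂μ) ^ 2 ≤ ((∫⁻ t, f t ^ 2 ∂μ) ^ (1 / 2 : ℝ)) ^ 2 := by gcongr
    _ = _ := by rw [← ENNReal.rpow_natCast, ← ENNReal.rpow_mul]; simp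

theorem integrable_translate (β : ℝ) {h : ℝ} (hh : 0 < h) (u : L2) (x : Space) :
    Integrable (fun t => transPhase β x t * u (x + t)) (ballMeasure h) := by
  have hprob := isProbabilityMeasure_ballMeasure hh
  have h1 : MemLp (fun t => u (x + t)) 2 (volume : Measure Space) :=
    (Lp.memLp u).comp_measurePreserving (measurePreserving_add_left volume x)
  have h3 : MemLp (fun t => u (x + t)) 2 (ballMeasure h) :=
    MemLp.smul_measure (h1.restrict (Metric.ball 0 h))
      (ENNReal.inv_ne_top.2 (Metric.measure_ball_pos _ _ hh).ne')
  have h2 : Integrable (fun t => u (x + t)) (ballMeasure h) := h3.integrable one_le_two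
  exact h2.bdd_mul (c := 1) ((continuous_transPhase β).comp
    (by fun_prop : Continuous fun t : Space => (x, t))).aestronglyMeasurable
    (Eventually.of_forall fun t => (norm_transPhase β x t).le)

theorem enorm_magAverage_sub_sq_le (β : ℝ) {h : ℝ} (hh : 0 < h) (u : L2) (x : Space) :
    ‖magAverage β h u x - u x‖ₑ ^ 2 ≤
      ∫⁻ t, ‖transPhase β x t * u (x + t) - u x‖ₑ ^ 2 ∂(ballMeasure h) := by
  have hprob := isProbabilityMeasure_ballMeasure hh
  have hmx : StronglyMeasurable fun t => transPhase β x t * u (x + t) :=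
    ((continuous_transPhase β).comp (by fun_prop : Continuous fun t : Space =>
      (x, t))).stronglyMeasurable.mul
      ((Lp.stronglyMeasurable u).comp_measurable (measurable_const_add x))
  have hint := integrable_translate β hh u x
  have e : magAverage β h u x - u x = ∫ t, (transPhase β x t * u (x + t) - u x) ∂(ballMeasure h) := by
    rw [integral_sub hint (integrable_const _)]
    simp [magAverage]
  rw [e]
  calc _ ≤ (∫⁻ t, ‖transPhase β x t * u (x + t) - u x‖ₑ ∂(ballMeasure h)) ^ 2 := by
        gcongr
        exact enorm_integral_le_lintegral_enorm _
    _ ≤ _ := sq_lintegral_le _ (hmx.sub stronglyMeasurable_const).measurable.enorm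

/-- Form domain functions are approximated by their averages. -/
theorem lintegral_magAverage_sub_le (β : ℝ) {h : ℝ} (hh : 0 < h) (u : L2) :
    ∫⁻ x, ‖magAverage β h u x - u x‖ₑ ^ 2 ≤ ENNReal.ofReal (3 * h ^ 2) * magneticForm β u := by
  have hprob := isProbabilityMeasure_ballMeasure hh
  have hsm := stronglyMeasurable_translate β u
  have hux : StronglyMeasurable fun q : Space × Space => u q.1 :=
    (Lp.stronglyMeasurable u).comp_measurable measurable_fst
  have hm2 : Measurable fun q : Space × Space =>
      ‖transPhase β q.1 q.2 * u (q.1 + q.2) - u q.1‖ₑ ^ 2 :=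
    (hsm.sub hux).measurable.enorm.pow_const 2
  refine (lintegral_mono (enorm_magAverage_sub_sq_le β hh u)).trans ?_
  rw [lintegral_lintegral_swap hm2.aemeasurable]
  have hae : ∀ᵐ t ∂(ballMeasure h), ∫⁻ x, ‖transPhase β x t * u (x + t) - u x‖ₑ ^ 2 ≤
      ENNReal.ofReal (3 * h ^ 2) * magneticForm β u := by
    filter_upwards [ProbabilityTheory.ae_cond_mem (μ := volume) (s := Metric.ball (0 : Space) h)
      measurableSet_ball] with t ht
    refine (lintegral_transPhase_sub_le β u t).trans ?_
    gcongr
    exact (mem_ball_zero_iff.1 ht).le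
  refine (lintegral_mono_ae hae).trans ?_
  simp

/-- `|a|² ≤ (1 + ε) |b|² + (1 + 1 / ε) |a - b|²`. -/
theorem enorm_sq_le {ε : ℝ} (hε : 0 < ε) (a b : ℂ) :
    ‖a‖ₑ ^ 2 ≤ ENNReal.ofReal (1 + ε) * ‖b‖ₑ ^ 2 + ENNReal.ofReal (1 + ε⁻¹) * ‖a - b‖ₑ ^ 2 := by
  simp_rw [enorm_sq_eq_ofReal]
  rw [← ENNReal.ofReal_mul (by positivity), ← ENNReal.ofReal_mul (by positivity),
    ← ENNReal.ofReal_add (by positivity) (by positivity)]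
  refine ENNReal.ofReal_le_ofReal ?_
  have h1 : ‖a‖ ≤ ‖b‖ + ‖a - b‖ := by
    simpa [add_comm] using norm_add_le (a - b) b
  have h2 : 0 ≤ ε⁻¹ * (ε * ‖b‖ - ‖a - b‖) ^ 2 := by positivity
  have h3 : ε⁻¹ * (ε * ‖b‖ - ‖a - b‖) ^ 2 =
      ε * ‖b‖ ^ 2 - 2 * ‖b‖ * ‖a - b‖ + ε⁻¹ * ‖a - b‖ ^ 2 := by
    field_simp
    ring
  nlinarith [norm_nonneg a, pow_le_pow_left₀ (norm_nonneg a) h1 2]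

namespace DensityMatrix

theorem quad_averageVec (β h : ℝ) (Γ : DensityMatrix) (x : Space) :
    quad Γ.op (averageVec β h x) =
      ∑' k, (Γ.diag.w k : ℝ≥0∞) * ‖magAverage β h (Γ.diag.ψ k) x‖ₑ ^ 2 := by
  rw [quad_eq_tsum]
  simp_rw [enorm_inner_symm _ (averageVec β h x), inner_averageVec]

theorem measurable_quad_averageVec (β : ℝ) {h : ℝ} (hh : 0 < h) (Γ : DensityMatrix) :
    Measurable fun x => quad Γ.op (averageVec β h x) := by
  simp_rw [quad_averageVec]
  exact Measurable.tsum fun k =>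
    ((measurable_magAverage β hh _).enorm.pow_const 2).const_mul _

theorem lintegral_mul_quad_averageVec (β : ℝ) {h : ℝ} (hh : 0 < h) (Γ : DensityMatrix)
    {χ : Space → ℝ≥0∞} (hχ : Measurable χ) :
    ∫⁻ x, χ x * quad Γ.op (averageVec β h x) =
      ∑' k, (Γ.diag.w k : ℝ≥0∞) * ∫⁻ x, χ x * ‖magAverage β h (Γ.diag.ψ k) x‖ₑ ^ 2 := by
  have hm : ∀ k, Measurable fun x => ‖magAverage β h (Γ.diag.ψ k) x‖ₑ ^ 2 := fun k =>
    (measurable_magAverage β hh _).enorm.pow_const 2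
  simp_rw [quad_averageVec, ← ENNReal.tsum_mul_left]
  rw [lintegral_tsum fun k => (show Measurable fun x => χ x * ((Γ.diag.w k : ℝ≥0∞) *
    ‖magAverage β h (Γ.diag.ψ k) x‖ₑ ^ 2) from hχ.mul ((hm k).const_mul _)).aemeasurable]
  refine tsum_congr fun k => ?_
  rw [← lintegral_const_mul _ (show Measurable fun x => χ x *
    ‖magAverage β h (Γ.diag.ψ k) x‖ₑ ^ 2 from hχ.mul (hm k))]
  exact lintegral_congr fun x => by ring

/-- A weighted comparison of two functions which differ little in `L²`. -/
theorem lintegral_mul_enorm_sq_le {χ : Space → ℝ≥0∞} (hχ : Measurable χ) {C : ℝ≥0∞}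
    (hC : ∀ x, χ x ≤ C) {ε : ℝ} (hε : 0 < ε) {f g : Space → ℂ} (hf : Measurable f)
    (hg : Measurable g) {δ : ℝ≥0∞} (hδ : ∫⁻ x, ‖f x - g x‖ₑ ^ 2 ≤ δ) :
    ∫⁻ x, χ x * ‖f x‖ₑ ^ 2 ≤ ENNReal.ofReal (1 + ε) * (∫⁻ x, χ x * ‖g x‖ₑ ^ 2) +
      ENNReal.ofReal (1 + ε⁻¹) * (C * δ) := by
  have h1 : Measurable fun x => χ x * ‖g x‖ₑ ^ 2 := hχ.mul (hg.enorm.pow_const 2)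
  have h2 : Measurable fun x => ‖f x - g x‖ₑ ^ 2 := (hf.sub hg).enorm.pow_const 2
  calc ∫⁻ x, χ x * ‖f x‖ₑ ^ 2
      ≤ ∫⁻ x, (ENNReal.ofReal (1 + ε) * (χ x * ‖g x‖ₑ ^ 2) +
          ENNReal.ofReal (1 + ε⁻¹) * (C * ‖f x - g x‖ₑ ^ 2)) := by
        refine lintegral_mono fun x => ?_
        calc χ x * ‖f x‖ₑ ^ 2 ≤ χ x * (ENNReal.ofReal (1 + ε) * ‖g x‖ₑ ^ 2 +
              ENNReal.ofReal (1 + ε⁻¹) * ‖f x - g x‖ₑ ^ 2) := by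
              gcongr; exact enorm_sq_le hε _ _
          _ = ENNReal.ofReal (1 + ε) * (χ x * ‖g x‖ₑ ^ 2) +
              ENNReal.ofReal (1 + ε⁻¹) * (χ x * ‖f x - g x‖ₑ ^ 2) := by ring
          _ ≤ _ := by gcongr; exact hC x
    _ = ENNReal.ofReal (1 + ε) * (∫⁻ x, χ x * ‖g x‖ₑ ^ 2) +
        ENNReal.ofReal (1 + ε⁻¹) * (C * ∫⁻ x, ‖f x - g x‖ₑ ^ 2) := by
        rw [lintegral_add_left (h1.const_mul _), lintegral_const_mul _ h1,
          lintegral_const_mul _ (h2.const_mul _), lintegral_const_mul _ h2]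
    _ ≤ _ := by gcongr

variable {χ : Space → ℝ≥0∞} {C : ℝ≥0∞} {ε h : ℝ}

/-- The density is dominated by the diagonal matrix elements between averaging kernels, up to an
error controlled by the kinetic energy and the radius `h` of the averaging. -/
theorem lintegral_mul_density_le (β : ℝ) (Γ : DensityMatrix) (hχ : Measurable χ)
    (hC : ∀ x, χ x ≤ C) (hε : 0 < ε) (hh : 0 < h) :
    ∫⁻ x, χ x * Γ.density x ≤
      ENNReal.ofReal (1 + ε) * (∫⁻ x, χ x * quad Γ.op (averageVec β h x)) +
        ENNReal.ofReal (1 + ε⁻¹) * (C * (ENNReal.ofReal (3 * h ^ 2) * Γ.magneticKineticEnergy β)) := by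
  rw [Γ.lintegral_mul_density hχ, lintegral_mul_quad_averageVec β hh Γ hχ, magneticKineticEnergy]
  simp_rw [← ENNReal.tsum_mul_left]
  rw [← ENNReal.tsum_add]
  refine ENNReal.tsum_le_tsum fun k => ?_
  have h1 := lintegral_mul_enorm_sq_le hχ hC hε
    (Lp.stronglyMeasurable (Γ.diag.ψ k)).measurable (measurable_magAverage β hh (Γ.diag.ψ k))
    (δ := ENNReal.ofReal (3 * h ^ 2) * magneticForm β (Γ.diag.ψ k)) (by
      simp_rw [enorm_sub_rev ((Γ.diag.ψ k : L2) _)]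
      exact lintegral_magAverage_sub_le β hh _)
  refine (mul_le_mul_right h1 _).trans (le_of_eq ?_)
  ring

/-- The converse comparison to `lintegral_mul_density_le`. -/
theorem lintegral_mul_quad_le (β : ℝ) (Γ : DensityMatrix) (hχ : Measurable χ)
    (hC : ∀ x, χ x ≤ C) (hε : 0 < ε) (hh : 0 < h) :
    ∫⁻ x, χ x * quad Γ.op (averageVec β h x) ≤
      ENNReal.ofReal (1 + ε) * (∫⁻ x, χ x * Γ.density x) +
        ENNReal.ofReal (1 + ε⁻¹) * (C * (ENNReal.ofReal (3 * h ^ 2) * Γ.magneticKineticEnergy β)) := by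
  rw [Γ.lintegral_mul_density hχ, lintegral_mul_quad_averageVec β hh Γ hχ, magneticKineticEnergy]
  simp_rw [← ENNReal.tsum_mul_left]
  rw [← ENNReal.tsum_add]
  refine ENNReal.tsum_le_tsum fun k => ?_
  have h1 := lintegral_mul_enorm_sq_le hχ hC hε (measurable_magAverage β hh (Γ.diag.ψ k))
    (Lp.stronglyMeasurable (Γ.diag.ψ k)).measurable
    (δ := ENNReal.ofReal (3 * h ^ 2) * magneticForm β (Γ.diag.ψ k))
      (lintegral_magAverage_sub_le β hh _)
  refine (mul_le_mul_right h1 _).trans (le_of_eq ?_)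
  ring

/-- Matrix elements between averaging kernels converge pointwise, and they are bounded because
the kernels have a common norm bound. -/
theorem tendsto_lintegral_quad_averageVec (β : ℝ) {Γn : ℕ → DensityMatrix} {Γ : DensityMatrix}
    {lam : ℝ} (hlam : ∀ n, (Γn n).trace ≤ lam)
    (hlim : ∀ x, Tendsto (fun n => ⟪x, (Γn n).op x⟫_ℂ) atTop (𝓝 ⟪x, Γ.op x⟫_ℂ))
    (hχ : Measurable χ) (hχi : ∫⁻ x, χ x ≠ ⊤) (hh : 0 < h) :
    Tendsto (fun n => ∫⁻ x, χ x * quad (Γn n).op (averageVec β h x)) atTop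
      (𝓝 (∫⁻ x, χ x * quad Γ.op (averageVec β h x))) := by
  set K := ENNReal.ofReal ((volume (Metric.ball (0 : Space) h))⁻¹.toReal ^ 2) *
        volume (Metric.ball (0 : Space) h)
  have hK : K ≠ ⊤ := (ENNReal.mul_lt_top (by simp) measure_ball_lt_top).ne
  refine tendsto_lintegral_of_dominated_convergence (fun x => χ x * (ENNReal.ofReal lam * K))
    (fun n => hχ.mul (measurable_quad_averageVec β hh _)) (fun n => Eventually.of_forall fun x => ?_)
    ?_ ?_
  · refine mul_le_mul_right (((Γn n).quad_le _).trans ?_) _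
    gcongr
    · exact hlam n
    · exact enorm_averageVec_sq_le β h x
  · rw [lintegral_mul_const _ hχ]
    exact ENNReal.mul_ne_top hχi (ENNReal.mul_ne_top (by simp) hK)
  · have hfin := ae_lt_top hχ hχi
    filter_upwards [hfin] with x hx
    refine ENNReal.Tendsto.const_mul ?_ (Or.inr hx.ne)
    exact ENNReal.tendsto_ofReal ((Complex.continuous_re.tendsto _).comp (hlim _))

/-- Along a weakly convergent sequence of bounded kinetic energy no mass is gained or lost locally in
the limit; only the upper bound is stated. The weight `χ` has to be bounded and integrable. -/
theorem limsup_lintegral_mul_density_le (β : ℝ) {Γn : ℕ → DensityMatrix} {Γ : DensityMatrix}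
    {lam M : ℝ} (hlam : ∀ n, (Γn n).trace ≤ lam)
    (hM : ∀ n, (Γn n).magneticKineticEnergy β ≤ ENNReal.ofReal M)
    (hlim : ∀ x, Tendsto (fun n => ⟪x, (Γn n).op x⟫_ℂ) atTop (𝓝 ⟪x, Γ.op x⟫_ℂ))
    (hχ : Measurable χ) (hχi : ∫⁻ x, χ x ≠ ⊤) {c : ℝ} (hc : 0 ≤ c)
    (hC : ∀ x, χ x ≤ ENNReal.ofReal c) :
    limsup (fun n => ∫⁻ x, χ x * (Γn n).density x) atTop ≤ ∫⁻ x, χ x * Γ.density x := by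
  have hM0 : ENNReal.ofReal M = ENNReal.ofReal (max M 0) := by
    rw [ENNReal.ofReal_max, ENNReal.ofReal_zero, max_eq_left zero_le]
  have hΓM : Γ.magneticKineticEnergy β ≤ ENNReal.ofReal (max M 0) := by
    refine (magneticKineticEnergy_le_liminf β hlim).trans ?_
    refine (liminf_le_liminf (Eventually.of_forall hM)).trans ?_
    rw [← hM0]
    simp
  set a := ∫⁻ x, χ x * Γ.density x with ha
  have hafin : a ≠ ⊤ := by
    refine ne_top_of_le_ne_top (b := ENNReal.ofReal c * ENNReal.ofReal Γ.trace)
      (ENNReal.mul_ne_top (by simp) (by simp)) ?_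
    rw [← Γ.lintegral_density, ← lintegral_const_mul _ Γ.measurable_density]
    exact lintegral_mono fun x => mul_le_mul_left (hC x) _
  have hareal : a = ENNReal.ofReal a.toReal := (ENNReal.ofReal_toReal hafin).symm
  have key : ∀ ε : ℝ, 0 < ε → limsup (fun n => ∫⁻ x, χ x * (Γn n).density x) atTop ≤
      ENNReal.ofReal ((1 + ε) * ((1 + ε) * a.toReal + (ε ^ 2 + ε) * (3 * c * max M 0)) +
        (ε ^ 2 + ε) * (3 * c * max M 0)) := by
    intro ε hε
    -- The averaging radius is `h = ε`, so that the errors `(1 + 1 / ε) h²` vanish as `ε → 0`.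
    have hh : 0 < ε := hε
    have hδ : ENNReal.ofReal (1 + ε⁻¹) * (ENNReal.ofReal c *
        (ENNReal.ofReal (3 * ε ^ 2) * ENNReal.ofReal (max M 0))) =
        ENNReal.ofReal ((ε ^ 2 + ε) * (3 * c * max M 0)) := by
      rw [← ENNReal.ofReal_mul (by positivity), ← ENNReal.ofReal_mul hc,
        ← ENNReal.ofReal_mul (by positivity)]
      congr 1
      field_simp
    have h1 : ∀ n, ∫⁻ x, χ x * (Γn n).density x ≤
        ENNReal.ofReal (1 + ε) * (∫⁻ x, χ x * quad (Γn n).op (averageVec β ε x)) +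
          ENNReal.ofReal ((ε ^ 2 + ε) * (3 * c * max M 0)) := fun n => by
      refine ((Γn n).lintegral_mul_density_le β hχ hC hε hh).trans ?_
      rw [← hδ, ← hM0]
      gcongr
      exact hM n
    have h2 := (ENNReal.Tendsto.const_mul (a := ENNReal.ofReal (1 + ε))
      (tendsto_lintegral_quad_averageVec β hlam hlim hχ hχi hh) (Or.inr (by simp))).add_const
        (ENNReal.ofReal ((ε ^ 2 + ε) * (3 * c * max M 0)))
    refine (limsup_le_limsup (Eventually.of_forall h1)).trans ?_
    rw [h2.limsup_eq]
    have h3 := Γ.lintegral_mul_quad_le β hχ hC hε hh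
    have h4 : ENNReal.ofReal (1 + ε⁻¹) * (ENNReal.ofReal c *
        (ENNReal.ofReal (3 * ε ^ 2) * Γ.magneticKineticEnergy β)) ≤
        ENNReal.ofReal ((ε ^ 2 + ε) * (3 * c * max M 0)) := by
      rw [← hδ]; gcongr
    have h5 := h3.trans (add_le_add_right h4 _)
    rw [← ha, hareal, ← ENNReal.ofReal_mul (by positivity),
      ← ENNReal.ofReal_add (by positivity) (by positivity)] at h5
    refine (add_le_add_left (mul_le_mul_right h5 _) _).trans (le_of_eq ?_)
    rw [← ENNReal.ofReal_mul (by positivity),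
      ← ENNReal.ofReal_add (by positivity) (by positivity)]
  have hlimit : Tendsto (fun ε : ℝ => ENNReal.ofReal ((1 + ε) * ((1 + ε) * a.toReal +
      (ε ^ 2 + ε) * (3 * c * max M 0)) + (ε ^ 2 + ε) * (3 * c * max M 0))) (𝓝[>] 0) (𝓝 a) := by
    have hcont : Continuous fun ε : ℝ => (1 + ε) * ((1 + ε) * a.toReal +
      (ε ^ 2 + ε) * (3 * c * max M 0)) + (ε ^ 2 + ε) * (3 * c * max M 0) := by fun_prop
    have := ENNReal.tendsto_ofReal ((hcont.tendsto 0).mono_left (nhdsWithin_le_nhds (s := Set.Ioi 0)))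
    simpa [← hareal] using this
  refine ge_of_tendsto hlimit ?_
  filter_upwards [self_mem_nhdsWithin] with ε hε
  exact key ε hε

end DensityMatrix

/-! ### Continuity of the attraction -/

/-- The Coulomb potential `1 / |x|`, restricted to the shell `r ≤ |x| < 1 / r`. -/
def coulombCutoff (r : ℝ) (x : Space) : ℝ≥0∞ :=
  (Metric.ball (0 : Space) r⁻¹ \ Metric.ball 0 r).indicator (fun x => ‖x‖ₑ⁻¹) x

theorem measurable_coulombCutoff (r : ℝ) : Measurable (coulombCutoff r) :=
  (by fun_prop : Measurable fun x : Space => ‖x‖ₑ⁻¹).indicator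
    (measurableSet_ball.diff measurableSet_ball)

theorem coulombCutoff_le (r : ℝ) (x : Space) : coulombCutoff r x ≤ ‖x‖ₑ⁻¹ :=
  Set.indicator_le_self _ _ x

theorem inv_enorm_le_of_le {r : ℝ} (hr : 0 < r) {x : Space} (h : r ≤ ‖x‖) :
    ‖x‖ₑ⁻¹ ≤ ENNReal.ofReal r⁻¹ := by
  rw [ENNReal.ofReal_inv_of_pos hr, ← ofReal_norm]
  gcongr

theorem coulombCutoff_le_indicator {r : ℝ} (hr : 0 < r) (x : Space) : coulombCutoff r x ≤
    (Metric.ball (0 : Space) r⁻¹).indicator (fun _ => ENNReal.ofReal r⁻¹) x := by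
  by_cases hx : x ∈ Metric.ball (0 : Space) r⁻¹ \ Metric.ball 0 r
  · rw [coulombCutoff, Set.indicator_of_mem hx, Set.indicator_of_mem hx.1]
    refine inv_enorm_le_of_le hr ?_
    simpa using hx.2
  · rw [coulombCutoff, Set.indicator_of_notMem hx]
    exact zero_le

/-- The part of the Coulomb potential near the origin is small relative to `1 / |x|²`, the part at
infinity is uniformly small. -/
theorem inv_enorm_le_coulombCutoff {r : ℝ} (hr : 0 < r) (x : Space) :
    ‖x‖ₑ⁻¹ ≤ coulombCutoff r x + (ENNReal.ofReal r * (‖x‖ₑ ^ 2)⁻¹ + ENNReal.ofReal r) := by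
  by_cases h1 : ‖x‖ < r
  · refine le_trans ?_ (le_add_left le_self_add)
    by_cases hx : x = 0
    · subst hx
      simp [ENNReal.mul_top, hr]
    have h0 : 0 < ‖x‖ := norm_pos_iff.2 hx
    rw [← ofReal_norm, ← ENNReal.ofReal_pow h0.le, ← ENNReal.ofReal_inv_of_pos h0,
      ← ENNReal.ofReal_inv_of_pos (by positivity), ← ENNReal.ofReal_mul hr.le]
    refine ENNReal.ofReal_le_ofReal ?_
    rw [← div_eq_mul_inv, inv_eq_one_div, div_le_div_iff₀ h0 (by positivity)]
    nlinarith
  by_cases h2 : ‖x‖ < r⁻¹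
  · rw [coulombCutoff, Set.indicator_of_mem (by simpa using ⟨h2, not_lt.1 h1⟩)]
    exact le_self_add
  · refine le_trans ?_ (le_add_left le_add_self)
    simpa using inv_enorm_le_of_le (inv_pos.2 hr) (not_lt.1 h2)

/-- Along a weakly convergent sequence of density matrices of bounded kinetic energy no attraction
is lost in the limit: by Hardy's inequality there is little of it near the nucleus. -/
theorem DensityMatrix.limsup_attraction_le (β : ℝ) {Γn : ℕ → DensityMatrix} {Γ : DensityMatrix}
    {lam M : ℝ} (hlam : ∀ n, (Γn n).trace ≤ lam)
    (hM : ∀ n, (Γn n).magneticKineticEnergy β ≤ ENNReal.ofReal M)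
    (hlim : ∀ x, Tendsto (fun n => ⟪x, (Γn n).op x⟫_ℂ) atTop (𝓝 ⟪x, Γ.op x⟫_ℂ)) :
    limsup (fun n => attraction (Γn n).density) atTop ≤ attraction Γ.density := by
  set K := 4 * ENNReal.ofReal M + ENNReal.ofReal lam
  have hK : K ≠ ⊤ := by simp [K, ENNReal.mul_eq_top]
  have key : ∀ r : ℝ, 0 < r → limsup (fun n => attraction (Γn n).density) atTop ≤
      attraction Γ.density + ENNReal.ofReal r * K := by
    intro r hr
    have hχ := measurable_coulombCutoff r
    have h1 : ∀ n, attraction (Γn n).density ≤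
        (∫⁻ x, coulombCutoff r x * (Γn n).density x) + ENNReal.ofReal r * K := fun n => by
      have hd := (Γn n).measurable_density
      have hm : Measurable fun x => (‖x‖ₑ ^ 2)⁻¹ * (Γn n).density x :=
        (by fun_prop : Measurable fun x : Space => (‖x‖ₑ ^ 2)⁻¹).mul hd
      calc attraction (Γn n).density ≤ ∫⁻ x, (coulombCutoff r x * (Γn n).density x +
            (ENNReal.ofReal r * ((‖x‖ₑ ^ 2)⁻¹ * (Γn n).density x) +
              ENNReal.ofReal r * (Γn n).density x)) := by
            refine lintegral_mono fun x => ?_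
            rw [div_eq_mul_inv, mul_comm, ← mul_assoc, ← add_mul, ← add_mul]
            gcongr
            exact inv_enorm_le_coulombCutoff hr x
        _ = (∫⁻ x, coulombCutoff r x * (Γn n).density x) + ENNReal.ofReal r *
            ((∫⁻ x, (‖x‖ₑ ^ 2)⁻¹ * (Γn n).density x) + ∫⁻ x, (Γn n).density x) := by
            rw [lintegral_add_left (show Measurable fun x => coulombCutoff r x *
              (Γn n).density x from hχ.mul hd), lintegral_add_left (hm.const_mul _),
              lintegral_const_mul _ hm, lintegral_const_mul _ hd, mul_add]
        _ ≤ _ := by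
            rw [(Γn n).lintegral_density]
            refine mul_le_mul_right (add_le_add ?_ (ENNReal.ofReal_le_ofReal (hlam n))) _ |>
              add_le_add le_rfl
            · have := (Γn n).lintegral_density_div_sq_le β 0
              simp only [sub_zero] at this
              exact this.trans (mul_le_mul_right (hM n) _)
    have hχi : ∫⁻ x, coulombCutoff r x ≠ ⊤ := by
      refine ne_top_of_le_ne_top ?_ (lintegral_mono (coulombCutoff_le_indicator hr))
      rw [lintegral_indicator_const measurableSet_ball]
      exact ENNReal.mul_ne_top (by simp) measure_ball_lt_top.ne
    have hC : ∀ x, coulombCutoff r x ≤ ENNReal.ofReal r⁻¹ := fun x =>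
      (coulombCutoff_le_indicator hr x).trans (Set.indicator_le_self _ _ x)
    have h2 := limsup_lintegral_mul_density_le β hlam hM hlim hχ hχi (inv_pos.2 hr).le hC
    calc limsup (fun n => attraction (Γn n).density) atTop
        ≤ limsup (fun n => (∫⁻ x, coulombCutoff r x * (Γn n).density x) +
            ENNReal.ofReal r * K) atTop := limsup_le_limsup (Eventually.of_forall h1)
      _ ≤ limsup (fun n => ∫⁻ x, coulombCutoff r x * (Γn n).density x) atTop +
            ENNReal.ofReal r * K := by
          exact (limsup_add_const atTop _ _ (by isBoundedDefault) (by isBoundedDefault)).le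
      _ ≤ _ := by
          gcongr
          refine h2.trans (lintegral_mono fun x => ?_)
          simp only []
          rw [div_eq_mul_inv, mul_comm]
          gcongr
          exact coulombCutoff_le r x
  have hlimit : Tendsto (fun r : ℝ => attraction Γ.density + ENNReal.ofReal r * K) (𝓝[>] 0)
      (𝓝 (attraction Γ.density)) := by
    have h1 := (ENNReal.tendsto_ofReal (tendsto_id (α := ℝ) (x := 𝓝 0))).mono_left
      (nhdsWithin_le_nhds (s := Set.Ioi 0))
    have h2 := (ENNReal.Tendsto.mul_const h1 (Or.inr hK)).const_add (attraction Γ.density)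
    simpa using h2
  refine ge_of_tendsto hlimit ?_
  filter_upwards [self_mem_nhdsWithin] with r hr
  exact key r hr

/-! ### Spread-out states in the lowest Landau level -/

/-- For smooth functions the weak magnetic momentum is the classical one. -/
theorem hasWeakMagneticMomentum_toLp {β : ℝ} {j : Fin 3} {φ : Space → ℂ} (hφ : ContDiff ℝ ∞ φ)
    (h : MemLp φ 2 volume) (hg : MemLp (magneticMomentum β j φ) 2 volume) :
    HasWeakMagneticMomentum β j h.toLp hg.toLp := by
  intro η hη hc
  set v := EuclideanSpace.single j (1 : ℝ)
  set f : Space → ℂ := fun x => starRingEnd ℂ (η x)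
  have hfd : ContDiff ℝ ∞ f := Complex.conjCLE.contDiff.comp hη
  have hfc : HasCompactSupport f := hc.comp_left (map_zero _)
  have hf' : ∀ x, fderiv ℝ f x v = starRingEnd ℂ (fderiv ℝ η x v) := fun x => by
    have h1 := Complex.conjCLE.toContinuousLinearMap.hasFDerivAt.comp x
      ((hη.differentiable (by simp)) x).hasFDerivAt
    rw [show fderiv ℝ f x = _ from h1.fderiv]
    rfl
  have hdφ : Continuous fun x => fderiv ℝ φ x v :=
    (hφ.continuous_fderiv (by simp)).clm_apply continuous_const
  have hdf : Continuous fun x => fderiv ℝ f x v :=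
    (hfd.continuous_fderiv (by simp)).clm_apply continuous_const
  have i1 : Integrable (fun x => fderiv ℝ f x v * φ x) volume :=
    (hdf.mul hφ.continuous).integrable_of_hasCompactSupport (hfc.fderiv_apply ℝ v).mul_right
  have i2 : Integrable (fun x => f x * fderiv ℝ φ x v) volume :=
    (hfd.continuous.mul hdφ).integrable_of_hasCompactSupport hfc.mul_right
  have i3 : Integrable (fun x => f x * φ x) volume :=
    (hfd.continuous.mul hφ.continuous).integrable_of_hasCompactSupport hfc.mul_right
  have i4 : Integrable (fun x => ((β * vectorPotential x j : ℝ) : ℂ) * (f x * φ x)) volume :=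
    ((Complex.continuous_ofReal.comp (continuous_const.mul
      (contDiff_vectorPotential j).continuous)).mul
        (hfd.continuous.mul hφ.continuous)).integrable_of_hasCompactSupport
          (hfc.mul_right (f' := φ)).mul_left
  have ibp := integral_mul_fderiv_eq_neg_fderiv_mul_of_integrable i1 i2 i3
    (fun x _ => (hfd.differentiable (by simp)) x) (fun x _ => (hφ.differentiable (by simp)) x)
  calc ∫ x, starRingEnd ℂ (magneticMomentum β j η x) * h.toLp φ x
      = ∫ x, (Complex.I * (fderiv ℝ f x v * φ x) +
          ((β * vectorPotential x j : ℝ) : ℂ) * (f x * φ x)) := by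
        refine integral_congr_ae ?_
        filter_upwards [h.coeFn_toLp] with x hx
        rw [hx, hf', magneticMomentum]
        simp only [map_add, map_mul, map_neg, Complex.conj_I, Complex.conj_ofReal, f, v]
        ring
    _ = ∫ x, (-Complex.I * (f x * fderiv ℝ φ x v) +
          ((β * vectorPotential x j : ℝ) : ℂ) * (f x * φ x)) := by
        rw [integral_add (i1.const_mul _) i4, integral_add (i2.const_mul _) i4,
          integral_const_mul, integral_const_mul, ibp]
        ring
    _ = _ := by
        refine integral_congr_ae ?_
        filter_upwards [hg.coeFn_toLp] with x hx
        rw [hx, magneticMomentum]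
        simp only [f, v]
        ring

/-- The function `x ↦ exp (-β (x₁² + x₂²) / 4)` of the lowest Landau level, cut off at the length
scale `1 / ε` by the factor `(1 + ε² |x|²)⁻²`. The second power makes `|x|` times the function square
integrable, also for `β = 0`. -/
def trialFun (β ε : ℝ) (x : Space) : ℝ :=
  Real.exp (-(β / 4) * (x 0 ^ 2 + x 1 ^ 2)) * ((1 + ε ^ 2 * ‖x‖ ^ 2) ^ 2)⁻¹

section trialFun

variable {β ε : ℝ}

theorem bracket_pos (ε : ℝ) (x : Space) : 0 < 1 + ε ^ 2 * ‖x‖ ^ 2 := by positivity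

theorem trialFun_pos (β ε : ℝ) (x : Space) : 0 < trialFun β ε x :=
  mul_pos (Real.exp_pos _) (by positivity)

theorem trialFun_le (hβ : 0 ≤ β) (ε : ℝ) (x : Space) :
    trialFun β ε x ≤ ((1 + ε ^ 2 * ‖x‖ ^ 2) ^ 2)⁻¹ := by
  refine mul_le_of_le_one_left (by positivity) (Real.exp_le_one_iff.2 ?_)
  nlinarith [mul_nonneg hβ (add_nonneg (sq_nonneg (x 0)) (sq_nonneg (x 1)))]

theorem trialFun_le_one (hβ : 0 ≤ β) (ε : ℝ) (x : Space) : trialFun β ε x ≤ 1 := by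
  have h := mul_nonneg (sq_nonneg ε) (sq_nonneg ‖x‖)
  exact (trialFun_le hβ ε x).trans (inv_le_one_of_one_le₀ (one_le_pow₀ (by linarith)))

/-- The trial function is differentiable, with an explicit logarithmic derivative. -/
theorem hasFDerivAt_trialFun (β ε : ℝ) (x : Space) : ∃ D : Space →L[ℝ] ℝ,
    HasFDerivAt (trialFun β ε) D x ∧ ∀ v, D v = (-(β / 2) * (x 0 * v 0 + x 1 * v 1) -
      4 * ε ^ 2 * ⟪x, v⟫_ℝ / (1 + ε ^ 2 * ‖x‖ ^ 2)) * trialFun β ε x := by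
  have hb := (bracket_pos ε x).ne'
  have hp : ∀ i : Fin 3, HasFDerivAt (fun y : Space => y i)
      (EuclideanSpace.proj i : Space →L[ℝ] ℝ) x := fun i =>
    (EuclideanSpace.proj i : Space →L[ℝ] ℝ).hasFDerivAt
  have h1 := ((((hp 0).pow 2).add ((hp 1).pow 2)).const_mul (-(β / 4))).exp
  have h2 := (hasDerivAt_inv (pow_ne_zero 2 hb)).comp_hasFDerivAt x
    ((((hasStrictFDerivAt_norm_sq x).hasFDerivAt.const_mul (ε ^ 2)).const_add 1).pow 2)
  refine ⟨_, h1.mul h2, fun v => ?_⟩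
  simp [trialFun]
  field_simp
  ring

theorem contDiff_trialFun (β ε : ℝ) : ContDiff ℝ ∞ fun x => (trialFun β ε x : ℂ) := by
  have h1 : ContDiff ℝ ∞ fun x : Space => ‖x‖ ^ 2 := contDiff_norm_sq ℝ
  refine Complex.ofRealCLM.contDiff.comp (f := trialFun β ε) ?_
  unfold trialFun
  refine ContDiff.mul ?_ (ContDiff.inv ?_ fun x => pow_ne_zero 2 (bracket_pos ε x).ne')
  · fun_prop
  · fun_prop

theorem magneticMomentum_trialFun (β ε : ℝ) (j : Fin 3) (x : Space) :
    magneticMomentum β j (fun x => (trialFun β ε x : ℂ)) x =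
      (Complex.I * ((β / 2 * (x 0 * dir j 0 + x 1 * dir j 1) +
        4 * ε ^ 2 * x j / (1 + ε ^ 2 * ‖x‖ ^ 2) : ℝ) : ℂ) +
          ((β * vectorPotential x j : ℝ) : ℂ)) * trialFun β ε x := by
  obtain ⟨D, hD, hD'⟩ := hasFDerivAt_trialFun β ε x
  have h := Complex.ofRealCLM.hasFDerivAt.comp x hD
  rw [magneticMomentum, show fderiv ℝ (fun x => (trialFun β ε x : ℂ)) x = _ from h.fderiv]
  simp only [ContinuousLinearMap.comp_apply, Complex.ofRealCLM_apply]
  rw [hD', show ⟪x, EuclideanSpace.single j (1 : ℝ)⟫_ℝ = x j by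
    simp [EuclideanSpace.inner_single_right]]
  push_cast
  ring

theorem norm_mul_bracket_inv_le (hε : 0 < ε) (x : Space) :
    ‖x‖ * (1 + ε ^ 2 * ‖x‖ ^ 2)⁻¹ ≤ ε⁻¹ := by
  rw [← div_eq_mul_inv, div_le_iff₀ (bracket_pos ε x), inv_mul_eq_div, le_div_iff₀ hε]
  nlinarith [sq_nonneg (ε * ‖x‖ - 1)]

theorem memLp_bracket_inv (hε : 0 < ε) :
    MemLp (fun x : Space => (1 + ε ^ 2 * ‖x‖ ^ 2)⁻¹) 2 volume := by
  rw [memLp_two_iff_integrable_sq (by fun_prop)]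
  have h1 : Integrable (fun x : Space => ((1 : ℝ) + ‖x‖ ^ 2) ^ (-(4 : ℝ) / 2)) volume :=
    integrable_rpow_neg_one_add_norm_sq (by simp; norm_num)
  have h2 := h1.comp_smul hε.ne'
  refine h2.congr (Eventually.of_forall fun x => ?_)
  simp only [norm_smul, Real.norm_of_nonneg hε.le, mul_pow]
  rw [show -(4 : ℝ) / 2 = -((2 : ℕ) : ℝ) by norm_num, Real.rpow_neg (bracket_pos ε x).le,
    Real.rpow_natCast, inv_pow]

theorem memLp_trialFun (hβ : 0 ≤ β) (hε : 0 < ε) :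
    MemLp (fun x => (trialFun β ε x : ℂ)) 2 volume := by
  refine (memLp_bracket_inv hε).mono (contDiff_trialFun β ε).continuous.aestronglyMeasurable
    (Eventually.of_forall fun x => ?_)
  rw [Complex.norm_real, Real.norm_of_nonneg (trialFun_pos β ε x).le,
    Real.norm_of_nonneg (by positivity)]
  refine (trialFun_le hβ ε x).trans (inv_anti₀ (bracket_pos ε x) ?_)
  nlinarith [mul_nonneg (sq_nonneg ε) (sq_nonneg ‖x‖)]

theorem abs_vectorPotential_le (x : Space) (j : Fin 3) : |vectorPotential x j| ≤ ‖x‖ := by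
  have h0 := abs_coord_le x 0
  have h1 := abs_coord_le x 1
  fin_cases j
  · simp only [Fin.zero_eta, vectorPotential_zero]
    rw [abs_le] at *; constructor <;> linarith
  · simp only [Fin.mk_one, vectorPotential_one]
    rw [abs_le] at *; constructor <;> linarith
  · simp [vectorPotential_two]

theorem abs_horizontal_le (x : Space) (j : Fin 3) :
    |x 0 * dir j 0 + x 1 * dir j 1| ≤ ‖x‖ := by
  have h0 := abs_coord_le x 0
  have h1 := abs_coord_le x 1
  fin_cases j <;> simp [dir, h0, h1]

theorem memLp_magneticMomentum_trialFun (hβ : 0 ≤ β) (hε : 0 < ε) (j : Fin 3) :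
    MemLp (magneticMomentum β j fun x => (trialFun β ε x : ℂ)) 2 volume := by
  refine ((memLp_bracket_inv hε).const_mul ((2 * β + 4 * ε ^ 2) * ε⁻¹)).mono
    (contDiff_magneticMomentum β j (contDiff_trialFun β ε)).continuous.aestronglyMeasurable
    (Eventually.of_forall fun x => ?_)
  have hb : 1 ≤ 1 + ε ^ 2 * ‖x‖ ^ 2 := by nlinarith [mul_nonneg (sq_nonneg ε) (sq_nonneg ‖x‖)]
  have hpos := trialFun_pos β ε x
  rw [magneticMomentum_trialFun, norm_mul, Complex.norm_real, Real.norm_of_nonneg hpos.le,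
    Real.norm_of_nonneg (by positivity)]
  have h1 : ‖Complex.I * ((β / 2 * (x 0 * dir j 0 + x 1 * dir j 1) +
        4 * ε ^ 2 * x j / (1 + ε ^ 2 * ‖x‖ ^ 2) : ℝ) : ℂ) +
          ((β * vectorPotential x j : ℝ) : ℂ)‖ ≤ (2 * β + 4 * ε ^ 2) * ‖x‖ := by
    refine (norm_add_le _ _).trans ?_
    rw [norm_mul, Complex.norm_I, one_mul, Complex.norm_real, Complex.norm_real, Real.norm_eq_abs,
      Real.norm_eq_abs]
    have e1 : |β / 2 * (x 0 * dir j 0 + x 1 * dir j 1)| ≤ β / 2 * ‖x‖ := by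
      rw [abs_mul, abs_of_nonneg (by positivity)]
      gcongr
      exact abs_horizontal_le x j
    have e2 : |4 * ε ^ 2 * x j / (1 + ε ^ 2 * ‖x‖ ^ 2)| ≤ 4 * ε ^ 2 * ‖x‖ := by
      rw [abs_div, abs_mul, abs_of_nonneg (by positivity : 0 ≤ 4 * ε ^ 2),
        abs_of_pos (bracket_pos ε x)]
      refine (div_le_self (by positivity) hb).trans ?_
      gcongr
      exact abs_coord_le x j
    have e3 : |β * vectorPotential x j| ≤ β * ‖x‖ := by
      rw [abs_mul, abs_of_nonneg hβ]
      gcongr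
      exact abs_vectorPotential_le x j
    have e4 := mul_nonneg hβ (norm_nonneg x)
    linarith [abs_add_le (β / 2 * (x 0 * dir j 0 + x 1 * dir j 1))
      (4 * ε ^ 2 * x j / (1 + ε ^ 2 * ‖x‖ ^ 2))]
  calc _ ≤ ((2 * β + 4 * ε ^ 2) * ‖x‖) * ((1 + ε ^ 2 * ‖x‖ ^ 2) ^ 2)⁻¹ :=
        mul_le_mul h1 (trialFun_le hβ ε x) hpos.le (by positivity)
    _ = (2 * β + 4 * ε ^ 2) * (‖x‖ * (1 + ε ^ 2 * ‖x‖ ^ 2)⁻¹) * (1 + ε ^ 2 * ‖x‖ ^ 2)⁻¹ := by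
        rw [sq (1 + _), mul_inv]; ring
    _ ≤ (2 * β + 4 * ε ^ 2) * ε⁻¹ * (1 + ε ^ 2 * ‖x‖ ^ 2)⁻¹ := by
        gcongr
        exact norm_mul_bracket_inv_le hε x

/-- The class in `L²` of `trialFun`. -/
def trialVec (hβ : 0 ≤ β) (hε : 0 < ε) : L2 := (memLp_trialFun hβ hε).toLp

theorem norm_trial_mul_le (hε : 0 < ε) (x : Space) :
    4 * ε ^ 2 * ‖x‖ / (1 + ε ^ 2 * ‖x‖ ^ 2) ≤ 4 * ε := by
  rw [div_le_iff₀ (bracket_pos ε x)]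
  nlinarith [mul_nonneg hε.le (sq_nonneg (ε * ‖x‖ - 1)), mul_nonneg hε.le (norm_nonneg x)]

/-- The trial function is almost in the lowest Landau level. -/
theorem landauEnergy_trialVec_le (hβ : 0 ≤ β) (hε : 0 < ε) :
    (DensityMatrix.pure (trialVec hβ hε)).HasFiniteMagneticKineticEnergy β ∧
      (landauEnergy β (DensityMatrix.pure (trialVec hβ hε)).op).toReal ≤
        32 * ε ^ 2 * ‖trialVec hβ hε‖ ^ 2 := by
  set u := trialVec hβ hε with hu
  set g : Fin 3 → L2 := fun j => (memLp_magneticMomentum_trialFun hβ hε j).toLp with hgdef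
  have hg : ∀ j, HasWeakMagneticMomentum β j u (g j) := fun j =>
    hasWeakMagneticMomentum_toLp (contDiff_trialFun β ε) _ _
  have hK : (DensityMatrix.pure u).magneticKineticEnergy β = ∑ j, ‖g j‖ₑ ^ 2 := by
    rw [DensityMatrix.magneticKineticEnergy_pure, magneticForm_eq_sum hg]
  have hfin : (DensityMatrix.pure u).HasFiniteMagneticKineticEnergy β := by
    rw [DensityMatrix.HasFiniteMagneticKineticEnergy, hK]
    exact ENNReal.sum_lt_top.2 fun j _ => by simp
  refine ⟨hfin, ?_⟩
  have h1 := DensityMatrix.toReal_magneticKineticEnergy hβ hfin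
  rw [hK, ENNReal.toReal_sum (fun j _ => by simp), Fin.sum_univ_three, DensityMatrix.trace_pure] at h1
  simp only [ENNReal.toReal_pow, toReal_enorm] at h1
  have h2 := norm_sub_I_smul_sq (hg 0) (hg 1)
  have hux : u =ᵐ[volume] fun x => (trialFun β ε x : ℂ) := (memLp_trialFun hβ hε).coeFn_toLp
  have hgx : ∀ j, g j =ᵐ[volume] magneticMomentum β j fun x => (trialFun β ε x : ℂ) := fun j =>
    (memLp_magneticMomentum_trialFun hβ hε j).coeFn_toLp
  -- The Gaussian is annihilated by `π₁ - iπ₂`, so that only the derivative of the cutoff remains.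
  have h3 : ‖g 0 - Complex.I • g 1‖ ≤ 4 * ε * ‖u‖ := by
    refine Lp.norm_le_mul_norm_of_ae_le_mul ?_
    filter_upwards [Lp.coeFn_sub (g 0) (Complex.I • g 1), Lp.coeFn_smul Complex.I (g 1), hgx 0,
      hgx 1, hux] with x a1 a2 a3 a4 a5
    rw [a1, Pi.sub_apply, a2, Pi.smul_apply, a3, a4, a5, magneticMomentum_trialFun,
      magneticMomentum_trialFun, vectorPotential_zero, vectorPotential_one, smul_eq_mul]
    have e : (Complex.I * ((β / 2 * (x 0 * dir 0 0 + x 1 * dir 0 1) +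
        4 * ε ^ 2 * x 0 / (1 + ε ^ 2 * ‖x‖ ^ 2) : ℝ) : ℂ) + ((β * (-(x 1) / 2) : ℝ) : ℂ)) *
          trialFun β ε x - Complex.I * ((Complex.I * ((β / 2 * (x 0 * dir 1 0 + x 1 * dir 1 1) +
        4 * ε ^ 2 * x 1 / (1 + ε ^ 2 * ‖x‖ ^ 2) : ℝ) : ℂ) + ((β * (x 0 / 2) : ℝ) : ℂ)) *
          trialFun β ε x) = ((4 * ε ^ 2 / (1 + ε ^ 2 * ‖x‖ ^ 2) : ℝ) : ℂ) *
            ((x 1 : ℂ) + (x 0 : ℂ) * Complex.I) * trialFun β ε x := by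
      simp [dir]
      linear_combination (-(β * x 1 / 2 + 4 * ε ^ 2 * x 1 / (1 + ε ^ 2 * ‖x‖ ^ 2)) *
        trialFun β ε x : ℂ) * Complex.I_mul_I
    rw [e, norm_mul, norm_mul, Complex.norm_real, Real.norm_of_nonneg (by positivity)]
    refine mul_le_mul_of_nonneg_right ?_ (norm_nonneg _)
    have h5 : ‖(x 1 : ℂ) + (x 0 : ℂ) * Complex.I‖ ≤ ‖x‖ := by
      rw [Complex.norm_add_mul_I]
      refine Real.sqrt_le_iff.2 ⟨norm_nonneg _, ?_⟩
      rw [norm_sq_eq_sum, Fin.sum_univ_three]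
      nlinarith [sq_nonneg (x 2)]
    refine (mul_le_mul_of_nonneg_left h5 (by positivity)).trans (le_trans (le_of_eq ?_)
      (norm_trial_mul_le hε x))
    ring
  have h4 : ‖g 2‖ ≤ 4 * ε * ‖u‖ := by
    refine Lp.norm_le_mul_norm_of_ae_le_mul ?_
    filter_upwards [hgx 2, hux] with x a1 a2
    rw [a1, a2, magneticMomentum_trialFun, vectorPotential_two]
    have e : (Complex.I * ((β / 2 * (x 0 * dir 2 0 + x 1 * dir 2 1) +
        4 * ε ^ 2 * x 2 / (1 + ε ^ 2 * ‖x‖ ^ 2) : ℝ) : ℂ) + ((β * 0 : ℝ) : ℂ)) =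
          Complex.I * ((4 * ε ^ 2 * x 2 / (1 + ε ^ 2 * ‖x‖ ^ 2) : ℝ) : ℂ) := by
      simp [dir]
    rw [e, norm_mul, norm_mul, Complex.norm_I, one_mul, Complex.norm_real]
    gcongr
    refine le_trans ?_ (norm_trial_mul_le hε x)
    rw [Real.norm_eq_abs, abs_div, abs_mul, abs_of_nonneg (by positivity : 0 ≤ 4 * ε ^ 2),
      abs_of_pos (bracket_pos ε x)]
    gcongr
    exact abs_coord_le x 2
  have h5 := pow_le_pow_left₀ (norm_nonneg _) h3 2
  have h6 := pow_le_pow_left₀ (norm_nonneg _) h4 2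
  rw [mul_pow, mul_pow] at h5 h6
  linarith

end trialFun

theorem volume_box (a : Fin 3 → ℝ) :
    volume {x : Space | ∀ i, |x i| ≤ a i} = ∏ i, ENNReal.ofReal (2 * a i) := by
  have h := (EuclideanSpace.volume_preserving_symm_measurableEquiv_toLp (Fin 3)).measure_preimage
    (measurableSet_Icc (a := -a) (b := a)).nullMeasurableSet
  rw [Real.volume_Icc_pi] at h
  convert h using 2
  · ext x
    simp [Pi.le_def, abs_le, forall_and]
  · simp [two_mul]

/-- The mass of the trial function becomes large, as it extends over a length `1 / ε` along the
magnetic field. -/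
theorem le_norm_trialVec_sq {β ε : ℝ} (hβ : 0 ≤ β) (hε : 0 < ε) (hε1 : ε ≤ 1) :
    Real.exp (-β) / 32 * ε⁻¹ ≤ ‖trialVec hβ hε‖ ^ 2 := by
  -- On the box `|x₁|, |x₂| ≤ 1`, `|x₃| ≤ 1 / ε` the trial function is bounded below.
  set B : Set Space := {x | ∀ i, |x i| ≤ ![1, 1, ε⁻¹] i} with hB
  have hvol : volume B = ENNReal.ofReal (8 * ε⁻¹) := by
    rw [hB, volume_box, Fin.prod_univ_three, ← ENNReal.ofReal_mul (by simp),
      ← ENNReal.ofReal_mul (by simp)]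
    congr 1
    simp
    ring
  have hmB : MeasurableSet B := by
    simp only [hB, Set.ofPred_forall]
    exact MeasurableSet.iInter fun i => measurableSet_le (by fun_prop) measurable_const
  have hlow : ∀ x ∈ B, Real.exp (-β) / 256 ≤ trialFun β ε x ^ 2 := by
    intro x hx
    have h0 : x 0 ^ 2 ≤ 1 := by
      have := hx 0
      rw [sq_le_one_iff_abs_le_one]; simpa using this
    have h1 : x 1 ^ 2 ≤ 1 := by
      have := hx 1
      rw [sq_le_one_iff_abs_le_one]; simpa using this
    have h2 : ε ^ 2 * x 2 ^ 2 ≤ 1 := by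
      have h3 : |x 2| ≤ ε⁻¹ := by simpa using hx 2
      rw [← mul_pow, sq_le_one_iff_abs_le_one, abs_mul, abs_of_pos hε]
      calc ε * |x 2| ≤ ε * ε⁻¹ := by gcongr
        _ = 1 := mul_inv_cancel₀ hε.ne'
    have h3 : 1 + ε ^ 2 * ‖x‖ ^ 2 ≤ 4 := by
      rw [norm_sq_eq_sum, Fin.sum_univ_three]
      have h4 : ε ^ 2 ≤ 1 := pow_le_one₀ hε.le hε1
      nlinarith [sq_nonneg (x 0), sq_nonneg (x 1), sq_nonneg ε]
    have h5 : (16 : ℝ)⁻¹ ≤ ((1 + ε ^ 2 * ‖x‖ ^ 2) ^ 2)⁻¹ := by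
      have := bracket_pos ε x
      refine inv_anti₀ (by positivity) ?_
      nlinarith
    have h6 : Real.exp (-β / 2) ≤ Real.exp (-(β / 4) * (x 0 ^ 2 + x 1 ^ 2)) := by
      refine Real.exp_le_exp.2 ?_
      nlinarith
    have h7 : Real.exp (-β / 2) * 16⁻¹ ≤ trialFun β ε x :=
      mul_le_mul h6 h5 (by norm_num) (Real.exp_pos _).le
    refine le_trans (le_of_eq ?_) (pow_le_pow_left₀ (by positivity) h7 2)
    rw [mul_pow, ← Real.exp_nat_mul, show ((2 : ℕ) : ℝ) * (-β / 2) = -β by push_cast; ring]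
    norm_num
    ring
  have h : ENNReal.ofReal (Real.exp (-β) / 32 * ε⁻¹) ≤ ENNReal.ofReal (‖trialVec hβ hε‖ ^ 2) := by
    rw [← enorm_sq_eq_ofReal, enorm_L2_sq,
      show Real.exp (-β) / 32 * ε⁻¹ = Real.exp (-β) / 256 * (8 * ε⁻¹) by ring,
      ENNReal.ofReal_mul (by positivity), ← hvol, ← lintegral_indicator_const hmB]
    refine lintegral_mono_ae ?_
    filter_upwards [(memLp_trialFun hβ hε).coeFn_toLp] with x hx
    by_cases hxB : x ∈ B
    · rw [Set.indicator_of_mem hxB, trialVec, hx, enorm_sq_eq_ofReal, Complex.norm_real,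
        Real.norm_eq_abs, sq_abs]
      exact ENNReal.ofReal_le_ofReal (hlow x hxB)
    · rw [Set.indicator_of_notMem hxB]
      exact zero_le
  exact (ENNReal.ofReal_le_ofReal_iff (by positivity)).1 h

/-- The Coulomb potential of a ball. -/
def ballPotential (R : ℝ) : ℝ≥0∞ :=
  ∫⁻ y : Space, (Metric.ball (0 : Space) R).indicator (fun y => ‖y‖ₑ⁻¹) y

theorem ballPotential_ne_top (R : ℝ) : ballPotential R ≠ ⊤ := by
  have h1 : IntegrableOn (fun y : Space => ‖y‖⁻¹) (Metric.ball 0 R) volume := by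
    rw [integrableOn_fun_norm_addHaar (μ := volume) (f := fun t : ℝ => t⁻¹)]
    have h2 : IntegrableOn (fun y : ℝ => y) (Set.Ioo 0 R) volume :=
      (continuous_id.integrableOn_Icc (a := 0) (b := R)).mono_set Set.Ioo_subset_Icc_self
    refine h2.congr_fun (fun y hy => ?_) measurableSet_Ioo
    have hy0 : y ≠ 0 := hy.1.ne'
    simp
    field_simp
  have h3 := h1.hasFiniteIntegral
  rw [hasFiniteIntegral_iff_enorm] at h3
  rw [ballPotential, lintegral_indicator measurableSet_ball]
  refine ne_top_of_le_ne_top h3.ne (lintegral_mono_ae ?_)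
  have h0 : ∀ᵐ y : Space ∂(volume.restrict (Metric.ball 0 R)), y ≠ 0 :=
    ae_restrict_of_ae (by simp [ae_iff])
  filter_upwards [h0] with y hy
  rw [enorm_inv (norm_ne_zero_iff.2 hy), enorm_norm]

/-- The Coulomb potential of a density bounded by one: points at distance less than `R` contribute at
most `ballPotential R`. -/
theorem lintegral_div_le_ballPotential {τ : Space → ℝ≥0∞} (hτm : Measurable τ)
    (hτ : ∀ᵐ y, τ y ≤ 1) {R : ℝ} (hR : 0 < R) (x : Space) :
    ∫⁻ y, τ y / ‖y - x‖ₑ ≤ ballPotential R + ENNReal.ofReal R⁻¹ * ∫⁻ y, τ y := by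
  have hm : Measurable fun y : Space => (Metric.ball (0 : Space) R).indicator
      (fun y => ‖y‖ₑ⁻¹) y :=
    (by fun_prop : Measurable fun x : Space => ‖x‖ₑ⁻¹).indicator measurableSet_ball
  calc ∫⁻ y, τ y / ‖y - x‖ₑ ≤ ∫⁻ y, ((Metric.ball (0 : Space) R).indicator (fun y => ‖y‖ₑ⁻¹) (y - x) +
        ENNReal.ofReal R⁻¹ * τ y) := by
        refine lintegral_mono_ae ?_
        filter_upwards [hτ] with y hy
        rw [div_eq_mul_inv]
        by_cases h : y - x ∈ Metric.ball (0 : Space) R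
        · rw [Set.indicator_of_mem h]
          exact (mul_le_of_le_one_left' hy).trans le_self_add
        · rw [Set.indicator_of_notMem h, zero_add, mul_comm]
          gcongr
          exact inv_enorm_le_of_le hR (by simpa using h)
    _ = _ := by
        rw [lintegral_add_right _ (hτm.const_mul _), lintegral_const_mul _ hτm,
          lintegral_sub_right_eq_self (fun y => (Metric.ball (0 : Space) R).indicator
            (fun y => ‖y‖ₑ⁻¹) y) x, ballPotential]

/-- There are density matrices of trace one whose energy above the lowest Landau level and whose
Coulomb potential are arbitrarily small. -/
theorem exists_spread_out {β : ℝ} (hβ : 0 ≤ β) {η : ℝ} (hη : 0 < η) :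
    ∃ Γ : DensityMatrix, Γ.HasFiniteMagneticKineticEnergy β ∧ Γ.trace = 1 ∧
      (landauEnergy β Γ.op).toReal ≤ η ∧
      ∀ x, ∫⁻ y, Γ.density y / ‖y - x‖ₑ ≤ ENNReal.ofReal η := by
  -- After normalization the Coulomb potential is at most `ballPotential R / N + 1 / R`, where the mass
  -- `N` of the trial function is at least `exp (-β) / (32 ε)`; with `R = 2 / η` both terms are at most
  -- `η / 2` for small `ε`.
  set K := (ballPotential (2 / η)).toReal * (32 * Real.exp β) with hK
  have hK0 : 0 ≤ K := by positivity
  set ε := min 1 (min (η / 32) (η / 2 / (K + 1))) with hεdef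
  have hε : 0 < ε := by positivity
  have hε1 : ε ≤ 1 := min_le_left _ _
  have hε2 : ε ≤ η / 32 := (min_le_right _ _).trans (min_le_left _ _)
  have hε3 : ε ≤ η / 2 / (K + 1) := (min_le_right _ _).trans (min_le_right _ _)
  set u := trialVec hβ hε with hu
  have hN := le_norm_trialVec_sq hβ hε hε1
  rw [← hu] at hN
  have hN0 : 0 < ‖u‖ ^ 2 := lt_of_lt_of_le (by positivity) hN
  obtain ⟨hfin, hL⟩ := landauEnergy_trialVec_le hβ hε
  rw [← hu] at hfin hL
  set c : ℝ≥0 := (‖u‖ ^ 2)⁻¹.toNNReal with hc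
  have hcr : (c : ℝ) = (‖u‖ ^ 2)⁻¹ := Real.coe_toNNReal _ (by positivity)
  refine ⟨DensityMatrix.comb c 0 (DensityMatrix.pure u) (DensityMatrix.pure u), hfin.comb hfin c 0,
    ?_, ?_, fun x => ?_⟩
  · rw [DensityMatrix.trace_comb, DensityMatrix.trace_pure, hcr]
    simp [hN0.ne']
  · rw [DensityMatrix.landauEnergy_comb]
    simp only [ENNReal.coe_zero, zero_mul, add_zero, ENNReal.toReal_mul, ENNReal.coe_toReal]
    rw [hcr, inv_mul_le_iff₀ hN0]
    refine hL.trans ?_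
    rw [mul_comm (‖u‖ ^ 2)]
    gcongr
    nlinarith
  · have hden : (DensityMatrix.comb c 0 (DensityMatrix.pure u) (DensityMatrix.pure u)).density
        =ᵐ[volume] fun y => (c : ℝ≥0∞) * ‖u y‖ₑ ^ 2 := by
      filter_upwards [DensityMatrix.density_comb c 0 (DensityMatrix.pure u) (DensityMatrix.pure u),
        DensityMatrix.density_pure u] with y h1 h2
      rw [h1, h2]
      simp
    have hle : ∀ᵐ y, ‖u y‖ₑ ^ 2 ≤ 1 := by
      filter_upwards [(memLp_trialFun hβ hε).coeFn_toLp] with y hy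
      rw [hu, trialVec, hy, enorm_sq_eq_ofReal, Complex.norm_real,
        Real.norm_of_nonneg (trialFun_pos β ε y).le]
      rw [ENNReal.ofReal_le_one]
      exact pow_le_one₀ (trialFun_pos β ε y).le (trialFun_le_one hβ ε y)
    have hm := DensityMatrix.measurable_enorm_sq u
    have h1 := lintegral_div_le_ballPotential hm hle (R := 2 / η) (by positivity) x
    rw [← enorm_L2_sq, enorm_sq_eq_ofReal] at h1
    have h2 : ∫⁻ y, (DensityMatrix.comb c 0 (DensityMatrix.pure u) (DensityMatrix.pure u)).density y /
        ‖y - x‖ₑ = c * ∫⁻ y, ‖u y‖ₑ ^ 2 / ‖y - x‖ₑ := by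
      rw [← lintegral_const_mul _ (show Measurable fun y => ‖u y‖ₑ ^ 2 / ‖y - x‖ₑ from
        hm.div (by fun_prop))]
      refine lintegral_congr_ae ?_
      filter_upwards [hden] with y hy
      rw [hy, mul_div_assoc]
    rw [h2]
    refine (mul_le_mul_right h1 _).trans ?_
    rw [← ENNReal.ofReal_toReal (ballPotential_ne_top (2 / η)), ← ENNReal.ofReal_mul (by positivity),
      ← ENNReal.ofReal_add (by positivity) (by positivity), ← ENNReal.ofReal_coe_nnreal,
      ← ENNReal.ofReal_mul (by positivity), hcr]
    refine ENNReal.ofReal_le_ofReal ?_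
    rw [inv_mul_le_iff₀ hN0, inv_div]
    have h3 : (ballPotential (2 / η)).toReal ≤ η / 2 * ‖u‖ ^ 2 := by
      refine le_trans ?_ (mul_le_mul_of_nonneg_left hN (by positivity))
      have h4 : K * ε ≤ η / 2 := by
        rw [le_div_iff₀ (by positivity)] at hε3
        nlinarith
      have h5 : (ballPotential (2 / η)).toReal = K * ε * (Real.exp (-β) / 32 * ε⁻¹) := by
        rw [hK, Real.exp_neg]
        field_simp
      rw [h5]
      gcongr
    linarith

/-- Missing mass can be added far away from the nucleus at an arbitrarily small cost. -/
theorem exists_trace_eq_hartree_le {β lam : ℝ} (hβ : 0 ≤ β) {Γ : DensityMatrix}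
    (hΓ : Γ.HasFiniteMagneticKineticEnergy β) (hlam : Γ.trace ≤ lam) {η : ℝ} (hη : 0 < η) :
    ∃ Γ' : DensityMatrix, Γ'.HasFiniteMagneticKineticEnergy β ∧ Γ'.trace = lam ∧
      hartree β Γ' ≤ hartree β Γ + η := by
  have ht := Γ.trace_nonneg
  have hlam0 : 0 ≤ lam := ht.trans hlam
  -- The total cost is at most `(lam + 3 lam²) θ`.
  set θ := η / (lam + 3 * lam ^ 2 + 1) with hθdef
  have hθ : 0 < θ := by positivity
  obtain ⟨Γ₀, hfin, htr, hL, hV⟩ := exists_spread_out hβ hθ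
  set δ : ℝ≥0 := (lam - Γ.trace).toNNReal
  have hδ : (δ : ℝ) = lam - Γ.trace := Real.coe_toNNReal _ (by linarith)
  have hδ0 : (0 : ℝ) ≤ δ := δ.2
  have hfin' := hΓ.comb hfin 1 δ
  refine ⟨DensityMatrix.comb 1 δ Γ Γ₀, hfin', ?_, ?_⟩
  · rw [DensityMatrix.trace_comb, htr, hδ]
    simp
  have hden := DensityMatrix.density_comb 1 δ Γ Γ₀
  have hA : (attraction Γ.density).toReal ≤
      (attraction (DensityMatrix.comb 1 δ Γ Γ₀).density).toReal := by
    refine ENNReal.toReal_mono (DensityMatrix.attraction_lt_top hfin').ne (lintegral_mono_ae ?_)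
    filter_upwards [hden] with x hx
    rw [hx]
    gcongr
    simp
  have hLan : (landauEnergy β (DensityMatrix.comb 1 δ Γ Γ₀).op).toReal ≤
      (landauEnergy β Γ.op).toReal + δ * θ := by
    rw [DensityMatrix.landauEnergy_comb, ENNReal.toReal_add
      (ENNReal.mul_ne_top (by simp) (DensityMatrix.landauEnergy_ne_top hβ hΓ))
      (ENNReal.mul_ne_top (by simp) (DensityMatrix.landauEnergy_ne_top hβ hfin))]
    simp only [ENNReal.toReal_mul, ENNReal.coe_toReal, NNReal.coe_one, one_mul]
    gcongr
  have hD1 : repulsion Γ.density Γ₀.density ≤ ENNReal.ofReal (lam * θ) := by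
    refine (repulsion_le Γ.measurable_density Γ₀.measurable_density hV).trans ?_
    rw [Γ.lintegral_density, ← ENNReal.ofReal_mul ht]
    exact ENNReal.ofReal_le_ofReal (by gcongr)
  have hD2 : repulsion Γ₀.density Γ₀.density ≤ ENNReal.ofReal θ := by
    refine (repulsion_le Γ₀.measurable_density Γ₀.measurable_density hV).trans ?_
    rw [Γ₀.lintegral_density, htr]
    simp
  have hD : (repulsion (DensityMatrix.comb 1 δ Γ Γ₀).density
      (DensityMatrix.comb 1 δ Γ Γ₀).density).toReal ≤
        (repulsion Γ.density Γ.density).toReal + (2 * δ * (lam * θ) + δ * δ * θ) := by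
    rw [repulsion_congr_ae hden hden, repulsion_comb Γ.measurable_density Γ₀.measurable_density]
    have hfinD := (DensityMatrix.repulsion_lt_top hΓ).ne
    refine ENNReal.toReal_le_of_le_ofReal (by positivity) ?_
    rw [ENNReal.ofReal_add (by positivity) (by positivity), ENNReal.ofReal_toReal hfinD,
      ENNReal.ofReal_add (by positivity) (by positivity), ENNReal.ofReal_mul (by positivity),
      ENNReal.ofReal_mul (by positivity), ENNReal.ofReal_mul (p := δ * δ) (by positivity),
      ENNReal.ofReal_mul (p := δ) (by positivity), ENNReal.ofReal_coe_nnreal, ENNReal.ofReal_ofNat,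
      ← add_assoc]
    simp only [ENNReal.coe_one, one_mul]
    gcongr
  rw [DensityMatrix.hartree_eq hβ hΓ, DensityMatrix.hartree_eq hβ hfin']
  have h1 : δ * θ + (2 * δ * (lam * θ) + δ * δ * θ) ≤ η := by
    have h2 : (δ : ℝ) ≤ lam := by rw [hδ]; linarith
    calc δ * θ + (2 * δ * (lam * θ) + δ * δ * θ) ≤
          lam * θ + (2 * lam * (lam * θ) + lam * lam * θ) := by gcongr
      _ = (lam + 3 * lam ^ 2) * θ := by ring
      _ ≤ (lam + 3 * lam ^ 2 + 1) * θ := mul_le_mul_of_nonneg_right (by linarith) hθ.le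
      _ = η := by rw [hθdef]; field_simp
  linarith

/-! ### Existence and uniqueness of minimizers -/

/-- The Hartree functional controls the kinetic energy. -/
theorem kinetic_le_hartree {β lam : ℝ} (hβ : 0 ≤ β) {Γ : DensityMatrix}
    (hΓ : Γ.HasFiniteMagneticKineticEnergy β) (hlam : Γ.trace ≤ lam) :
    (Γ.magneticKineticEnergy β).toReal / 2 ≤ hartree β Γ + (β + 2) * lam := by
  have h1 := ENNReal.toReal_mono (ENNReal.add_ne_top.2 ⟨ENNReal.mul_ne_top (by simp) hΓ.ne,
    ENNReal.mul_ne_top (by simp) (by simp)⟩) (DensityMatrix.attraction_le β Γ)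
  rw [ENNReal.toReal_add (ENNReal.mul_ne_top (by simp) hΓ.ne)
    (ENNReal.mul_ne_top (by simp) (by simp))] at h1
  simp only [ENNReal.toReal_mul, ENNReal.toReal_inv, ENNReal.toReal_ofNat,
    ENNReal.toReal_ofReal Γ.trace_nonneg] at h1
  have h2 : (0 : ℝ) ≤ (repulsion Γ.density Γ.density).toReal := ENNReal.toReal_nonneg
  have h3 : (β + 2) * Γ.trace ≤ (β + 2) * lam := by gcongr
  rw [hartree]
  linarith

/-- Semicontinuity of the Hartree functional along a weakly convergent sequence of bounded kinetic
energy whose energies converge. -/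
theorem hartree_le_of_tendsto {β lam M E : ℝ} (hβ : 0 ≤ β) {Γn : ℕ → DensityMatrix}
    {Γ : DensityMatrix} (hfin : ∀ n, (Γn n).HasFiniteMagneticKineticEnergy β)
    (hlam : ∀ n, (Γn n).trace ≤ lam)
    (hM : ∀ n, (Γn n).magneticKineticEnergy β ≤ ENNReal.ofReal M)
    (hlim : ∀ x, Tendsto (fun n => ⟪x, (Γn n).op x⟫_ℂ) atTop (𝓝 ⟪x, Γ.op x⟫_ℂ))
    (hE : Tendsto (fun n => hartree β (Γn n)) atTop (𝓝 E)) :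
    Γ.HasFiniteMagneticKineticEnergy β ∧ hartree β Γ ≤ E := by
  have hΓ : Γ.HasFiniteMagneticKineticEnergy β := by
    refine (DensityMatrix.magneticKineticEnergy_le_liminf β hlim).trans_lt ?_
    refine (liminf_le_liminf (Eventually.of_forall hM)).trans_lt ?_
    simp
  refine ⟨hΓ, ?_⟩
  have hL := DensityMatrix.landauEnergy_le_liminf β hlim
  have hD := DensityMatrix.repulsion_le_liminf hlim
  have hA := DensityMatrix.limsup_attraction_le β hlam hM hlim
  have hAfin := (DensityMatrix.attraction_lt_top hΓ).ne
  have hLfin := DensityMatrix.landauEnergy_ne_top hβ hΓ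
  have hDfin := (DensityMatrix.repulsion_lt_top hΓ).ne
  have hLn := fun n => DensityMatrix.landauEnergy_ne_top hβ (hfin n)
  have hDn := fun n => (DensityMatrix.repulsion_lt_top (hfin n)).ne
  have hAn := fun n => (DensityMatrix.attraction_lt_top (hfin n)).ne
  have hLD := DensityMatrix.le_liminf_add hL hD
  -- Each one-sided limit costs `ε / 2`; the three terms are finite, so real arithmetic applies.
  refine le_of_forall_pos_le_add fun ε hε => ?_
  have e1 : ∀ᶠ n in atTop, (attraction (Γn n).density).toReal ≤
      (attraction Γ.density).toReal + ε / 2 := by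
    have h1 : limsup (fun n => attraction (Γn n).density) atTop <
        attraction Γ.density + ENNReal.ofReal (ε / 2) :=
      hA.trans_lt (ENNReal.lt_add_right hAfin (by simpa using hε))
    filter_upwards [eventually_lt_of_limsup_lt h1] with n hn
    have h2 := ENNReal.toReal_mono (by simp [hAfin]) hn.le
    rwa [ENNReal.toReal_add hAfin (by simp), ENNReal.toReal_ofReal (by positivity)] at h2
  have e2 : ∀ᶠ n in atTop, (landauEnergy β Γ.op).toReal + (repulsion Γ.density Γ.density).toReal ≤
      (landauEnergy β (Γn n).op).toReal + (repulsion (Γn n).density (Γn n).density).toReal +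
        ε / 2 := by
    rw [← ENNReal.toReal_add hLfin hDfin]
    by_cases h0 : landauEnergy β Γ.op + repulsion Γ.density Γ.density = 0
    · refine Eventually.of_forall fun n => ?_
      rw [h0]
      simp only [ENNReal.toReal_zero]
      positivity
    have h1 : landauEnergy β Γ.op + repulsion Γ.density Γ.density - ENNReal.ofReal (ε / 2) <
        liminf (fun n => landauEnergy β (Γn n).op + repulsion (Γn n).density (Γn n).density) atTop :=
      (ENNReal.sub_lt_self (ENNReal.add_ne_top.2 ⟨hLfin, hDfin⟩) h0
        (by simpa using hε)).trans_le hLD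
    filter_upwards [eventually_lt_of_lt_liminf h1] with n hn
    have h2 := ENNReal.toReal_mono (by simp [hLn, hDn]) (tsub_le_iff_right.1 hn.le)
    rwa [ENNReal.toReal_add (ENNReal.add_ne_top.2 ⟨hLn n, hDn n⟩) (by simp),
      ENNReal.toReal_add (hLn n) (hDn n), ENNReal.toReal_ofReal (by positivity)] at h2
  refine ge_of_tendsto (hE.add_const ε) ?_
  filter_upwards [e1, e2] with n h1 h2
  rw [DensityMatrix.hartree_eq hβ hΓ, DensityMatrix.hartree_eq hβ (hfin n)]
  linarith

/-- The values of the Hartree functional under the relaxed condition `Tr[Γ] ≤ lam`. -/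
def relaxedEnergyValues (β lam : ℝ) : Set ℝ :=
  {E | ∃ Γ : DensityMatrix, Γ.HasFiniteMagneticKineticEnergy β ∧ Γ.trace ≤ lam ∧ hartree β Γ = E}

theorem bddBelow_relaxedEnergyValues {β lam : ℝ} (hβ : 0 ≤ β) :
    BddBelow (relaxedEnergyValues β lam) := by
  refine ⟨-((β + 2) * lam), ?_⟩
  rintro _ ⟨Γ, hΓ, hlam, rfl⟩
  have h1 := kinetic_le_hartree hβ hΓ hlam
  have h2 : (0 : ℝ) ≤ (Γ.magneticKineticEnergy β).toReal := ENNReal.toReal_nonneg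
  linarith

theorem relaxedEnergyValues_nonempty {β lam : ℝ} (hlam : 0 ≤ lam) :
    (relaxedEnergyValues β lam).Nonempty := by
  refine ⟨_, DensityMatrix.pure 0, ?_, ?_, rfl⟩
  · rw [DensityMatrix.HasFiniteMagneticKineticEnergy, DensityMatrix.magneticKineticEnergy_pure,
      magneticForm_eq_tsum]
    simp
  · rw [DensityMatrix.trace_pure]
    simpa using hlam

theorem exists_isMinimizer {β lam : ℝ} (hβ : 0 ≤ β) (hlam : 0 ≤ lam) :
    ∃ Γ, IsMinimizer β lam Γ := by
  have hbdd := bddBelow_relaxedEnergyValues (lam := lam) hβ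
  obtain ⟨E, hEanti, hE, hmem⟩ :=
    exists_seq_tendsto_sInf (relaxedEnergyValues_nonempty (β := β) hlam) hbdd
  choose Γn hfin htr hval using hmem
  obtain ⟨φ, Γ, hφ, hΓtr, hlim⟩ := exists_subseq_tendsto htr
  have hM : ∀ n, (Γn n).magneticKineticEnergy β ≤
      ENNReal.ofReal (2 * (E 0 + (β + 2) * lam)) := fun n => by
    rw [← ENNReal.ofReal_toReal (hfin n).ne]
    refine ENNReal.ofReal_le_ofReal ?_
    have h1 := kinetic_le_hartree hβ (hfin n) (htr n)
    rw [hval] at h1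
    linarith [hEanti (Nat.zero_le n)]
  have hE' : Tendsto (fun n => hartree β (Γn (φ n))) atTop (𝓝 (sInf (relaxedEnergyValues β lam))) := by
    simp_rw [hval]
    exact hE.comp hφ.tendsto_atTop
  obtain ⟨hΓ, hle⟩ := hartree_le_of_tendsto hβ (fun n => hfin (φ n)) (fun n => htr (φ n))
    (fun n => hM (φ n)) (fun x => hlim x x) hE'
  exact ⟨Γ, hΓ, hΓtr, fun Γ' h1 h2 => hle.trans (csInf_le hbdd ⟨Γ', h1, h2, rfl⟩)⟩

theorem energyValues_subset (β lam : ℝ) : energyValues β lam ⊆ relaxedEnergyValues β lam := by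
  rintro _ ⟨Γ, h1, h2, h3⟩
  exact ⟨Γ, h1, h2.le, h3⟩

theorem energyValues_nonempty {β lam : ℝ} (hβ : 0 ≤ β) (hlam : 0 ≤ lam) :
    (energyValues β lam).Nonempty := by
  obtain ⟨_, Γ, h1, h2, -⟩ := relaxedEnergyValues_nonempty (β := β) hlam
  obtain ⟨Γ', h3, h4, -⟩ := exists_trace_eq_hartree_le hβ h1 h2 one_pos
  exact ⟨_, Γ', h3, h4, rfl⟩

/-- The Hartree energy, an infimum under `Tr[Γ] = lam`, is attained under `Tr[Γ] ≤ lam`. -/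
theorem hartreeEnergy_eq_of_isMinimizer {β lam : ℝ} (hβ : 0 ≤ β) {Γ : DensityMatrix}
    (h : IsMinimizer β lam Γ) : hartreeEnergy lam β = hartree β Γ := by
  have hlam := Γ.trace_nonneg.trans h.2.1
  refine le_antisymm (le_of_forall_pos_le_add fun η hη => ?_)
    (le_csInf (energyValues_nonempty hβ hlam) ?_)
  · obtain ⟨Γ', h1, h2, h3⟩ := exists_trace_eq_hartree_le hβ h.1 h.2.1 hη
    exact (csInf_le ((bddBelow_relaxedEnergyValues hβ).mono (energyValues_subset β lam))
      ⟨Γ', h1, h2, rfl⟩).trans h3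
  · rintro _ ⟨Γ', h1, h2, rfl⟩
    exact h.2.2 Γ' h1 h2.le

/-- Two minimizers have the same density, as the midpoint would have a lower energy otherwise. -/
theorem IsMinimizer.density_ae_eq {β lam : ℝ} (hβ : 0 ≤ β) {Γ₁ Γ₂ : DensityMatrix}
    (h₁ : IsMinimizer β lam Γ₁) (h₂ : IsMinimizer β lam Γ₂) :
    Γ₁.density =ᵐ[volume] Γ₂.density := by
  set Γ := DensityMatrix.comb 2⁻¹ 2⁻¹ Γ₁ Γ₂ with hΓdef
  have hΓ : Γ.HasFiniteMagneticKineticEnergy β := h₁.1.comb h₂.1 _ _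
  have htr : Γ.trace ≤ lam := by
    rw [hΓdef, DensityMatrix.trace_comb]
    push_cast
    linarith [h₁.2.1, h₂.2.1]
  have hm₁ := Γ₁.measurable_density
  have hm₂ := Γ₂.measurable_density
  have hden := DensityMatrix.density_comb 2⁻¹ 2⁻¹ Γ₁ Γ₂
  have hL : (landauEnergy β Γ.op).toReal =
      ((landauEnergy β Γ₁.op).toReal + (landauEnergy β Γ₂.op).toReal) / 2 := by
    rw [hΓdef, DensityMatrix.landauEnergy_comb, ENNReal.toReal_add
      (ENNReal.mul_ne_top (by simp) (DensityMatrix.landauEnergy_ne_top hβ h₁.1))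
      (ENNReal.mul_ne_top (by simp) (DensityMatrix.landauEnergy_ne_top hβ h₂.1))]
    simp only [ENNReal.toReal_mul, ENNReal.coe_toReal]
    push_cast
    ring
  have hA : (attraction Γ.density).toReal =
      ((attraction Γ₁.density).toReal + (attraction Γ₂.density).toReal) / 2 := by
    have e : attraction Γ.density =
        ((2⁻¹ : ℝ≥0) : ℝ≥0∞) * attraction Γ₁.density +
          ((2⁻¹ : ℝ≥0) : ℝ≥0∞) * attraction Γ₂.density := by
      have d₁ : Measurable fun x => Γ₁.density x / ‖x‖ₑ := hm₁.div (by fun_prop)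
      have d₂ : Measurable fun x => Γ₂.density x / ‖x‖ₑ := hm₂.div (by fun_prop)
      rw [attraction, attraction, attraction, ← lintegral_const_mul _ d₁,
        ← lintegral_const_mul _ d₂, ← lintegral_add_left (d₁.const_mul _)]
      refine lintegral_congr_ae ?_
      filter_upwards [hden] with x hx
      rw [hx]
      simp only [div_eq_mul_inv]
      ring
    rw [e, ENNReal.toReal_add
      (ENNReal.mul_ne_top (by simp) (DensityMatrix.attraction_lt_top h₁.1).ne)
      (ENNReal.mul_ne_top (by simp) (DensityMatrix.attraction_lt_top h₂.1).ne)]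
    simp only [ENNReal.toReal_mul, ENNReal.coe_toReal]
    push_cast
    ring
  have hD₁ := (DensityMatrix.repulsion_lt_top h₁.1).ne
  have hD₂ := (DensityMatrix.repulsion_lt_top h₂.1).ne
  have hD₁₂ : repulsion Γ₁.density Γ₂.density ≠ ⊤ := by
    have := repulsion_add_repulsion_le hm₁ hm₂
    exact (ENNReal.add_ne_top.1 (ne_top_of_le_ne_top (ENNReal.add_ne_top.2 ⟨hD₁, hD₂⟩) this)).1
  have hD : (repulsion Γ.density Γ.density).toReal =
      ((repulsion Γ₁.density Γ₁.density).toReal + 2 * (repulsion Γ₁.density Γ₂.density).toReal +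
        (repulsion Γ₂.density Γ₂.density).toReal) / 4 := by
    rw [repulsion_congr_ae hden hden, repulsion_comb hm₁ hm₂, ENNReal.toReal_add (by finiteness)
      (by finiteness), ENNReal.toReal_add (by finiteness) (by finiteness)]
    simp only [ENNReal.toReal_mul, ENNReal.coe_toReal, ENNReal.toReal_ofNat]
    push_cast
    ring
  -- The sum of the two inequalities is `D[ρ₁, ρ₁] + D[ρ₂, ρ₂] ≤ 2 D[ρ₁, ρ₂]`.
  have m₁ := h₁.2.2 Γ hΓ htr
  have m₂ := h₂.2.2 Γ hΓ htr
  rw [DensityMatrix.hartree_eq hβ hΓ, hL, hA, hD] at m₁ m₂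
  rw [DensityMatrix.hartree_eq hβ h₁.1] at m₁
  rw [DensityMatrix.hartree_eq hβ h₂.1] at m₂
  refine ae_eq_of_repulsion_le hm₁ hm₂ (by rw [Γ₁.lintegral_density]; simp)
    (by rw [Γ₂.lintegral_density]; simp) hD₁₂ ?_
  refine (ENNReal.toReal_le_toReal (ENNReal.add_ne_top.2 ⟨hD₁, hD₂⟩)
    (ENNReal.add_ne_top.2 ⟨hD₁₂, hD₁₂⟩)).1 ?_
  rw [ENNReal.toReal_add hD₁ hD₂, ENNReal.toReal_add hD₁₂ hD₁₂]
  linarith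

end MagneticHartree

end

theorem mainTheorem7 (β lam : ℝ) (hβ : 0 ≤ β) (hlam : 0 < lam) :
    (∀ Γ : MagneticHartree.DensityMatrix, Γ.HasFiniteMagneticKineticEnergy β →
      MagneticHartree.attraction Γ.density < ⊤ ∧
        MagneticHartree.repulsion Γ.density Γ.density < ⊤) ∧
    (MagneticHartree.energyValues β lam).Nonempty ∧
    BddBelow (MagneticHartree.energyValues β lam) ∧
    (∃ Γ : MagneticHartree.DensityMatrix, MagneticHartree.IsMinimizer β lam Γ ∧
      MagneticHartree.hartreeEnergy lam β = MagneticHartree.hartree β Γ) ∧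
    (∀ Γ₁ Γ₂ : MagneticHartree.DensityMatrix,
      MagneticHartree.IsMinimizer β lam Γ₁ → MagneticHartree.IsMinimizer β lam Γ₂ →
        Γ₁.density =ᵐ[MeasureTheory.volume] Γ₂.density) := by
  refine ⟨fun Γ h => ⟨MagneticHartree.DensityMatrix.attraction_lt_top h,
    MagneticHartree.DensityMatrix.repulsion_lt_top h⟩,
    MagneticHartree.energyValues_nonempty hβ hlam.le,
    (MagneticHartree.bddBelow_relaxedEnergyValues hβ).mono
      (MagneticHartree.energyValues_subset β lam), ?_,
    fun Γ₁ Γ₂ h₁ h₂ => h₁.density_ae_eq hβ h₂⟩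
  obtain ⟨Γ, hΓ⟩ := MagneticHartree.exists_isMinimizer hβ hlam.le
  exact ⟨Γ, hΓ, MagneticHartree.hartreeEnergy_eq_of_isMinimizer hβ hΓ⟩
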